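/- **Theorem 1 (Read–Shockley formula).** Let $\mu>0$ (shear modulus), $\nu\in[0,1)$ (Poisson ratio), $b>0$ (length of the Burgers vector) and $\gamma_0=\frac{\mu b}{4\pi(1-\nu)}$. For $(x,y)\in\mathbb R^2\setminus\{0\}$ and $r^2=x^2+y^2$ let $$u_0=\frac{-b}{8\pi(1-\nu)}\begin{pmatrix}4(1-\nu)\arctan(x,y)-\frac{2xy}{r^2}\\ (1-2\nu)\log(x^2+y^2)+\frac{x^2-y^2}{r^2}\end{pmatrix},\qquad \sigma_0=\frac{2\gamma_0}{r^4}\begin{pmatrix}-y(3x^2+y^2)&x(x^2-y^2)\\ x(x^2-y^2)&y(x^2-y^2)\end{pmatrix},$$ where $\arctan(x,y)\in(-\pi,\pi]$ is the argument of $y+ix$ (branch cut along $\{(0,y):y<0\}$), and let $\beta_0=\nabla u_0$ be the regular part of the derivative (the jump across the cut is ignored). For $h>0$ let $\Omega_h=\mathbb R\times[-\pi h,\pi h)$ be the periodic strip, $e_2=(0,1)$, and, for $z,z'\in\Omega_h$, $$q^{\rm per}_{z,z'}(\zeta)=\frac12\sum_{n,n'\in\mathbb Z}\beta_0(\zeta-z-2\pi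 nh\,e_2):\sigma_0(\zeta-z'-2\pi n'h\,e_2),\qquad A:B=\operatorname{trace}(A^TB),$$ where the lattice sums are limits of sums over symmetric ranges. Let $B_b(z)$ be the open Euclidean ball of radius $b$ around $z$ in the periodic strip (the union of the balls of radius $b$ around the points $z+2\pi nh\,e_2$, $n\in\mathbb Z$) and put $$U_{\rm self}(z)=\frac1{2\pi h}\int_{\Omega_h\setminus B_b(z)}q^{\rm per}_{z,z}(\zeta)\,d\zeta,\qquad U_{\rm int}(z,z')=\frac1{2\pi h}\int_{\Omega_h}q^{\rm per}_{z,z'}(\zeta)\,d\zeta\quad(z\ne z'),$$ $$\mathcal E(\omega)=\sum_{z\in\omega}U_{\rm self}(z)+\sum_{z,z'\in\omega,\ z\neq z'}U_{\rm int}(z,z')\qquad(\omega\subset\Omega_h\text{ finite}).$$ Then there are constants $C$ and $\theta_0>0$, depending only on $\mu,\nu,b$, such that for all integers $N\ge1$ and all $h>0$ with $\theta:=\frac{Nb}{2\pi h}<\theta_0$ the lattice sums above converge for almost every $\zeta$, the integrals converge absolutely, the minimum of $\mathcal E$ over all $\omega\subset\Omega_h$ with $|\omega|=N$ exists, and $$\Bigl|\min_{\omega\subset\Omega_h,\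 |\omega|=N}\mathcal E(\omega)+\gamma_0\,\theta\log\theta\Bigr|\le C\,\theta .$$ -/

import Mathlib

noncomputable section

namespace ReadShockley

/-- `γ₀ = μ b / (4 π (1 - ν))`. -/
def gammaZero (μ ν b : ℝ) : ℝ := μ * b / (4 * Real.pi * (1 - ν))

/-- The displacement `u₀` of a single edge dislocation at the origin with Burgers vector `(b, 0)`.
The angle is `arctan(x, y) = arg (y + i x) ∈ (-π, π]`, whose branch cut is `{(0, y) : y < 0}`. -/
def displacement (ν b : ℝ) (p : ℝ × ℝ) : Fin 2 → ℝ :=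
  (-b / (8 * Real.pi * (1 - ν))) •
    ![4 * (1 - ν) * Complex.arg ⟨p.2, p.1⟩ - 2 * p.1 * p.2 / (p.1 ^ 2 + p.2 ^ 2),
      (1 - 2 * ν) * Real.log (p.1 ^ 2 + p.2 ^ 2)
        + (p.1 ^ 2 - p.2 ^ 2) / (p.1 ^ 2 + p.2 ^ 2)]

/-- The strain `β₀ = ∇ u₀` with entries `∂_j (u₀)_i`. These are the classical partial derivatives,
which exist off the branch cut; so this is, almost everywhere, the regular part of the
distributional derivative (the jump across the cut is ignored). -/
def strain (ν b : ℝ) (p : ℝ × ℝ) : Matrix (Fin 2) (Fin 2) ℝ :=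
  Matrix.of fun i =>
    ![deriv (fun x : ℝ => displacement ν b (x, p.2) i) p.1,
      deriv (fun y : ℝ => displacement ν b (p.1, y) i) p.2]

/-- The stress `σ₀` of a single edge dislocation at the origin. -/
def stress (μ ν b : ℝ) (p : ℝ × ℝ) : Matrix (Fin 2) (Fin 2) ℝ :=
  (2 * gammaZero μ ν b / (p.1 ^ 2 + p.2 ^ 2) ^ 2) •
    !![-p.2 * (3 * p.1 ^ 2 + p.2 ^ 2), p.1 * (p.1 ^ 2 - p.2 ^ 2);
       p.1 * (p.1 ^ 2 - p.2 ^ 2), p.2 * (p.1 ^ 2 - p.2 ^ 2)]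

/-- The contraction `A : B = trace (Aᵀ B)`. -/
def contract (A B : Matrix (Fin 2) (Fin 2) ℝ) : ℝ := (A.transpose * B).trace

/-- The vector `2 π n h e₂`. -/
def shift (h : ℝ) (n : ℤ) : ℝ × ℝ := (0, 2 * Real.pi * n * h)

/-- The `(n, n')` summand `β₀(ζ - z - 2πnh e₂) : σ₀(ζ - z' - 2πn'h e₂)` of the periodized
interaction. -/
def pairTerm (μ ν b h : ℝ) (z z' ζ : ℝ × ℝ) (n n' : ℤ) : ℝ :=
  contract (strain ν b (ζ - z - shift h n)) (stress μ ν b (ζ - z' - shift h n'))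

/-- The periodized energy density `q^per_{z,z'}`. Since `β₀` and `σ₀` decay only like `1 / r`, the
lattice sums are conditionally convergent and are taken over symmetric ranges `-M ≤ n ≤ M`,
`M → ∞`. -/
def qPer (μ ν b h : ℝ) (z z' ζ : ℝ × ℝ) : ℝ :=
  (1 / 2) * ∑'[SummationFilter.symmetricIcc ℤ] n : ℤ,
    ∑'[SummationFilter.symmetricIcc ℤ] n' : ℤ, pairTerm μ ν b h z z' ζ n n'

/-- Convergence of the lattice sums in `qPer` at the point `ζ`. -/
def QPerConverges (μ ν b h : ℝ) (z z' ζ : ℝ × ℝ) : Prop :=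
  (∀ n : ℤ, Summable (fun n' : ℤ => pairTerm μ ν b h z z' ζ n n')
    (SummationFilter.symmetricIcc ℤ)) ∧
  Summable (fun n : ℤ =>
    ∑'[SummationFilter.symmetricIcc ℤ] n' : ℤ, pairTerm μ ν b h z z' ζ n n')
    (SummationFilter.symmetricIcc ℤ)

/-- The periodic strip `Ω_h = ℝ × [-πh, πh)`: one representative of each point of
`ℝ × (ℝ / 2πhℤ)`. -/
def strip (h : ℝ) : Set (ℝ × ℝ) :=
  Set.univ ×ˢ Set.Ico (-(Real.pi * h)) (Real.pi * h)

/-- The open Euclidean ball of radius `ρ` around `z` in the periodic strip, i.e. the union of the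
balls around all the points `z + 2πnh e₂`. -/
def periodicBall (h ρ : ℝ) (z : ℝ × ℝ) : Set (ℝ × ℝ) :=
  {ζ | ∃ n : ℤ, (ζ - z - shift h n).1 ^ 2 + (ζ - z - shift h n).2 ^ 2 < ρ ^ 2}

/-- The self energy with core radius `ρ`. -/
def uSelf (μ ν b h ρ : ℝ) (z : ℝ × ℝ) : ℝ :=
  1 / (2 * Real.pi * h) * ∫ ζ in strip h \ periodicBall h ρ z, qPer μ ν b h z z ζ

/-- The interaction energy of dislocations at `z` and `z'`. -/
def uInt (μ ν b h : ℝ) (z z' : ℝ × ℝ) : ℝ :=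
  1 / (2 * Real.pi * h) * ∫ ζ in strip h, qPer μ ν b h z z' ζ

/-- The normalized dislocation energy of a finite configuration `ω`, with core radius `ρ = b`. The
second sum runs over ordered pairs of distinct points. -/
def energy (μ ν b h : ℝ) (ω : Finset (ℝ × ℝ)) : ℝ :=
  ∑ z ∈ ω, uSelf μ ν b h b z + ∑ p ∈ ω.offDiag, uInt μ ν b h p.1 p.2

/-- All the lattice sums (almost everywhere) and integrals entering the energy of configurations in
the strip converge. -/
def EnergyWellDefined (μ ν b h : ℝ) : Prop :=
  ∀ z ∈ strip h, ∀ z' ∈ strip h,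
    (∀ᵐ ζ : ℝ × ℝ, QPerConverges μ ν b h z z' ζ) ∧
    (z ≠ z' → MeasureTheory.IntegrableOn (qPer μ ν b h z z') (strip h)) ∧
    MeasureTheory.IntegrableOn (qPer μ ν b h z z) (strip h \ periodicBall h b z)

/-- The tilt angle `θ = N b / (2 π h)`. -/
def tilt (b h : ℝ) (N : ℕ) : ℝ := N * b / (2 * Real.pi * h)

end ReadShockley

end

/-! ### Strain and stress of one dislocation off the line `x = 0`. -/

noncomputable section

namespace ReadShockley

open Real

/-! The energy can be computed in closed form, which turns the theorem into an estimate for a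
logarithmic pair potential on a cylinder.

Off `x = 0`, `β₀ : σ₀` is a multiple of `(1 - 2ν) A A' + B B' + D D'`, where, with `w = x + iy`, `A
= Im (1/w)`, `B = x Im (1/w²)`, `D = x Re (1/w²)`. Vertical translations do not touch the factor
`x`, so the lattice sums are the partial fraction series of `cot` and `1/sin²` (`qPer_eq`). In `y`
the periodized fields are one-sided Fourier series in powers of `exp (-|x| + iy)`; Parseval gives
the integral over each vertical line (`integral_density_unit`), and the remaining integral in `x`
has an elementary antiderivative. The result (`uInt_eq`) is `U_int = (γ₀ b / 2πh) · pot`, where for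
`X ≠ 0` one has `pot (X, Y) = ∑ (1/n + |X|) exp (-n|X|) cos (nY)`, summed over `n ≥ 1`. The same
antiderivative shows that the self energy is `(γ₀ b / 2πh) (-log (b/h) + O(1))`
(`abs_setIntegral_selfDensity_add_log_le`).

It remains to show that the minimum of the sum of `pot` over ordered pairs of `N` points is `-N log
N + O(N)`. The upper bound comes from the equispaced vertical wall, where the sum is exactly `-N log
N` because the distances from one `N`-th root of unity to the others multiply to `N`. For the lower
bound, damp the Fourier coefficients by `exp (-nε)`. The damped potential is positive definite,
since `(1 + |x|) exp (-|x|)` is the convolution of `exp (-|x|)` with itself; it exceeds `pot` by at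
most `ε/2` and is at most `-log ε + ε` at the origin. Taking `ε = 1/N` gives `le_sum_pot`.

A minimizer exists although the cylinder is not compact. The potential has mean zero over every
circle `X ≠ 0`, so two clusters can be placed side by side with nonpositive interaction. Hence
either splitting into smaller optimal clusters loses nothing, or low-energy configurations have
bounded gaps and compactness applies (`exists_minimal_pairEnergy`).

Finally `N · γ₀ b / 2πh = γ₀ θ` and `log N + log (b/h) = log θ + log 2π`, so all errors are `O(θ)`.
-/

theorem hasDerivAt_arg_fst {x y : ℝ} (hx : x ≠ 0) :
    HasDerivAt (fun t : ℝ => Complex.arg ⟨y, t⟩) (y / (x ^ 2 + y ^ 2)) x := by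
  have h2 : HasDerivAt (fun t : ℝ => (⟨y, t⟩ : ℂ)) Complex.I x := by
    have : HasDerivAt (fun t : ℝ => (y : ℂ) + (t : ℂ) * Complex.I) (0 + 1 * Complex.I) x :=
      (hasDerivAt_const x (y : ℂ)).add ((HasDerivAt.ofReal_comp (hasDerivAt_id x)).mul_const _)
    convert this using 1
    · ext t; exact Complex.mk_eq_add_mul_I y t
    · simp
  have h3 := h2.clog_real (Or.inr hx)
  have h4 : HasDerivAt (fun t : ℝ => (Complex.log ⟨y, t⟩).im) (Complex.I / (⟨y, x⟩ : ℂ)).im x :=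
    Complex.imCLM.hasFDerivAt.comp_hasDerivAt x h3
  simp only [Complex.log_im] at h4
  convert h4 using 1
  simp [Complex.div_im, Complex.normSq_apply]
  ring

theorem hasDerivAt_arg_snd {x y : ℝ} (hx : x ≠ 0) :
    HasDerivAt (fun t : ℝ => Complex.arg ⟨t, x⟩) (-x / (x ^ 2 + y ^ 2)) y := by
  have h2 : HasDerivAt (fun t : ℝ => (⟨t, x⟩ : ℂ)) 1 y := by
    have : HasDerivAt (fun t : ℝ => (t : ℂ) + (x : ℂ) * Complex.I) 1 y :=
      (HasDerivAt.ofReal_comp (hasDerivAt_id y)).add_const _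
    convert this using 1
    · ext t; exact Complex.mk_eq_add_mul_I t x
  have h3 := h2.clog_real (Or.inr hx)
  have h4 : HasDerivAt (fun t : ℝ => (Complex.log ⟨t, x⟩).im) (1 / (⟨y, x⟩ : ℂ)).im y :=
    Complex.imCLM.hasFDerivAt.comp_hasDerivAt y h3
  simp only [Complex.log_im] at h4
  convert h4 using 1
  simp [Complex.normSq_apply]
  ring

/-- The entries of the stress are, up to the factor `2γ₀`, combinations of these three fields. -/
def fieldA (p : ℝ × ℝ) : ℝ := -p.2 / (p.1 ^ 2 + p.2 ^ 2)

def fieldB (p : ℝ × ℝ) : ℝ := -2 * p.1 ^ 2 * p.2 / (p.1 ^ 2 + p.2 ^ 2) ^ 2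

def fieldD (p : ℝ × ℝ) : ℝ := p.1 * (p.1 ^ 2 - p.2 ^ 2) / (p.1 ^ 2 + p.2 ^ 2) ^ 2

theorem stress_eq (μ ν b : ℝ) {p : ℝ × ℝ} (hp : p.1 ≠ 0) :
    stress μ ν b p = (2 * gammaZero μ ν b) •
      !![fieldA p + fieldB p, fieldD p; fieldD p, fieldA p - fieldB p] := by
  have hr : p.1 ^ 2 + p.2 ^ 2 ≠ 0 := by positivity
  ext i j
  fin_cases i <;> fin_cases j <;> simp [stress, fieldA, fieldB, fieldD] <;> field_simp <;> ring

theorem strain_eq {ν b : ℝ} {p : ℝ × ℝ} (hp : p.1 ≠ 0) :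
    strain ν b p = (-b / (8 * π * (1 - ν))) •
      !![-(2 - 4 * ν) * fieldA p - 2 * fieldB p,
          -4 * (1 - ν) * p.1 / (p.1 ^ 2 + p.2 ^ 2) - 2 * fieldD p;
         2 * (1 - 2 * ν) * p.1 / (p.1 ^ 2 + p.2 ^ 2)
            + 4 * p.1 * p.2 ^ 2 / (p.1 ^ 2 + p.2 ^ 2) ^ 2,
          -(2 - 4 * ν) * fieldA p + 2 * fieldB p] := by
  obtain ⟨x, y⟩ := p
  simp only at hp
  have hr : x ^ 2 + y ^ 2 ≠ 0 := by positivity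
  have sx : HasDerivAt (fun t : ℝ => t ^ 2 + y ^ 2) (2 * x) x := by
    simpa using (hasDerivAt_pow 2 x).add_const (y ^ 2)
  have sy : HasDerivAt (fun t : ℝ => x ^ 2 + t ^ 2) (2 * y) y := by
    simpa using (hasDerivAt_pow 2 y).const_add (x ^ 2)
  have mx : HasDerivAt (fun t : ℝ => t ^ 2 - y ^ 2) (2 * x) x := by
    simpa using (hasDerivAt_pow 2 x).sub_const (y ^ 2)
  have my : HasDerivAt (fun t : ℝ => x ^ 2 - t ^ 2) (-(2 * y)) y := by
    simpa using (hasDerivAt_pow 2 y).const_sub (x ^ 2)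
  have px : HasDerivAt (fun t : ℝ => 2 * t * y) (2 * y) x := by
    simpa using ((hasDerivAt_id x).const_mul 2).mul_const y
  have py : HasDerivAt (fun t : ℝ => 2 * x * t) (2 * x) y := by
    simpa using (hasDerivAt_id y).const_mul (2 * x)
  have d00 := (((hasDerivAt_arg_fst (y := y) hp).const_mul (4 * (1 - ν))).sub
    (px.div sx hr))
  have d01 := (((hasDerivAt_arg_snd (y := y) hp).const_mul (4 * (1 - ν))).sub
    (py.div sy hr))
  have d10 := (((sx.log hr).const_mul (1 - 2 * ν)).add
    (mx.div sx hr))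
  have d11 := (((sy.log hr).const_mul (1 - 2 * ν)).add
    (my.div sy hr))
  ext i j
  fin_cases i <;> fin_cases j <;> simp [strain, displacement, fieldA, fieldB, fieldD]
  · refine Or.inl (d00.deriv.trans ?_)
    field_simp; ring
  · refine Or.inl (d01.deriv.trans ?_)
    field_simp; ring
  · refine Or.inl (d10.deriv.trans ?_)
    field_simp; ring
  · refine Or.inl (d11.deriv.trans ?_)
    field_simp; ring

/-- The stress is symmetric, so only the symmetric part of the strain enters. In the sum of its two
off-diagonal entries the terms depending on `ν` cancel and a multiple of `fieldD` is left. -/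
theorem contract_strain_stress {μ ν b : ℝ} (hμ : μ ≠ 0) (hν : ν < 1) {p p' : ℝ × ℝ}
    (hp : p.1 ≠ 0) (hp' : p'.1 ≠ 0) :
    contract (strain ν b p) (stress μ ν b p') = 4 * gammaZero μ ν b ^ 2 / μ *
      ((1 - 2 * ν) * fieldA p * fieldA p' + fieldB p * fieldB p' + fieldD p * fieldD p') := by
  have h1 : 1 - ν ≠ 0 := by linarith
  have key : -b / (8 * π * (1 - ν)) = -(gammaZero μ ν b / (2 * μ)) := by
    rw [gammaZero]; field_simp; ring
  have hr : p.1 ^ 2 + p.2 ^ 2 ≠ 0 := by positivity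
  have hoff : (-4 * (1 - ν) * p.1 / (p.1 ^ 2 + p.2 ^ 2) - 2 * fieldD p)
      + (2 * (1 - 2 * ν) * p.1 / (p.1 ^ 2 + p.2 ^ 2)
            + 4 * p.1 * p.2 ^ 2 / (p.1 ^ 2 + p.2 ^ 2) ^ 2) = -4 * fieldD p := by
    rw [fieldD]; field_simp; ring
  rw [contract, strain_eq hp, stress_eq μ ν b hp', Matrix.trace_fin_two, key]
  simp [Matrix.mul_apply, Fin.sum_univ_two]
  have h2 := eq_sub_of_add_eq' hoff
  rw [h2]
  field_simp
  ring

end ReadShockley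

end

/-! ### Lattice sums in closed form. -/

noncomputable section

namespace ReadShockley

open Real SummationFilter Filter
open scoped Topology

theorem hasSum_of_eq {ι M : Type*} [AddCommMonoid M] [TopologicalSpace M] {f g : ι → M} {a b : M}
    {L : SummationFilter ι}
    (h : HasSum f a L) (hf : f = g) (ha : a = b) : HasSum g b L := by
  subst hf ha; exact h

/-- The partial fraction expansion of the cotangent, in which the terms `n` and `-n` are paired. The
series is only conditionally convergent, which is why symmetric ranges are needed. -/
theorem hasSum_symmetricIcc_inv_sub {z : ℂ} (hz : z ∈ Complex.integerComplement) :
    HasSum (fun n : ℤ => 1 / (z - n)) (π * Complex.cot (π * z)) (symmetricIcc ℤ) := by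
  rw [hasSum_symmetricIcc_iff]
  have h := (tendsto_logDeriv_euler_cot_sub hz).add_const (1 / z)
  rw [sub_add_cancel] at h
  refine h.congr fun N => ?_
  induction N with
  | zero => simp
  | succ N ih =>
    have : Finset.Icc (-((N + 1 : ℕ) : ℤ)) ((N + 1 : ℕ) : ℤ)
        = insert (-((N : ℤ) + 1)) (insert ((N : ℤ) + 1) (Finset.Icc (-(N : ℤ)) N)) := by
      ext k; simp; omega
    rw [this, Finset.sum_insert, Finset.sum_insert, ← ih, Finset.sum_range_succ, cotTerm]
    · push_cast
      ring
    · simp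
    · simp; omega

/-- With `q = exp (2πiz)`, the Lipschitz formula gives `(-2πi)² ∑ n qⁿ = (-2πi)² q / (1 - q)²`,
which is `(π / sin πz)²`. The formula holds in the upper half plane; the lower one follows by `z ↦
-z`. -/
theorem hasSum_inv_sub_sq {z : ℂ} (hz : z.im ≠ 0) :
    HasSum (fun n : ℤ => 1 / (z - n) ^ 2) ((π / Complex.sin (π * z)) ^ 2) := by
  wlog hpos : 0 < z.im generalizing z
  · have h := this (z := -z) (by simpa using hz)
      (by simpa using lt_of_le_of_ne (not_lt.1 hpos) hz)
    rw [← (Equiv.neg ℤ).hasSum_iff] at h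
    convert h using 1
    · ext n
      simp only [Function.comp_apply, Equiv.neg_apply, Int.cast_neg, one_div]
      congr 1; ring
    · rw [mul_neg, Complex.sin_neg, div_neg, neg_sq]
  have hsum : Summable (fun n : ℤ => 1 / (z + n) ^ 2) := by
    simpa [one_div] using EisensteinSeries.linear_right_summable z 1 (k := 2) le_rfl
  have hid := EisensteinSeries.qExpansion_identity (k := 1) le_rfl ⟨z, hpos⟩
  have hnorm : ‖Complex.exp (2 * π * Complex.I * z)‖ < 1 :=
    UpperHalfPlane.norm_exp_two_pi_I_lt_one ⟨z, hpos⟩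
  simp only [pow_one, Nat.factorial_one, Nat.cast_one, div_one, Nat.reduceAdd] at hid
  have hid' : ∑' n : ℤ, 1 / (z + n) ^ 2 = (-2 * π * Complex.I) ^ 2 *
      ∑' n : ℕ, (n : ℂ) * Complex.exp (2 * π * Complex.I * z) ^ n := hid
  rw [tsum_coe_mul_geometric_of_norm_lt_one hnorm] at hid'
  have hs := hsum.hasSum
  rw [hid', ← (Equiv.neg ℤ).hasSum_iff] at hs
  convert hs using 1
  · ext n
    simp [sub_eq_add_neg]
  · have h1 : Complex.exp (2 * π * Complex.I * z) ≠ 1 := by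
      intro h; rw [h] at hnorm; simp at hnorm
    set e := Complex.exp (π * z * Complex.I) with he
    have he0 : e ≠ 0 := Complex.exp_ne_zero _
    have h2 : Complex.exp (2 * π * Complex.I * z) = e ^ 2 := by
      rw [he, ← Complex.exp_nat_mul]; congr 1; push_cast; ring
    have h3 : Complex.exp (-(π * z) * Complex.I) = e⁻¹ := by
      rw [he, ← Complex.exp_neg]; congr 1; ring
    rw [h2] at h1 ⊢
    have h4 : 1 - e ^ 2 ≠ 0 := sub_ne_zero.2 (Ne.symm h1)
    have hI : Complex.I ^ 2 = -1 := Complex.I_sq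
    rw [Complex.sin, h3, ← he]
    have h5 : e⁻¹ - e ≠ 0 := by
      have : e⁻¹ - e = (1 - e ^ 2) / e := by field_simp
      rw [this]; positivity
    have : e⁻¹ - e = (1 - e ^ 2) / e := by field_simp
    rw [this]
    field_simp
    rw [show Complex.I ^ 4 = (Complex.I ^ 2) ^ 2 by ring, hI]
    norm_num

/-- The periodized counterparts of `fieldA`, `fieldB`, `fieldD`, in units in which the period
is `2π`. -/
def perA (x y : ℝ) : ℝ := -sin y / (2 * (cosh x - cos y))

def perB (x y : ℝ) : ℝ := -(x * sinh x * sin y) / (2 * (cosh x - cos y) ^ 2)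

def perD (x y : ℝ) : ℝ := x * (cosh x * cos y - 1) / (2 * (cosh x - cos y) ^ 2)

theorem cosh_sub_cos_pos {x : ℝ} (hx : x ≠ 0) (y : ℝ) : 0 < cosh x - cos y := by
  linarith [one_lt_cosh.2 hx, cos_le_one y]

theorem cosh_sub_cos_nonneg (x y : ℝ) : 0 ≤ cosh x - cos y := by
  linarith [one_le_cosh x, cos_le_one y]

theorem inv_sub_lattice {h x y : ℝ} (hh : 0 < h) (n : ℤ) :
    1 / (⟨x, y - 2 * π * n * h⟩ : ℂ) =
      (-Complex.I / (2 * π * h)) * (1 / ((⟨y, -x⟩ : ℂ) / (2 * π * h) - n)) := by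
  have hpi : (π : ℂ) ≠ 0 := by exact_mod_cast pi_ne_zero
  have hh' : (h : ℂ) ≠ 0 := by exact_mod_cast hh.ne'
  have : (⟨x, y - 2 * π * n * h⟩ : ℂ) =
      Complex.I * (2 * π * h) * ((⟨y, -x⟩ : ℂ) / (2 * π * h) - n) := by
    rw [mul_sub, mul_assoc Complex.I (2 * π * h : ℂ) (_ / _), mul_div_cancel₀ (b := (2 * π * h : ℂ)) _
      (mul_ne_zero (mul_ne_zero two_ne_zero hpi) hh')]
    apply Complex.ext <;> simp
    ring
  rw [this, one_div, mul_inv, mul_inv, Complex.inv_I]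
  ring

theorem lattice_im {h x y : ℝ} :
    ((⟨y, -x⟩ : ℂ) / (2 * π * h)).im = -x / (2 * π * h) := by
  have : (2 * π * h : ℂ) = ((2 * π * h : ℝ) : ℂ) := by push_cast; ring
  rw [this, Complex.div_ofReal_im]

theorem pi_mul_lattice {h x y : ℝ} (hh : 0 < h) :
    2 * (π * ((⟨y, -x⟩ : ℂ) / (2 * π * h))) = ((y / h : ℝ) : ℂ) - (x / h : ℝ) * Complex.I := by
  have hpi : (π : ℂ) ≠ 0 := by exact_mod_cast pi_ne_zero
  have hh' : (h : ℂ) ≠ 0 := by exact_mod_cast hh.ne'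
  rw [Complex.mk_eq_add_mul_I]
  push_cast
  field_simp
  ring

/-- Both `cot u = sin 2u / (1 - cos 2u)` and `1 / sin² u = 2 / (1 - cos 2u)` depend only on these
two quantities, so their real and imaginary parts become explicit. -/
theorem sub_mul_I_sin_cos {X Y : ℝ} {u : ℂ} (hu : 2 * u = (Y : ℂ) - X * Complex.I) :
    Complex.sin (2 * u) = ⟨sin Y * cosh X, -(cos Y * sinh X)⟩ ∧
    1 - Complex.cos (2 * u) = ⟨1 - cos Y * cosh X, -(sin Y * sinh X)⟩ := by
  rw [hu, Complex.sin_sub, Complex.cos_sub, Complex.cos_mul_I, Complex.sin_mul_I,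
    ← Complex.ofReal_sin, ← Complex.ofReal_cos, ← Complex.ofReal_sinh, ← Complex.ofReal_cosh]
  constructor <;> apply Complex.ext <;>
    simp [-Complex.ofReal_sin, -Complex.ofReal_cos, -Complex.ofReal_sinh, -Complex.ofReal_cosh]

theorem normSq_one_sub_cos (X Y : ℝ) :
    (1 - cos Y * cosh X) ^ 2 + (sin Y * sinh X) ^ 2 = (cosh X - cos Y) ^ 2 := by
  have h1 := sin_sq_add_cos_sq Y
  have h2 := cosh_sq X
  have h3 : sin Y ^ 2 = 1 - cos Y ^ 2 := by linarith
  have h4 : sinh X ^ 2 = cosh X ^ 2 - 1 := by linarith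
  rw [mul_pow, h3, h4]; ring

theorem sin_ne_zero_of_two_mul_eq {X Y : ℝ} (hX : X ≠ 0) {u : ℂ}
    (hu : 2 * u = (Y : ℂ) - X * Complex.I) : Complex.sin u ≠ 0 := by
  intro h
  have h1 : 1 - Complex.cos (2 * u) = 0 := by
    rw [Complex.cos_two_mul, Complex.cos_sq', h]; ring
  rw [(sub_mul_I_sin_cos hu).2, Complex.ext_iff] at h1
  have h2 := normSq_one_sub_cos X Y
  simp only [Complex.zero_re, Complex.zero_im, neg_eq_zero] at h1
  rw [h1.1, h1.2] at h2
  have := cosh_sub_cos_pos hX Y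
  nlinarith

theorem cot_re {X Y : ℝ} (hX : X ≠ 0) {u : ℂ} (hu : 2 * u = (Y : ℂ) - X * Complex.I) :
    (Complex.cot u).re = sin Y / (cosh X - cos Y) := by
  have hs := sin_ne_zero_of_two_mul_eq hX hu
  obtain ⟨h1, h2⟩ := sub_mul_I_sin_cos hu
  have hD := cosh_sub_cos_pos hX Y
  have : Complex.cot u = Complex.sin (2 * u) / (1 - Complex.cos (2 * u)) := by
    have h3 : 1 - Complex.cos (2 * u) = 2 * Complex.sin u ^ 2 := by
      rw [Complex.cos_two_mul, Complex.cos_sq']; ring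
    rw [h3, Complex.sin_two_mul, Complex.cot]
    field_simp
  rw [this, h1, h2, Complex.div_re, Complex.normSq_apply]
  have h4 := normSq_one_sub_cos X Y
  have h5 : (1 - cos Y * cosh X) * (1 - cos Y * cosh X) +
      -(sin Y * sinh X) * -(sin Y * sinh X) = (cosh X - cos Y) ^ 2 := by rw [← h4]; ring
  simp only [h5]
  have h6 := cosh_sq X
  rw [← add_div, div_eq_div_iff (by positivity) hD.ne']
  linear_combination (-(cosh X - cos Y) * sin Y * cos Y) * h6

theorem sin_sq_inv {X Y : ℝ} (hX : X ≠ 0) {u : ℂ} (hu : 2 * u = (Y : ℂ) - X * Complex.I) :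
    -(1 / Complex.sin u) ^ 2 = ⟨2 * (cosh X * cos Y - 1) / (cosh X - cos Y) ^ 2,
      -2 * sinh X * sin Y / (cosh X - cos Y) ^ 2⟩ := by
  have hs := sin_ne_zero_of_two_mul_eq hX hu
  obtain ⟨-, h2⟩ := sub_mul_I_sin_cos hu
  have hD := cosh_sub_cos_pos hX Y
  have h3 : 1 - Complex.cos (2 * u) = 2 * Complex.sin u ^ 2 := by
    rw [Complex.cos_two_mul, Complex.cos_sq']; ring
  have h4 : -(1 / Complex.sin u) ^ 2 = -2 * (1 - Complex.cos (2 * u))⁻¹ := by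
    rw [h3]; field_simp
  have h5 : (1 - cos Y * cosh X) * (1 - cos Y * cosh X) +
      -(sin Y * sinh X) * -(sin Y * sinh X) = (cosh X - cos Y) ^ 2 := by
    rw [← normSq_one_sub_cos]; ring
  rw [h4, h2]
  apply Complex.ext
  · simp only [Complex.mul_re, Complex.inv_re, Complex.inv_im, Complex.normSq_apply, h5]
    simp; ring
  · simp only [Complex.mul_im, Complex.inv_re, Complex.inv_im, Complex.normSq_apply, h5]
    simp; ring

/-- The field is `Im (1/w)` with `w = x + iy`, so its lattice sum is the imaginary part of a rotated
and rescaled cotangent series. -/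
theorem hasSum_fieldA {h x : ℝ} (hh : 0 < h) (hx : x ≠ 0) (y : ℝ) :
    HasSum (fun n : ℤ => fieldA (x, y - 2 * π * n * h)) (perA (x / h) (y / h) / h)
      (symmetricIcc ℤ) := by
  set z : ℂ := (⟨y, -x⟩ : ℂ) / (2 * π * h) with hz
  have him : z.im ≠ 0 := by
    rw [hz, lattice_im]
    have := pi_pos
    exact div_ne_zero (neg_ne_zero.2 hx) (by positivity)
  have hzc : z ∈ Complex.integerComplement := by
    rintro ⟨n, hn⟩; simp [← hn] at him
  have h1 := (hasSum_symmetricIcc_inv_sub hzc).mul_left (-Complex.I / (2 * π * h))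
  have h2 := Complex.imCLM.hasSum h1
  convert h2 using 1
  · ext n
    simp only [hz, ← inv_sub_lattice hh, Complex.imCLM_apply]
    simp [fieldA, Complex.normSq_apply, sq]
  · have hD := cosh_sub_cos_pos (div_ne_zero hx hh.ne') (y / h)
    have h3 := cot_re (div_ne_zero hx hh.ne') (pi_mul_lattice (x := x) (y := y) hh)
    have h4 : -Complex.I / (2 * π * h) * (π * Complex.cot (π * z)) =
        ((1 / (2 * h) : ℝ) : ℂ) * (-Complex.I * Complex.cot (π * z)) := by
      have hpi : (π : ℂ) ≠ 0 := by exact_mod_cast pi_ne_zero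
      have hh' : (h : ℂ) ≠ 0 := by exact_mod_cast hh.ne'
      push_cast; field_simp
    rw [h4, Complex.imCLM_apply, Complex.im_ofReal_mul, perA]
    simp only [neg_mul, Complex.neg_im, Complex.I_mul_im]
    rw [hz, h3]
    field_simp

/-- The two fields are `x Im (1/w²)` and `x Re (1/w²)`, and `x` is unchanged by the translations, so
both sums are read off from the series of `1/sin²`. -/
theorem hasSum_fieldBD {h x : ℝ} (hh : 0 < h) (hx : x ≠ 0) (y : ℝ) :
    HasSum (fun n : ℤ => fieldB (x, y - 2 * π * n * h)) (perB (x / h) (y / h) / h)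
      (symmetricIcc ℤ) ∧
    HasSum (fun n : ℤ => fieldD (x, y - 2 * π * n * h)) (perD (x / h) (y / h) / h)
      (symmetricIcc ℤ) := by
  set z : ℂ := (⟨y, -x⟩ : ℂ) / (2 * π * h) with hz
  have him : z.im ≠ 0 := by
    rw [hz, lattice_im]
    have := pi_pos
    exact div_ne_zero (neg_ne_zero.2 hx) (by positivity)
  have hI : (-Complex.I / (2 * π * h)) ^ 2 * (π / Complex.sin (π * z)) ^ 2 =
      ((1 / (2 * h) ^ 2 : ℝ) : ℂ) * (-(1 / Complex.sin (π * z)) ^ 2) := by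
    have hpi : (π : ℂ) ≠ 0 := by exact_mod_cast pi_ne_zero
    have hh' : (h : ℂ) ≠ 0 := by exact_mod_cast hh.ne'
    push_cast
    rw [div_pow, div_pow, neg_sq, Complex.I_sq]
    field_simp
  have h1 : HasSum (fun n : ℤ => (-Complex.I / (2 * π * h)) ^ 2 * (1 / (z - n) ^ 2)) _
      (symmetricIcc ℤ) :=
    ((hasSum_inv_sub_sq him).mul_left ((-Complex.I / (2 * π * h)) ^ 2)).mono_left
      (symmetricIcc ℤ).le_atTop
  have h2 : ∀ n : ℤ, (-Complex.I / (2 * π * h)) ^ 2 * (1 / (z - n) ^ 2) =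
      (1 / (⟨x, y - 2 * π * n * h⟩ : ℂ)) ^ 2 := fun n => by
    rw [inv_sub_lattice hh, mul_pow, ← hz]; simp
  simp only [h2] at h1
  rw [hI, sin_sq_inv (div_ne_zero hx hh.ne') (pi_mul_lattice (x := x) (y := y) hh)] at h1
  have hD := cosh_sub_cos_pos (div_ne_zero hx hh.ne') (y / h)
  constructor
  · refine hasSum_of_eq ((Complex.imCLM.hasSum h1).mul_left x) ?_ ?_
    · ext n
      have : x ^ 2 + (y - 2 * π * n * h) ^ 2 ≠ 0 := by positivity
      simp [fieldB, Complex.normSq_apply, sq]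
      field_simp
      ring
    · rw [Complex.imCLM_apply, Complex.im_ofReal_mul, perB]
      simp only
      field_simp
  · refine hasSum_of_eq ((Complex.reCLM.hasSum h1).mul_left x) ?_ ?_
    · ext n
      have : x ^ 2 + (y - 2 * π * n * h) ^ 2 ≠ 0 := by positivity
      simp [fieldD, Complex.normSq_apply, sq]
      field_simp
      ring
    · rw [Complex.reCLM_apply, Complex.re_ofReal_mul, perD]
      simp only
      field_simp

/-- The periodized elastic energy density in units in which the period is `2π`. -/
def density (ν x y x' y' : ℝ) : ℝ :=
  (1 - 2 * ν) * (perA x y * perA x' y') + perB x y * perB x' y' + perD x y * perD x' y'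

theorem pairTerm_eq {μ ν b : ℝ} (h : ℝ) (hμ : μ ≠ 0) (hν : ν < 1) {z z' ζ : ℝ × ℝ}
    (hz : ζ.1 ≠ z.1) (hz' : ζ.1 ≠ z'.1) (n n' : ℤ) :
    pairTerm μ ν b h z z' ζ n n' = 4 * gammaZero μ ν b ^ 2 / μ *
      ((1 - 2 * ν) * fieldA (ζ.1 - z.1, ζ.2 - z.2 - 2 * π * n * h) *
          fieldA (ζ.1 - z'.1, ζ.2 - z'.2 - 2 * π * n' * h)
        + fieldB (ζ.1 - z.1, ζ.2 - z.2 - 2 * π * n * h) *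
          fieldB (ζ.1 - z'.1, ζ.2 - z'.2 - 2 * π * n' * h)
        + fieldD (ζ.1 - z.1, ζ.2 - z.2 - 2 * π * n * h) *
          fieldD (ζ.1 - z'.1, ζ.2 - z'.2 - 2 * π * n' * h)) := by
  have e : ∀ (w : ℝ × ℝ) (m : ℤ), ζ - w - shift h m =
      (ζ.1 - w.1, ζ.2 - w.2 - 2 * π * m * h) := fun w m => by
    ext <;> simp [shift]
  rw [pairTerm, e, e]
  exact contract_strain_stress hμ hν (sub_ne_zero.2 hz) (sub_ne_zero.2 hz')

/-- Each summand is a combination of three products of a function of `n` and a function of `n'`, so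
the iterated sum is the same combination of products of single sums. -/
theorem hasSum_pairTerm {μ ν b h : ℝ} (hμ : μ ≠ 0) (hν : ν < 1) (hh : 0 < h)
    {z z' ζ : ℝ × ℝ} (hz : ζ.1 ≠ z.1) (hz' : ζ.1 ≠ z'.1) :
    (∀ n, Summable (fun n' : ℤ => pairTerm μ ν b h z z' ζ n n') (symmetricIcc ℤ)) ∧
    HasSum (fun n : ℤ => ∑'[symmetricIcc ℤ] n' : ℤ, pairTerm μ ν b h z z' ζ n n')
      (4 * gammaZero μ ν b ^ 2 / μ / h ^ 2 * density ν ((ζ.1 - z.1) / h) ((ζ.2 - z.2) / h)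
        ((ζ.1 - z'.1) / h) ((ζ.2 - z'.2) / h)) (symmetricIcc ℤ) := by
  have a := hasSum_fieldA hh (sub_ne_zero.2 hz) (ζ.2 - z.2)
  have bd := hasSum_fieldBD hh (sub_ne_zero.2 hz) (ζ.2 - z.2)
  have a' := hasSum_fieldA hh (sub_ne_zero.2 hz') (ζ.2 - z'.2)
  have bd' := hasSum_fieldBD hh (sub_ne_zero.2 hz') (ζ.2 - z'.2)
  have inner := fun n : ℤ =>
    (((a'.mul_left ((1 - 2 * ν) * fieldA (ζ.1 - z.1, ζ.2 - z.2 - 2 * π * n * h))).add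
      (bd'.1.mul_left (fieldB (ζ.1 - z.1, ζ.2 - z.2 - 2 * π * n * h)))).add
      (bd'.2.mul_left (fieldD (ζ.1 - z.1, ζ.2 - z.2 - 2 * π * n * h)))).mul_left
      (4 * gammaZero μ ν b ^ 2 / μ)
  simp only [pairTerm_eq h hμ hν hz hz']
  refine ⟨fun n => (inner n).summable, ?_⟩
  simp only [fun n => (inner n).tsum_eq]
  refine hasSum_of_eq (((((a.mul_left (1 - 2 * ν)).mul_right (perA ((ζ.1 - z'.1) / h) ((ζ.2 - z'.2) / h) / h)).add
    (bd.1.mul_right (perB ((ζ.1 - z'.1) / h) ((ζ.2 - z'.2) / h) / h))).add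
    (bd.2.mul_right (perD ((ζ.1 - z'.1) / h) ((ζ.2 - z'.2) / h) / h))).mul_left
    (4 * gammaZero μ ν b ^ 2 / μ)) (funext fun n => by ring) ?_
  rw [density]
  ring

theorem qPer_eq {μ ν b h : ℝ} (hμ : μ ≠ 0) (hν : ν < 1) (hh : 0 < h)
    {z z' ζ : ℝ × ℝ} (hz : ζ.1 ≠ z.1) (hz' : ζ.1 ≠ z'.1) :
    QPerConverges μ ν b h z z' ζ ∧ qPer μ ν b h z z' ζ = 2 * gammaZero μ ν b ^ 2 / μ / h ^ 2 *
      density ν ((ζ.1 - z.1) / h) ((ζ.2 - z.2) / h) ((ζ.1 - z'.1) / h) ((ζ.2 - z'.2) / h) := by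
  obtain ⟨h1, h2⟩ := hasSum_pairTerm (b := b) hμ hν hh hz hz'
  refine ⟨⟨h1, h2.summable⟩, ?_⟩
  rw [qPer, h2.tsum_eq]
  ring

end ReadShockley

end

/-! ### Integrability of the energy density. -/

noncomputable section

namespace ReadShockley

open Real MeasureTheory Set

/-- The reciprocal of `|2 sinh ((x + i y) / 2)|`. -/
def core (x y : ℝ) : ℝ := 1 / √(2 * (cosh x - cos y))

theorem core_nonneg (x y : ℝ) : 0 ≤ core x y := by unfold core; positivity

theorem core_sq (x y : ℝ) : core x y ^ 2 = 1 / (2 * (cosh x - cos y)) := by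
  rw [core, div_pow, one_pow, sq_sqrt (by linarith [cosh_sub_cos_nonneg x y])]

theorem cosh_sub_cos_eq (x y : ℝ) :
    cosh x - cos y = 2 * (sinh (x / 2) ^ 2 + sin (y / 2) ^ 2) := by
  have h1 := cosh_two_mul (x / 2)
  have h2 := cos_two_mul (y / 2)
  have h3 := cosh_sq (x / 2)
  have h4 := sin_sq_add_cos_sq (y / 2)
  rw [mul_div_cancel₀ _ two_ne_zero] at h1 h2
  linarith

theorem sq_le_two_mul_cosh_sub_one (x : ℝ) : x ^ 2 ≤ 2 * (cosh x - 1) := by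
  have h := cosh_sub_cos_eq x 0
  simp only [cos_zero, zero_div, sin_zero] at h
  rw [h]
  have h1 : (x / 2) ^ 2 ≤ sinh (x / 2) ^ 2 := by
    rw [← sq_abs, ← sq_abs (sinh _), abs_sinh]
    exact pow_le_pow_left₀ (abs_nonneg _) (self_le_sinh_iff.2 (abs_nonneg _)) 2
  nlinarith

theorem abs_perA_le (x y : ℝ) : |perA x y| ≤ core x y := by
  refine abs_le_of_sq_le_sq ?_ (core_nonneg x y)
  rw [core_sq, perA]
  rcases (cosh_sub_cos_nonneg x y).eq_or_lt with h | h
  · simp [← h]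
  · rw [div_pow, neg_sq, div_le_div_iff₀ (by positivity) (by positivity)]
    have h1 : sin y ^ 2 ≤ 2 * (cosh x - cos y) := by
      nlinarith [sin_sq_add_cos_sq y, one_le_cosh x, cos_le_one y, neg_one_le_cos y]
    nlinarith

/-- The left side is exactly `x² / (2 (cosh x - cos y))²`, and `x² ≤ 2 (cosh x - cos y)`. -/
theorem perB_sq_add_perD_sq_le (x y : ℝ) : perB x y ^ 2 + perD x y ^ 2 ≤ core x y ^ 2 := by
  rw [core_sq, perB, perD]
  rcases (cosh_sub_cos_nonneg x y).eq_or_lt with h | h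
  · simp [← h]
  · have h1 := normSq_one_sub_cos x y
    have h2 : x ^ 2 ≤ 2 * (cosh x - cos y) := by
      linarith [sq_le_two_mul_cosh_sub_one x, cos_le_one y]
    have h3 : (-(x * sinh x * sin y) / (2 * (cosh x - cos y) ^ 2)) ^ 2 +
        (x * (cosh x * cos y - 1) / (2 * (cosh x - cos y) ^ 2)) ^ 2 =
        x ^ 2 / (2 * (cosh x - cos y)) ^ 2 := by
      rw [div_pow, div_pow, ← add_div, div_eq_div_iff (by positivity) (by positivity)]
      linear_combination (4 * x ^ 2 * (cosh x - cos y) ^ 2) * h1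
    rw [h3, div_le_div_iff₀ (by positivity) (by positivity)]
    nlinarith

theorem abs_density_le {ν : ℝ} (hν₀ : 0 ≤ ν) (hν₁ : ν < 1) (x y x' y' : ℝ) :
    |density ν x y x' y'| ≤ 2 * (core x y * core x' y') := by
  have c := core_nonneg x y
  have c' := core_nonneg x' y'
  have h1 : |(1 - 2 * ν) * (perA x y * perA x' y')| ≤ core x y * core x' y' := by
    rw [abs_mul, abs_mul]
    have h : |1 - 2 * ν| ≤ 1 := abs_le.2 ⟨by linarith, by linarith⟩
    calc _ ≤ 1 * (core x y * core x' y') := by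
          gcongr
          · exact abs_perA_le x y
          · exact abs_perA_le x' y'
      _ = _ := one_mul _
  have h2 : |perB x y * perB x' y' + perD x y * perD x' y'| ≤ core x y * core x' y' := by
    refine abs_le_of_sq_le_sq ?_ (mul_nonneg c c')
    have e1 := perB_sq_add_perD_sq_le x y
    have e2 := perB_sq_add_perD_sq_le x' y'
    calc (perB x y * perB x' y' + perD x y * perD x' y') ^ 2
        ≤ (perB x y ^ 2 + perD x y ^ 2) * (perB x' y' ^ 2 + perD x' y' ^ 2) := by
          nlinarith [sq_nonneg (perB x y * perD x' y' - perD x y * perB x' y')]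
      _ ≤ core x y ^ 2 * core x' y' ^ 2 := by gcongr
      _ = _ := by ring
  rw [density, add_assoc]
  exact (abs_add_le _ _).trans (by linarith)

/-- The inequality `s² + t² ≥ 2st`, applied to `|sinh (x/2)|` and `|sin (y/2)|`, separates the
variables. It splits the `1/r` singularity into two integrable powers `-1/2` and keeps exponential
decay in `x`. -/
theorem core_le {x y : ℝ} (hx : x ≠ 0) (hy : sin (y / 2) ≠ 0) :
    core x y ≤ (|x| ^ (-(1 / 2) : ℝ) * exp (-(1 / 8) * |x|)) * |sin (y / 2)| ^ (-(1 / 2) : ℝ) := by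
  have hx' := abs_pos.2 hx
  have hy' := abs_pos.2 hy
  have hlow : |x| * exp (|x| / 4) * |sin (y / 2)| ≤ 2 * (cosh x - cos y) := by
    have h0 : |sinh (x / 2)| = sinh (|x| / 2) := by rw [abs_sinh, abs_div, abs_two]
    have h1 : |x| / 4 * exp (|x| / 4) ≤ sinh (|x| / 2) := by
      have e : |x| / 2 = 2 * (|x| / 4) := by ring
      rw [e, sinh_two_mul]
      have e1 : |x| / 4 ≤ sinh (|x| / 4) := self_le_sinh_iff.2 (by positivity)
      have e2 : exp (|x| / 4) ≤ 2 * cosh (|x| / 4) := by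
        rw [cosh_eq]; linarith [exp_pos (-(|x| / 4))]
      nlinarith [exp_pos (|x| / 4)]
    rw [cosh_sub_cos_eq, ← sq_abs (sinh _), ← sq_abs (sin _), h0]
    have h2 : 0 ≤ sinh (|x| / 2) := sinh_nonneg_iff.2 (by positivity)
    nlinarith [sq_nonneg (sinh (|x| / 2) - |sin (y / 2)|)]
  have hpos : 0 < |x| * exp (|x| / 4) * |sin (y / 2)| := by positivity
  have : (|x| ^ (-(1 / 2) : ℝ) * exp (-(1 / 8) * |x|)) * |sin (y / 2)| ^ (-(1 / 2) : ℝ) =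
      1 / √(|x| * exp (|x| / 4) * |sin (y / 2)|) := by
    rw [sqrt_eq_rpow, one_div (_ ^ _), ← rpow_neg hpos.le, mul_rpow (by positivity) hy'.le,
      mul_rpow hx'.le (exp_pos _).le, ← exp_mul]
    congr 3; ring
  rw [this, core]
  exact one_div_le_one_div_of_le (sqrt_pos.2 hpos) (sqrt_le_sqrt hlow)

theorem integrable_comp_abs {f : ℝ → ℝ} (hf : IntegrableOn f (Ioi 0)) :
    Integrable (fun x => f |x|) := by
  have h1 : IntegrableOn (fun x => f |x|) (Ioi 0) := hf.congr_fun
    (fun x hx => by rw [abs_of_pos hx]) measurableSet_Ioi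
  have h2 : IntegrableOn (fun x ↦ f |x|) (Iic 0) := by
    rw [← Measure.map_neg_eq_self (volume : Measure ℝ)]
    let m : MeasurableEmbedding fun x : ℝ => -x := (Homeomorph.neg ℝ).measurableEmbedding
    rw [m.integrableOn_map_iff]
    simp_rw [Function.comp_def, abs_neg, neg_preimage, neg_Iic, neg_zero]
    exact Iff.mpr integrableOn_Ici_iff_integrableOn_Ioi h1
  rw [← integrableOn_univ, ← Iic_union_Ioi (a := (0 : ℝ))]
  exact h2.union h1

theorem integrable_abs_rpow_mul_exp :
    Integrable (fun x : ℝ => |x| ^ (-(1 / 2) : ℝ) * exp (-(1 / 8) * |x|)) := by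
  have := integrableOn_rpow_mul_exp_neg_mul_rpow (p := 1) (s := -(1 / 2)) (b := 1 / 8)
    (by norm_num) one_pos (by norm_num)
  simp only [rpow_one] at this
  exact integrable_comp_abs this

theorem intervalIntegrable_abs_sin_rpow (a c : ℝ) :
    IntervalIntegrable (fun y : ℝ => |sin (y / 2)| ^ (-(1 / 2) : ℝ)) volume a c := by
  have hper : Function.Periodic (fun y : ℝ => |sin (y / 2)| ^ (-(1 / 2) : ℝ)) (2 * π) := fun y => by
    simp only
    rw [show (y + 2 * π) / 2 = y / 2 + π by ring, sin_add_pi, abs_neg]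
  refine hper.intervalIntegrable two_pi_pos.ne' (t := -π) ?_ a c
  have e : -π + 2 * π = π := by ring
  rw [e, intervalIntegrable_iff_integrableOn_Ioc_of_le (by linarith [pi_pos])]
  have hb : IntervalIntegrable (fun y : ℝ => π ^ (1 / 2 : ℝ) * |y| ^ (-(1 / 2) : ℝ)) volume (-π) π := by
    have h1 : IntervalIntegrable (fun y : ℝ => |y| ^ (-(1 / 2) : ℝ)) volume 0 π :=
      (intervalIntegral.intervalIntegrable_rpow' (r := -(1 / 2)) (by norm_num)).congr fun y hy => by
        rw [uIoc_of_le pi_pos.le] at hy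
        rw [abs_of_pos hy.1]
    have h2 := (h1.comp_sub_left 0)
    simp only [zero_sub, abs_neg, sub_zero] at h2
    exact (h2.symm.trans h1).const_mul _
  rw [intervalIntegrable_iff_integrableOn_Ioc_of_le (by linarith [pi_pos])] at hb
  refine Integrable.mono' hb (Measurable.aestronglyMeasurable (by fun_prop)) ?_
  filter_upwards [ae_restrict_mem measurableSet_Ioc, compl_mem_ae_iff.2 (measure_singleton 0)]
    with y hy hy0
  have hy0 : y ≠ 0 := hy0
  have hyp := abs_pos.2 hy0
  rw [norm_of_nonneg (by positivity)]
  have h3 : |y| / π ≤ |sin (y / 2)| := by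
    have := mul_abs_le_abs_sin (x := y / 2) (by
      rw [abs_div, abs_two]; gcongr; exact abs_le.2 ⟨hy.1.le, hy.2⟩)
    rw [abs_div, abs_two] at this
    calc _ = 2 / π * (|y| / 2) := by field_simp
      _ ≤ _ := this
  calc |sin (y / 2)| ^ (-(1 / 2) : ℝ) ≤ (|y| / π) ^ (-(1 / 2) : ℝ) :=
        rpow_le_rpow_of_nonpos (by positivity) h3 (by norm_num)
    _ = _ := by
      rw [div_rpow hyp.le pi_pos.le, rpow_neg pi_pos.le, div_inv_eq_mul, mul_comm]

theorem volume_restrict_strip (h : ℝ) : (volume : Measure (ℝ × ℝ)).restrict (strip h) =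
    (volume : Measure ℝ).prod (volume.restrict (Ico (-(π * h)) (π * h))) := by
  rw [strip, Measure.volume_eq_prod, ← Measure.prod_restrict, Measure.restrict_univ]

theorem measurableSet_strip (h : ℝ) : MeasurableSet (strip h) :=
  MeasurableSet.univ.prod measurableSet_Ico

theorem ae_fst_ne (c : ℝ) : ∀ᵐ ζ : ℝ × ℝ, ζ.1 ≠ c := by
  rw [Measure.volume_eq_prod]
  exact Measure.quasiMeasurePreserving_fst.ae (p := fun x : ℝ => x ≠ c)
    (compl_mem_ae_iff.2 (measure_singleton c))

theorem ae_sin_ne {h : ℝ} (hh : 0 < h) (c : ℝ) : ∀ᵐ ζ : ℝ × ℝ, sin ((ζ.2 - c) / h / 2) ≠ 0 := by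
  rw [Measure.volume_eq_prod]
  refine Measure.quasiMeasurePreserving_snd.ae (p := fun y : ℝ => sin ((y - c) / h / 2) ≠ 0) ?_
  refine compl_mem_ae_iff.2 (Set.Countable.measure_zero ?_ _)
  refine (countable_range (fun n : ℤ => (n : ℝ) * π * 2 * h + c)).mono ?_
  intro y hy
  have hy' : sin ((y - c) / h / 2) = 0 := hy
  obtain ⟨n, hn⟩ := sin_eq_zero_iff.1 hy'
  exact ⟨n, by simp only; rw [hn]; field_simp; ring⟩

theorem integrableOn_core {h : ℝ} (hh : 0 < h) (z : ℝ × ℝ) :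
    IntegrableOn (fun ζ : ℝ × ℝ => core ((ζ.1 - z.1) / h) ((ζ.2 - z.2) / h)) (strip h) := by
  have hf := (integrable_abs_rpow_mul_exp.comp_div hh.ne').comp_sub_right z.1
  have hg : Integrable (fun y : ℝ => |sin ((y - z.2) / h / 2)| ^ (-(1 / 2) : ℝ))
      (volume.restrict (Ico (-(π * h)) (π * h))) := by
    have h1 := ((intervalIntegrable_abs_sin_rpow ((-(π * h) - z.2) / h)
      ((π * h - z.2) / h)).comp_mul_right (c := h⁻¹)).comp_sub_right z.2
    simp only [div_inv_eq_mul, div_mul_cancel₀ _ hh.ne', sub_add_cancel] at h1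
    rw [intervalIntegrable_iff_integrableOn_Ico_of_le (by nlinarith [pi_pos])] at h1
    simpa only [div_eq_mul_inv, IntegrableOn] using h1
  have hp := hf.mul_prod hg
  rw [← volume_restrict_strip] at hp
  refine Integrable.mono' hp ?_ ?_
  · have : Measurable (fun ζ : ℝ × ℝ => core ((ζ.1 - z.1) / h) ((ζ.2 - z.2) / h)) := by
      unfold core; fun_prop
    exact this.aestronglyMeasurable
  · filter_upwards [ae_restrict_of_ae (ae_fst_ne z.1), ae_restrict_of_ae (ae_sin_ne hh z.2)]
      with ζ h1 h2
    rw [norm_of_nonneg (core_nonneg _ _)]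
    exact core_le (div_ne_zero (sub_ne_zero.2 h1) hh.ne') h2

/-- A local quasi-triangle inequality: `cosh x - cos y` behaves like a squared distance to the
lattice of singularities. -/
theorem cosh_sub_cos_sub_le {η x y x' y' : ℝ} (hη : η ≤ 1) (h : cosh x - cos y ≤ η)
    (h' : cosh x' - cos y' ≤ η) : cosh (x - x') - cos (y - y') ≤ 10 * η := by
  rw [cosh_sub_cos_eq] at *
  have e1 : sinh ((x - x') / 2) = sinh (x / 2) * cosh (x' / 2) - cosh (x / 2) * sinh (x' / 2) := by
    rw [sub_div, sinh_sub]
  have e2 : sin ((y - y') / 2) = sin (y / 2) * cos (y' / 2) - cos (y / 2) * sin (y' / 2) := by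
    rw [sub_div, sin_sub]
  rw [e1, e2]
  have c1 := cosh_sq (x / 2)
  have c2 := cosh_sq (x' / 2)
  have c3 := sin_sq_add_cos_sq (y / 2)
  have c4 := sin_sq_add_cos_sq (y' / 2)
  set S := sinh (x / 2)
  set S' := sinh (x' / 2)
  set K := cosh (x / 2)
  set K' := cosh (x' / 2)
  set s := sin (y / 2)
  set s' := sin (y' / 2)
  set c := cos (y / 2)
  set c' := cos (y' / 2)
  have b1 : (S * K' - K * S') ^ 2 ≤ 2 * (S ^ 2 * K' ^ 2 + K ^ 2 * S' ^ 2) := by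
    nlinarith [sq_nonneg (S * K' + K * S')]
  have b2 : (s * c' - c * s') ^ 2 ≤ 2 * (s ^ 2 * c' ^ 2 + c ^ 2 * s' ^ 2) := by
    nlinarith [sq_nonneg (s * c' + c * s')]
  have k1 : K ^ 2 ≤ 3 / 2 := by nlinarith [sq_nonneg s]
  have k2 : K' ^ 2 ≤ 3 / 2 := by nlinarith [sq_nonneg s']
  have k3 : c ^ 2 ≤ 1 := by nlinarith [sq_nonneg s]
  have k4 : c' ^ 2 ≤ 1 := by nlinarith [sq_nonneg s']
  have m1 : S ^ 2 * K' ^ 2 ≤ S ^ 2 * (3 / 2) := by gcongr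
  have m2 : K ^ 2 * S' ^ 2 ≤ (3 / 2) * S' ^ 2 := by gcongr
  have m3 : s ^ 2 * c' ^ 2 ≤ s ^ 2 * 1 := by gcongr
  have m4 : c ^ 2 * s' ^ 2 ≤ 1 * s' ^ 2 := by gcongr
  nlinarith [sq_nonneg s, sq_nonneg s', sq_nonneg S, sq_nonneg S']

theorem core_le_of_le {δ x y : ℝ} (hδ : 0 < δ) (h : δ ≤ cosh x - cos y) :
    core x y ≤ 1 / √(2 * δ) :=
  one_div_le_one_div_of_le (sqrt_pos.2 (by linarith)) (sqrt_le_sqrt (by linarith))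

/-- A point cannot be close to two separated singularities at once, so one of the two factors is
bounded and the product is no more singular than the sum. -/
theorem core_mul_core_le {x y x' y' : ℝ} {d : ℝ} (hd : 0 < d)
    (h : d ≤ cosh (x - x') - cos (y - y')) :
    core x y * core x' y' ≤ 1 / √(2 * min 1 (d / 20)) * (core x y + core x' y') := by
  -- If both points were within `η`, the quasi-triangle inequality, which needs `η ≤ 1`, would give
  -- `d ≤ 10 η ≤ d/2`.
  set η := min 1 (d / 20) with hη
  have hη0 : 0 < η := lt_min one_pos (by positivity)
  have hη1 : η ≤ d / 20 := min_le_right _ _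
  have c := core_nonneg x y
  have c' := core_nonneg x' y'
  have p : 0 ≤ 1 / √(2 * η) := by positivity
  have : η ≤ cosh x - cos y ∨ η ≤ cosh x' - cos y' := by
    by_contra hcon
    push Not at hcon
    have := cosh_sub_cos_sub_le (min_le_left _ _) hcon.1.le hcon.2.le
    linarith
  rcases this with h1 | h1
  · have := mul_le_mul_of_nonneg_right (core_le_of_le hη0 h1) c'
    nlinarith [mul_nonneg p c]
  · have := mul_le_mul_of_nonneg_left (core_le_of_le hη0 h1) c
    nlinarith [mul_nonneg p c']

theorem cosh_sub_cos_pos_of_mem_strip {h : ℝ} (hh : 0 < h) {z z' : ℝ × ℝ} (hz : z ∈ strip h)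
    (hz' : z' ∈ strip h) (hne : z ≠ z') :
    0 < cosh ((z'.1 - z.1) / h) - cos ((z'.2 - z.2) / h) := by
  by_cases h1 : z'.1 - z.1 = 0
  · have h2 : z'.2 - z.2 ≠ 0 := fun h2 =>
      hne (Prod.ext (sub_eq_zero.1 h1).symm (sub_eq_zero.1 h2).symm)
    rw [h1, zero_div, cosh_zero]
    have hlt : |(z'.2 - z.2) / h| < 2 * π := by
      rw [abs_div, abs_of_pos hh, div_lt_iff₀ hh, abs_lt]
      have a := hz.2
      have b := hz'.2
      constructor <;> nlinarith [a.1, a.2, b.1, b.2]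
    rw [sub_pos]
    refine lt_of_le_of_ne (cos_le_one _) fun hc => ?_
    exact div_ne_zero h2 hh.ne' ((cos_eq_one_iff_of_lt_of_lt (abs_lt.1 hlt).1 (abs_lt.1 hlt).2).1 hc)
  · exact cosh_sub_cos_pos (div_ne_zero h1 hh.ne') _

theorem measurable_density (ν h : ℝ) (z z' : ℝ × ℝ) : Measurable (fun ζ : ℝ × ℝ =>
    density ν ((ζ.1 - z.1) / h) ((ζ.2 - z.2) / h) ((ζ.1 - z'.1) / h) ((ζ.2 - z'.2) / h)) := by
  unfold density perA perB perD
  fun_prop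

theorem integrableOn_density {ν h : ℝ} (hν₀ : 0 ≤ ν) (hν₁ : ν < 1) (hh : 0 < h)
    {z z' : ℝ × ℝ} (hz : z ∈ strip h) (hz' : z' ∈ strip h) (hne : z ≠ z') :
    IntegrableOn (fun ζ : ℝ × ℝ => density ν ((ζ.1 - z.1) / h) ((ζ.2 - z.2) / h)
      ((ζ.1 - z'.1) / h) ((ζ.2 - z'.2) / h)) (strip h) := by
  have hd := cosh_sub_cos_pos_of_mem_strip hh hz hz' hne
  refine Integrable.mono' ((((integrableOn_core hh z).add (integrableOn_core hh z')).const_mul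
    (1 / √(2 * min 1 ((cosh ((z'.1 - z.1) / h) - cos ((z'.2 - z.2) / h)) / 20)))).const_mul 2)
    (measurable_density ν h z z').aestronglyMeasurable (Filter.Eventually.of_forall fun ζ => ?_)
  refine (abs_density_le hν₀ hν₁ _ _ _ _).trans ?_
  refine mul_le_mul_of_nonneg_left (core_mul_core_le hd (le_of_eq ?_)) zero_le_two
  congr 2 <;> ring

theorem sq_le_cosh_sub_cos {x y : ℝ} (hy : |y| ≤ π) :
    4 / π ^ 2 * (x ^ 2 + y ^ 2) ≤ 2 * (cosh x - cos y) := by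
  have h1 := sq_le_two_mul_cosh_sub_one x
  have h2 := cos_le_one_sub_mul_cos_sq hy
  have h3 : 4 / π ^ 2 ≤ 1 := by
    rw [div_le_one (by positivity)]
    nlinarith [pi_gt_three]
  have : 4 / π ^ 2 * (x ^ 2 + y ^ 2) = 4 / π ^ 2 * x ^ 2 + 2 * (2 / π ^ 2 * y ^ 2) := by ring
  nlinarith [mul_le_mul_of_nonneg_right h3 (sq_nonneg x)]

theorem measurableSet_periodicBall (h ρ : ℝ) (z : ℝ × ℝ) : MeasurableSet (periodicBall h ρ z) := by
  have : periodicBall h ρ z =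
      ⋃ n : ℤ, {ζ | (ζ - z - shift h n).1 ^ 2 + (ζ - z - shift h n).2 ^ 2 < ρ ^ 2} := by
    ext ζ; simp [periodicBall]
  rw [this]
  exact MeasurableSet.iUnion fun n => measurableSet_lt (by fun_prop) (by fun_prop)

theorem le_cosh_sub_cos_of_notMem_periodicBall {h ρ : ℝ} (hh : 0 < h) {z ζ : ℝ × ℝ}
    (hζ : ζ ∉ periodicBall h ρ z) :
    2 / π ^ 2 * (ρ / h) ^ 2 ≤ cosh ((ζ.1 - z.1) / h) - cos ((ζ.2 - z.2) / h) := by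
  set Y := (ζ.2 - z.2) / h with hY
  -- Pass to the nearest lattice translate, where the angle is at most `π` and the quadratic lower
  -- bound applies.
  have hcos : cos Y = cos (Y - round (Y / (2 * π)) * (2 * π)) := (cos_sub_int_mul_two_pi _ _).symm
  have hb : |Y - round (Y / (2 * π)) * (2 * π)| ≤ π := by
    have h1 := abs_sub_round (Y / (2 * π))
    have h2 : Y - round (Y / (2 * π)) * (2 * π) = (Y / (2 * π) - round (Y / (2 * π))) * (2 * π) := by
      field_simp
    rw [h2, abs_mul, abs_of_pos two_pi_pos]
    nlinarith [pi_pos]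
  have h3 := sq_le_cosh_sub_cos (x := (ζ.1 - z.1) / h) hb
  rw [← hcos] at h3
  simp only [periodicBall, mem_ofPred_eq, not_exists, not_lt] at hζ
  have h4 := hζ (round (Y / (2 * π)))
  have h5 : (ρ / h) ^ 2 ≤ ((ζ.1 - z.1) / h) ^ 2 + (Y - round (Y / (2 * π)) * (2 * π)) ^ 2 := by
    have e : ((ζ.1 - z.1) / h) ^ 2 + (Y - round (Y / (2 * π)) * (2 * π)) ^ 2 =
        ((ζ - z - shift h (round (Y / (2 * π)))).1 ^ 2 +
          (ζ - z - shift h (round (Y / (2 * π)))).2 ^ 2) / h ^ 2 := by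
      generalize round (Y / (2 * π)) = m
      simp only [shift, Prod.fst_sub, Prod.snd_sub, sub_zero, hY]
      field_simp
    rw [e, div_pow]
    gcongr
  have h6 : 4 / π ^ 2 * (ρ / h) ^ 2 ≤ 4 / π ^ 2 *
      (((ζ.1 - z.1) / h) ^ 2 + (Y - round (Y / (2 * π)) * (2 * π)) ^ 2) := by gcongr
  have h7 : 4 / π ^ 2 * (ρ / h) ^ 2 = 2 * (2 / π ^ 2 * (ρ / h) ^ 2) := by ring
  linarith

theorem integrableOn_density_self {ν h ρ : ℝ} (hν₀ : 0 ≤ ν) (hν₁ : ν < 1) (hh : 0 < h)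
    (hρ : 0 < ρ) (z : ℝ × ℝ) :
    IntegrableOn (fun ζ : ℝ × ℝ => density ν ((ζ.1 - z.1) / h) ((ζ.2 - z.2) / h)
      ((ζ.1 - z.1) / h) ((ζ.2 - z.2) / h)) (strip h \ periodicBall h ρ z) := by
  refine Integrable.mono' (((integrableOn_core hh z).mono_set sdiff_subset).const_mul
    (2 * (1 / √(2 * (2 / π ^ 2 * (ρ / h) ^ 2)))))
    (measurable_density ν h z z).aestronglyMeasurable ?_
  filter_upwards [ae_restrict_mem ((measurableSet_strip h).diff (measurableSet_periodicBall h ρ z))]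
    with ζ hζ
  refine (abs_density_le hν₀ hν₁ _ _ _ _).trans ?_
  rw [mul_assoc]
  have := pi_pos
  gcongr
  · exact core_nonneg _ _
  · exact core_le_of_le (by positivity) (le_cosh_sub_cos_of_notMem_periodicBall hh hζ.2)

theorem energyWellDefined {μ ν b h : ℝ} (hμ : 0 < μ) (hν₀ : 0 ≤ ν) (hν₁ : ν < 1) (hb : 0 < b)
    (hh : 0 < h) : EnergyWellDefined μ ν b h := by
  intro z hz z' hz'
  have hae : ∀ w w' : ℝ × ℝ, (fun ζ : ℝ × ℝ => 2 * gammaZero μ ν b ^ 2 / μ / h ^ 2 *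
      density ν ((ζ.1 - w.1) / h) ((ζ.2 - w.2) / h) ((ζ.1 - w'.1) / h) ((ζ.2 - w'.2) / h))
      =ᵐ[volume] qPer μ ν b h w w' := fun w w' => by
    filter_upwards [ae_fst_ne w.1, ae_fst_ne w'.1] with ζ h1 h2
    exact (qPer_eq hμ.ne' hν₁ hh h1 h2).2.symm
  refine ⟨?_, fun hne => ?_, ?_⟩
  · filter_upwards [ae_fst_ne z.1, ae_fst_ne z'.1] with ζ h1 h2
    exact (qPer_eq hμ.ne' hν₁ hh h1 h2).1
  · exact ((integrableOn_density hν₀ hν₁ hh hz hz' hne).const_mul _).congr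
      (ae_restrict_of_ae (hae z z'))
  · exact ((integrableOn_density_self hν₀ hν₁ hh hb z).const_mul _).congr
      (ae_restrict_of_ae (hae z z))

/-! ### Fourier series, Parseval, and the interaction potential. -/

/-- `exp (-s + i Y)`. -/
def nome (s Y : ℝ) : ℂ := Complex.exp ⟨-s, Y⟩

theorem norm_nome (s Y : ℝ) : ‖nome s Y‖ = exp (-s) := by simp [nome, Complex.norm_exp]

theorem nome_re (s Y : ℝ) : (nome s Y).re = exp (-s) * cos Y := by simp [nome, Complex.exp_re]

theorem nome_im (s Y : ℝ) : (nome s Y).im = exp (-s) * sin Y := by simp [nome, Complex.exp_im]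

theorem norm_nome_lt_one {s : ℝ} (hs : 0 < s) (Y : ℝ) : ‖nome s Y‖ < 1 := by
  rw [norm_nome]; simpa using hs

theorem nome_mul_conj (s s' Y Y' : ℝ) :
    nome s Y * (starRingEnd ℂ) (nome s' Y') = nome (s + s') (Y - Y') := by
  simp only [nome, ← Complex.exp_conj, ← Complex.exp_add]
  congr 1
  apply Complex.ext <;> simp <;> ring

theorem nome_mul_exp (s Y y : ℝ) : nome s Y * Complex.exp (y * Complex.I) = nome s (Y + y) := by
  simp only [nome, ← Complex.exp_add]
  congr 1
  apply Complex.ext <;> simp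

theorem hasSum_geom_one {z : ℂ} (hz : ‖z‖ < 1) :
    HasSum (fun n : ℕ => z ^ (n + 1)) (z / (1 - z)) := by
  simpa [pow_succ', div_eq_mul_inv] using (hasSum_geometric_of_norm_lt_one hz).mul_left z

theorem hasSum_geom_two {z : ℂ} (hz : ‖z‖ < 1) :
    HasSum (fun n : ℕ => ((n : ℂ) + 1) * z ^ (n + 1)) (z / (1 - z) ^ 2) := by
  have h := (hasSum_nat_add_iff' (f := fun n : ℕ => (n : ℂ) * z ^ n) 1).2
    (hasSum_coe_mul_geometric_of_norm_lt_one hz)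
  simpa using h

theorem hasSum_geom_three {z : ℂ} (hz : ‖z‖ < 1) :
    HasSum (fun n : ℕ => ((n : ℂ) + 1) ^ 2 * z ^ (n + 1)) (z * (1 + z) / (1 - z) ^ 3) := by
  have h1 : 1 - z ≠ 0 := fun h => by
    rw [← sub_eq_zero.1 h] at hz; simp at hz
  have h2 := (hasSum_choose_mul_geometric_of_norm_lt_one 2 hz).mul_left (2 * z)
  have h3 := h2.sub (hasSum_geom_two hz)
  refine hasSum_of_eq h3 (funext fun n => ?_) ?_
  · have : ((Nat.choose (n + 2) 2 : ℕ) : ℂ) = ((n : ℂ) + 2) * (n + 1) / 2 := by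
      rw [Nat.cast_choose_two]; push_cast; ring
    rw [this]; ring
  · field_simp; ring

theorem integral_exp_int_mul {m : ℤ} (hm : m ≠ 0) :
    ∫ y in (-π)..π, Complex.exp (m * (y * Complex.I)) = 0 := by
  have hc : (m : ℂ) * Complex.I ≠ 0 := mul_ne_zero (by exact_mod_cast hm) Complex.I_ne_zero
  have : ∀ y : ℝ, Complex.exp (m * (y * Complex.I)) = Complex.exp ((m : ℂ) * Complex.I * y) :=
    fun y => by congr 1; ring
  simp only [this]
  rw [integral_exp_mul_complex hc]
  have e : (m : ℂ) * Complex.I * π = (m : ℂ) * Complex.I * ((-π : ℝ) : ℂ) + m * (2 * π * Complex.I) := by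
    push_cast; ring
  rw [e, Complex.exp_periodic.int_mul m, sub_self, zero_div]

/-- The function `∑ cₙ e^{i(n+1)y}` with absolutely summable coefficients. -/
def powerSeries (c : ℕ → ℂ) (y : ℝ) : ℂ :=
  ∑' n, c n * Complex.exp (((n + 1 : ℕ) : ℤ) * (y * Complex.I))

theorem norm_exp_int (m : ℤ) (y : ℝ) : ‖Complex.exp (m * (y * Complex.I))‖ = 1 := by
  rw [← mul_assoc]
  exact_mod_cast Complex.norm_exp_ofReal_mul_I (m * y)

theorem summable_powerSeries {c : ℕ → ℂ} (hc : Summable (fun n => ‖c n‖)) (y : ℝ) :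
    Summable (fun n => c n * Complex.exp (((n + 1 : ℕ) : ℤ) * (y * Complex.I))) :=
  Summable.of_norm (by simpa only [norm_mul, norm_exp_int, mul_one] using hc)

theorem continuous_powerSeries {c : ℕ → ℂ} (hc : Summable (fun n => ‖c n‖)) :
    Continuous (powerSeries c) :=
  continuous_tsum (fun n => by fun_prop) hc fun n y => by rw [norm_mul, norm_exp_int, mul_one]

theorem hasSum_integral_powerSeries_mul {c : ℕ → ℂ} (hc : Summable (fun n => ‖c n‖))
    {g : ℝ → ℂ} (hg : Continuous g) :
    HasSum (fun n => c n * ∫ y in (-π)..π, Complex.exp (((n + 1 : ℕ) : ℤ) * (y * Complex.I)) * g y)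
      (∫ y in (-π)..π, powerSeries c y * g y) := by
  have h : HasSum (fun n => ∫ y in (-π)..π,
      (c n * Complex.exp (((n + 1 : ℕ) : ℤ) * (y * Complex.I))) * g y)
      (∫ y in (-π)..π, powerSeries c y * g y) := by
    refine intervalIntegral.hasSum_integral_of_dominated_convergence (fun n y => ‖c n‖ * ‖g y‖)
      (fun n => Continuous.aestronglyMeasurable (by fun_prop)) (fun n => ?_) ?_ ?_ ?_
    · refine Filter.Eventually.of_forall fun y _ => ?_
      rw [norm_mul, norm_mul, norm_exp_int, mul_one]
    · exact Filter.Eventually.of_forall fun y _ => hc.mul_right _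
    · simp only [tsum_mul_right]
      exact (continuous_const.mul hg.norm).intervalIntegrable _ _
    · exact Filter.Eventually.of_forall fun y _ => (summable_powerSeries hc y).hasSum.mul_right _
  refine hasSum_of_eq h (funext fun n => ?_) rfl
  rw [← intervalIntegral.integral_const_mul]
  simp only [mul_assoc]

theorem intervalIntegral_conj (f : ℝ → ℂ) : ∫ y in (-π)..π, (starRingEnd ℂ) (f y) =
    (starRingEnd ℂ) (∫ y in (-π)..π, f y) := by
  rw [intervalIntegral.integral_of_le (by linarith [pi_pos]),
    intervalIntegral.integral_of_le (by linarith [pi_pos]), integral_conj]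

/-- All frequencies of the product are strictly positive. -/
theorem integral_exp_mul_powerSeries {c : ℕ → ℂ} (hc : Summable (fun n => ‖c n‖)) (m : ℕ) :
    ∫ y in (-π)..π, Complex.exp (m * (y * Complex.I)) * powerSeries c y = 0 := by
  have h := hasSum_integral_powerSeries_mul hc
    (g := fun y => Complex.exp (m * (y * Complex.I))) (by fun_prop)
  simp only [← Complex.exp_add, ← add_mul] at h
  have h0 : ∀ n : ℕ, ∫ y in (-π)..π,
      Complex.exp (((((n + 1 : ℕ) : ℤ) : ℂ) + m) * (y * Complex.I)) = 0 := fun n => by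
    have := integral_exp_int_mul (m := ((n + 1 : ℕ) : ℤ) + m) (by positivity)
    exact_mod_cast this
  simp only [h0, mul_zero] at h
  simpa only [mul_comm] using h.unique hasSum_zero

theorem integral_exp_mul_conj_powerSeries {c : ℕ → ℂ} (hc : Summable (fun n => ‖c n‖)) (m : ℕ) :
    ∫ y in (-π)..π, Complex.exp (((m + 1 : ℕ) : ℤ) * (y * Complex.I)) *
      (starRingEnd ℂ) (powerSeries c y) = 2 * π * (starRingEnd ℂ) (c m) := by
  have h := hasSum_integral_powerSeries_mul hc
    (g := fun y => Complex.exp ((-((m + 1 : ℕ) : ℤ) : ℤ) * (y * Complex.I))) (by fun_prop)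
  simp only [← Complex.exp_add, ← add_mul] at h
  have h0 : ∀ n : ℕ, n ≠ m → c n * ∫ y in (-π)..π,
      Complex.exp (((((n + 1 : ℕ) : ℤ) : ℂ) + ((-((m + 1 : ℕ) : ℤ) : ℤ) : ℂ)) * (y * Complex.I))
        = 0 := fun n hn => by
    have := integral_exp_int_mul (m := ((n + 1 : ℕ) : ℤ) + -((m + 1 : ℕ) : ℤ)) (by omega)
    rw [← Int.cast_add, this, mul_zero]
  have h1 := h.unique (hasSum_single m h0)
  rw [← Int.cast_add, add_neg_cancel] at h1
  simp only [Int.cast_zero, zero_mul, Complex.exp_zero, intervalIntegral.integral_const,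
    sub_neg_eq_add] at h1
  have h2 := congrArg (starRingEnd ℂ) h1
  rw [← intervalIntegral_conj] at h2
  simp only [map_mul, ← Complex.exp_conj, Complex.conj_I, Complex.conj_ofReal] at h2
  refine (intervalIntegral.integral_congr fun y _ => ?_).trans (h2.trans ?_)
  · simp only [mul_comm _ ((starRingEnd ℂ) (powerSeries c y))]
    congr 2
    push_cast
    simp
    ring
  · simp; ring

/-- Parseval's identity for real parts of one-sided Fourier series. -/
theorem integral_re_mul_re_powerSeries {c d : ℕ → ℂ} (hc : Summable (fun n => ‖c n‖))
    (hd : Summable (fun n => ‖d n‖)) :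
    ∫ y in (-π)..π, (powerSeries c y).re * (powerSeries d y).re =
      π * (∑' n, c n * (starRingEnd ℂ) (d n)).re := by
  have cc := continuous_powerSeries hc
  have cd := continuous_powerSeries hd
  -- Pair the first series with twice the real part of the second: the unconjugated half integrates
  -- to zero, and orthogonality leaves the diagonal of the conjugated half.
  have h := hasSum_integral_powerSeries_mul hc
    (g := fun y => powerSeries d y + (starRingEnd ℂ) (powerSeries d y))
    (cd.add (Complex.continuous_conj.comp cd))
  have h0 : ∀ n : ℕ, ∫ y in (-π)..π, Complex.exp (((n + 1 : ℕ) : ℤ) * (y * Complex.I)) *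
      (powerSeries d y + (starRingEnd ℂ) (powerSeries d y)) = 2 * π * (starRingEnd ℂ) (d n) := by
    intro n
    simp only [mul_add]
    rw [intervalIntegral.integral_add, integral_exp_mul_conj_powerSeries hd]
    · have := integral_exp_mul_powerSeries hd (n + 1)
      rw [Int.cast_natCast, this, zero_add]
    · exact Continuous.intervalIntegrable (by fun_prop) _ _
    · exact Continuous.intervalIntegrable
        (Continuous.mul (by fun_prop) (Complex.continuous_conj.comp cd)) _ _
  simp only [h0] at h
  have h1 : (fun n => c n * (2 * π * (starRingEnd ℂ) (d n))) =
      fun n => 2 * π * (c n * (starRingEnd ℂ) (d n)) := by ext n; ring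
  rw [h1] at h
  have h2 := h.tsum_eq
  rw [tsum_mul_left] at h2
  have h3 : ∫ y in (-π)..π, (powerSeries c y).re * (powerSeries d y).re =
      ∫ y in (-π)..π, (1 / 2) * (powerSeries c y *
        (powerSeries d y + (starRingEnd ℂ) (powerSeries d y))).re := by
    congr 1; ext y
    rw [Complex.add_conj, Complex.re_mul_ofReal]; ring
  have h4 := Complex.reCLM.intervalIntegral_comp_comm (μ := volume) (a := -π) (b := π)
    (f := fun y => powerSeries c y * (powerSeries d y + (starRingEnd ℂ) (powerSeries d y)))
    (Continuous.intervalIntegrable (cc.mul (cd.add (Complex.continuous_conj.comp cd))) _ _)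
  simp only [Complex.reCLM_apply] at h4
  rw [h3, intervalIntegral.integral_const_mul, h4, ← h2,
    show (2 * π : ℂ) = ((2 * π : ℝ) : ℂ) by push_cast; ring, Complex.re_ofReal_mul]
  ring

/-- The sums `∑ n^k e^{-ns} cos (nY)`, `k = 0, 1, 2`, and `∑ e^{-ns} cos (nY) / n` in closed form. -/
def kernelG (s Y : ℝ) : ℝ := (nome s Y / (1 - nome s Y)).re

def kernelGone (s Y : ℝ) : ℝ := (nome s Y / (1 - nome s Y) ^ 2).re

def kernelGtwo (s Y : ℝ) : ℝ := (nome s Y * (1 + nome s Y) / (1 - nome s Y) ^ 3).re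

def kernelF (s Y : ℝ) : ℝ := -log ‖1 - nome s Y‖

theorem norm_one_sub_nome_sq (s Y : ℝ) :
    ‖1 - nome s Y‖ ^ 2 = 2 * exp (-s) * (cosh s - cos Y) := by
  rw [← Complex.normSq_eq_norm_sq, Complex.normSq_apply, cosh_eq]
  simp only [Complex.sub_re, Complex.sub_im, Complex.one_re, Complex.one_im, nome_re, nome_im]
  have h1 : exp (-s) * exp s = 1 := by rw [← exp_add]; simp
  have h2 := sin_sq_add_cos_sq Y
  linear_combination (exp (-s)) ^ 2 * h2 - h1

theorem one_sub_nome_ne_zero {s Y : ℝ} (h : 0 < cosh s - cos Y) : 1 - nome s Y ≠ 0 := by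
  have h1 := norm_one_sub_nome_sq s Y
  have h2 : 0 < 2 * exp (-s) * (cosh s - cos Y) := by positivity
  intro h3
  rw [h3] at h1
  simp at h1
  linarith

theorem nome_div_one_sub_im {s Y : ℝ} (h : 0 < cosh s - cos Y) :
    (nome s Y / (1 - nome s Y)).im = sin Y / (2 * (cosh s - cos Y)) := by
  have h1 := norm_one_sub_nome_sq s Y
  rw [← Complex.normSq_eq_norm_sq] at h1
  rw [Complex.div_im, h1]
  simp only [Complex.sub_re, Complex.sub_im, Complex.one_re, Complex.one_im, nome_re, nome_im]
  have := exp_pos (-s)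
  field_simp
  ring

theorem kernelG_eq {s Y : ℝ} (h : 0 < cosh s - cos Y) :
    kernelG s Y = (sinh s / (cosh s - cos Y) - 1) / 2 := by
  have h1 := norm_one_sub_nome_sq s Y
  rw [← Complex.normSq_eq_norm_sq] at h1
  rw [kernelG, Complex.div_re, h1]
  simp only [Complex.sub_re, Complex.sub_im, Complex.one_re, Complex.one_im, nome_re, nome_im]
  have := exp_pos (-s)
  have h2 := sin_sq_add_cos_sq Y
  have h3 : cosh s - sinh s = exp (-s) := cosh_sub_sinh s
  field_simp
  linear_combination -exp (-s) * h2 + h3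

theorem nome_div_one_sub_sq {s Y : ℝ} (h : 0 < cosh s - cos Y) :
    nome s Y / (1 - nome s Y) ^ 2 = ⟨(cosh s * cos Y - 1) / (2 * (cosh s - cos Y) ^ 2),
      sinh s * sin Y / (2 * (cosh s - cos Y) ^ 2)⟩ := by
  have hinv : (nome s Y)⁻¹ = nome (-s) (-Y) := by
    rw [nome, nome, ← Complex.exp_neg]; congr 1
  have hq : nome s Y ≠ 0 := Complex.exp_ne_zero _
  have hsum : nome s Y + nome (-s) (-Y) = 2 * ⟨cosh s * cos Y, -(sinh s * sin Y)⟩ := by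
    apply Complex.ext
    · simp [nome_re, cosh_eq]; ring
    · simp [nome_im, sinh_eq]; ring
  have hsq : (1 - nome s Y) ^ 2 =
      nome s Y * (2 * ⟨cosh s * cos Y - 1, -(sinh s * sin Y)⟩) := by
    have e : (⟨cosh s * cos Y - 1, -(sinh s * sin Y)⟩ : ℂ) =
        ⟨cosh s * cos Y, -(sinh s * sin Y)⟩ - 1 := by apply Complex.ext <;> simp
    rw [e, mul_sub, ← hsum, ← hinv]
    field_simp
    ring
  have hn := normSq_one_sub_cos s Y
  have hn' : (cosh s * cos Y - 1) * (cosh s * cos Y - 1) +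
      -(sinh s * sin Y) * -(sinh s * sin Y) = (cosh s - cos Y) ^ 2 := by rw [← hn]; ring
  rw [hsq, div_mul_eq_div_div, div_self hq, one_div, mul_inv]
  apply Complex.ext
  · simp [Complex.mul_re, Complex.inv_re, Complex.inv_im, Complex.normSq_mk]
    rw [← neg_mul_neg (sinh s * sin Y), hn']
    field_simp
  · simp [Complex.mul_im, Complex.inv_re, Complex.inv_im, Complex.normSq_mk]
    rw [← neg_mul_neg (sinh s * sin Y), hn']
    field_simp

theorem hasDerivAt_nome (s Y : ℝ) : HasDerivAt (fun t => nome t Y) (-nome s Y) s := by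
  have h1 : HasDerivAt (fun t : ℝ => (⟨-t, Y⟩ : ℂ)) (-1) s := by
    have : HasDerivAt (fun t : ℝ => -(t : ℂ) + (Y : ℂ) * Complex.I) (-1) s :=
      ((HasDerivAt.ofReal_comp (hasDerivAt_id s)).neg).add_const _
    convert this using 1
    ext t; rw [Complex.mk_eq_add_mul_I]; push_cast; rfl
  refine (h1.cexp).congr_deriv ?_
  simp [nome]

/-- Differentiation in `s` acts as `-q d/dq`. It multiplies the `n`-th coefficient by `-n`, so the
four kernels form a chain of derivatives, up to sign. -/
theorem hasDerivAt_re_comp_nome {f : ℂ → ℂ} {f' : ℂ} {s Y : ℝ}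
    (hf : HasDerivAt f f' (nome s Y)) :
    HasDerivAt (fun t => (f (nome t Y)).re) (-(nome s Y * f').re) s := by
  have h1 : HasDerivAt (fun t => f (nome t Y)) (f' * -nome s Y) s :=
    hf.comp_of_eq s (hasDerivAt_nome s Y) rfl
  have h2 := Complex.reCLM.hasFDerivAt.comp_hasDerivAt s h1
  refine h2.congr_deriv ?_
  simp; ring

theorem hasDerivAt_kernelG {s Y : ℝ} (h : 0 < cosh s - cos Y) :
    HasDerivAt (fun t => kernelG t Y) (-kernelGone s Y) s := by
  have hne := one_sub_nome_ne_zero h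
  have h1 : HasDerivAt (fun z : ℂ => z / (1 - z)) (1 / (1 - nome s Y) ^ 2) (nome s Y) := by
    refine ((hasDerivAt_id (nome s Y)).div ((hasDerivAt_id (nome s Y)).const_sub 1) hne).congr_deriv ?_
    simp
  refine (hasDerivAt_re_comp_nome h1).congr_deriv ?_
  rw [kernelGone, mul_one_div]

theorem hasDerivAt_kernelGone {s Y : ℝ} (h : 0 < cosh s - cos Y) :
    HasDerivAt (fun t => kernelGone t Y) (-kernelGtwo s Y) s := by
  have hne := one_sub_nome_ne_zero h
  have h1 : HasDerivAt (fun z : ℂ => z / (1 - z) ^ 2) ((1 + nome s Y) / (1 - nome s Y) ^ 3)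
      (nome s Y) := by
    refine ((hasDerivAt_id (nome s Y)).div (((hasDerivAt_id (nome s Y)).const_sub 1).pow 2)
      (pow_ne_zero 2 hne)).congr_deriv ?_
    simp
    field_simp
    ring
  refine (hasDerivAt_re_comp_nome h1).congr_deriv ?_
  rw [kernelGtwo, mul_div_assoc]

theorem one_sub_nome_mem_slitPlane {s Y : ℝ} (hs : 0 ≤ s) (h : 0 < cosh s - cos Y) :
    1 - nome s Y ∈ Complex.slitPlane := by
  refine Or.inl ?_
  simp only [Complex.sub_re, Complex.one_re, nome_re, sub_pos]
  rcases hs.eq_or_lt with rfl | hs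
  · simp at h ⊢; exact h
  · have h1 : exp (-s) < 1 := by simpa using hs
    nlinarith [cos_le_one Y, exp_pos (-s)]

theorem hasDerivAt_kernelF {s Y : ℝ} (hs : 0 ≤ s) (h : 0 < cosh s - cos Y) :
    HasDerivAt (fun t => kernelF t Y) (-kernelG s Y) s := by
  have h1 : HasDerivAt (fun z : ℂ => -Complex.log (1 - z)) (1 / (1 - nome s Y)) (nome s Y) := by
    refine (((hasDerivAt_id (nome s Y)).const_sub 1).clog (one_sub_nome_mem_slitPlane hs h)).neg.congr_deriv ?_
    simp [neg_div]
  have h2 := (hasDerivAt_re_comp_nome h1).congr_deriv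
    (g' := -kernelG s Y) (by rw [kernelG, mul_one_div])
  simpa only [kernelF, Complex.neg_re, Complex.log_re] using h2

/-- An antiderivative of `t ↦ α G(a + 2t) + 2t(t + a) G₂(a + 2t)`. -/
def sliceAntideriv (α a Y t : ℝ) : ℝ :=
  -((1 + α) / 2) * kernelF (a + 2 * t) Y - t * (t + a) * kernelGone (a + 2 * t) Y
    - (a + 2 * t) / 2 * kernelG (a + 2 * t) Y

theorem hasDerivAt_sliceAntideriv (α : ℝ) {a Y t : ℝ} (hs : 0 ≤ a + 2 * t)
    (h : 0 < cosh (a + 2 * t) - cos Y) :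
    HasDerivAt (sliceAntideriv α a Y)
      (α * kernelG (a + 2 * t) Y + 2 * (t * (t + a)) * kernelGtwo (a + 2 * t) Y) t := by
  have hl : HasDerivAt (fun t : ℝ => a + 2 * t) 2 t := by
    simpa using ((hasDerivAt_id t).const_mul 2).const_add a
  have hF := (hasDerivAt_kernelF hs h).comp_of_eq t hl rfl
  have hG := (hasDerivAt_kernelG h).comp_of_eq t hl rfl
  have hG1 := (hasDerivAt_kernelGone h).comp_of_eq t hl rfl
  have hp : HasDerivAt (fun t : ℝ => t * (t + a)) (2 * t + a) t := by
    refine ((hasDerivAt_id t).mul ((hasDerivAt_id t).add_const a)).congr_deriv ?_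
    simp; ring
  refine (((hF.const_mul (-((1 + α) / 2))).sub (hp.mul hG1)).sub
    ((hl.div_const 2).mul hG)).congr_deriv ?_
  simp only [Function.comp_apply]
  ring

theorem one_half_le_norm_one_sub_nome {s : ℝ} (hs : 1 ≤ s) (Y : ℝ) : 1 / 2 ≤ ‖1 - nome s Y‖ := by
  have h1 : ‖(1 : ℂ)‖ - ‖nome s Y‖ ≤ ‖1 - nome s Y‖ := norm_sub_norm_le _ _
  rw [norm_one, norm_nome] at h1
  have h2 : exp (-s) ≤ exp (-1) := exp_le_exp.2 (by linarith)
  have h3 : exp (-1) ≤ 1 / 2 := by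
    rw [exp_neg, ← one_div]
    exact one_div_le_one_div_of_le two_pos (by linarith [add_one_le_exp (1 : ℝ)])
  linarith

theorem abs_kernelG_le {s : ℝ} (hs : 1 ≤ s) (Y : ℝ) : |kernelG s Y| ≤ 2 * exp (-s) := by
  refine (Complex.abs_re_le_norm _).trans ?_
  have h := one_half_le_norm_one_sub_nome hs Y
  rw [norm_div, norm_nome, div_le_iff₀ (by linarith)]
  nlinarith [exp_pos (-s)]

theorem abs_kernelGone_le {s : ℝ} (hs : 1 ≤ s) (Y : ℝ) : |kernelGone s Y| ≤ 4 * exp (-s) := by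
  refine (Complex.abs_re_le_norm _).trans ?_
  have h := one_half_le_norm_one_sub_nome hs Y
  have h2 : (1 / 2) ^ 2 ≤ ‖1 - nome s Y‖ ^ 2 := pow_le_pow_left₀ (by norm_num) h 2
  rw [norm_div, norm_pow, norm_nome, div_le_iff₀ (by positivity)]
  nlinarith [exp_pos (-s)]

theorem abs_kernelF_le {s : ℝ} (hs : 1 ≤ s) (Y : ℝ) : |kernelF s Y| ≤ 2 * exp (-s) := by
  have h := one_half_le_norm_one_sub_nome hs Y
  have hlow : ‖(1 : ℂ)‖ - ‖nome s Y‖ ≤ ‖1 - nome s Y‖ := norm_sub_norm_le _ _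
  have hup : ‖1 - nome s Y‖ ≤ ‖(1 : ℂ)‖ + ‖nome s Y‖ := norm_sub_le _ _
  rw [norm_one, norm_nome] at hlow hup
  set r := ‖1 - nome s Y‖
  have hr : 0 < r := by linarith
  have h1 := log_le_sub_one_of_pos hr
  have h2 := one_sub_inv_le_log_of_pos hr
  have h3 : r⁻¹ - 1 ≤ 2 * exp (-s) := by
    have : r⁻¹ - 1 = (1 - r) / r := by field_simp
    rw [this, div_le_iff₀ hr]
    nlinarith [exp_pos (-s)]
  rw [kernelF, abs_neg, abs_le]
  constructor <;> linarith [exp_pos (-s)]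

open Filter Topology in
theorem tendsto_sliceAntideriv (α a Y : ℝ) :
    Tendsto (sliceAntideriv α a Y) atTop (𝓝 0) := by
  have hlin : Tendsto (fun t : ℝ => a + 2 * t) atTop atTop :=
    tendsto_atTop_add_const_left _ _ (tendsto_id.const_mul_atTop two_pos)
  have hexp : Tendsto (fun s : ℝ => exp (-s)) atTop (𝓝 0) := tendsto_exp_neg_atTop_nhds_zero
  have hF : Tendsto (fun s => kernelF s Y) atTop (𝓝 0) :=
    squeeze_zero_norm' ((eventually_ge_atTop 1).mono fun s hs => abs_kernelF_le hs Y)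
      (by simpa using hexp.const_mul 2)
  have hG : Tendsto (fun s => s * kernelG s Y) atTop (𝓝 0) := by
    refine squeeze_zero_norm' (a := fun s => 2 * (s ^ 1 * exp (-s)))
      ((eventually_ge_atTop 1).mono fun s hs => ?_)
      (by simpa using (tendsto_pow_mul_exp_neg_atTop_nhds_zero 1).const_mul 2)
    rw [norm_mul, norm_of_nonneg (by linarith : 0 ≤ s), pow_one]
    have := mul_le_mul_of_nonneg_left (abs_kernelG_le hs Y) (by linarith : 0 ≤ s)
    rw [norm_eq_abs]; linarith
  have hG1 : Tendsto (fun s => kernelGone s Y) atTop (𝓝 0) :=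
    squeeze_zero_norm' ((eventually_ge_atTop 1).mono fun s hs => abs_kernelGone_le hs Y)
      (by simpa using hexp.const_mul 4)
  have hG2 : Tendsto (fun s => s ^ 2 * kernelGone s Y) atTop (𝓝 0) := by
    refine squeeze_zero_norm' (a := fun s => 4 * (s ^ 2 * exp (-s)))
      ((eventually_ge_atTop 1).mono fun s hs => ?_)
      (by simpa using (tendsto_pow_mul_exp_neg_atTop_nhds_zero 2).const_mul 4)
    rw [norm_mul, norm_of_nonneg (by positivity)]
    have := mul_le_mul_of_nonneg_left (abs_kernelGone_le hs Y) (sq_nonneg s)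
    rw [norm_eq_abs]; linarith
  -- With `s = a + 2t` one has `t (t + a) = (s² - a²) / 4`.
  have key : sliceAntideriv α a Y = (fun s => -((1 + α) / 2) * kernelF s Y
      - (1 / 4 * (s ^ 2 * kernelGone s Y) - a ^ 2 / 4 * kernelGone s Y)
      - 1 / 2 * (s * kernelG s Y)) ∘ (fun t => a + 2 * t) := by
    ext t; simp only [sliceAntideriv, Function.comp_apply]; ring
  rw [key]
  refine Tendsto.comp ?_ hlin
  have hlim := ((hF.const_mul (-((1 + α) / 2))).sub
    ((hG2.const_mul (1 / 4)).sub (hG1.const_mul (a ^ 2 / 4)))).sub (hG.const_mul (1 / 2))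
  simp only [mul_zero, sub_zero] at hlim
  exact hlim

theorem nome_pow_mul_exp (s y t : ℝ) (n : ℕ) :
    nome s (-y) ^ (n + 1) * Complex.exp (((n + 1 : ℕ) : ℤ) * (t * Complex.I)) =
      nome s (t - y) ^ (n + 1) := by
  have h := nome_mul_exp s (-y) t
  rw [neg_add_eq_sub] at h
  rw [← h, mul_pow, ← Complex.exp_nat_mul]
  simp

theorem summable_norm_pow_mul_nome {s : ℝ} (hs : 0 < s) (y : ℝ) (κ : ℂ) (k : ℕ) :
    Summable (fun n : ℕ => ‖κ * (((n : ℂ) + 1) ^ k * nome s (-y) ^ (n + 1))‖) := by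
  have h := (summable_nat_add_iff 1).2 (summable_norm_pow_mul_geometric_of_norm_lt_one k
    (norm_nome_lt_one hs (-y)))
  simp only [norm_mul]
  refine Summable.mul_left _ ?_
  simpa only [norm_mul, Nat.cast_add, Nat.cast_one] using h

theorem powerSeries_one {s : ℝ} (hs : 0 < s) (y t : ℝ) (κ : ℂ) :
    powerSeries (fun n : ℕ => κ * (((n : ℂ) + 1) ^ 0 * nome s (-y) ^ (n + 1))) t =
      κ * (nome s (t - y) / (1 - nome s (t - y))) := by
  rw [powerSeries, ← ((hasSum_geom_one (norm_nome_lt_one hs (t - y))).mul_left κ).tsum_eq]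
  congr 1; ext n
  rw [← nome_pow_mul_exp]; ring

theorem powerSeries_two {s : ℝ} (hs : 0 < s) (y t : ℝ) (κ : ℂ) :
    powerSeries (fun n : ℕ => κ * (((n : ℂ) + 1) ^ 1 * nome s (-y) ^ (n + 1))) t =
      κ * (nome s (t - y) / (1 - nome s (t - y)) ^ 2) := by
  rw [powerSeries, ← ((hasSum_geom_two (norm_nome_lt_one hs (t - y))).mul_left κ).tsum_eq]
  congr 1; ext n
  rw [← nome_pow_mul_exp]; ring

/-- The field is even in `x`, so the base of the series can be taken with `|x|`, which keeps it
inside the unit disc. -/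
theorem perA_eq_powerSeries {x : ℝ} (hx : x ≠ 0) (y t : ℝ) : perA x (t - y) =
    (powerSeries (fun n : ℕ => Complex.I * (((n : ℂ) + 1) ^ 0 * nome |x| (-y) ^ (n + 1))) t).re := by
  have hD := cosh_sub_cos_pos (abs_ne_zero.2 hx) (t - y)
  rw [powerSeries_one (abs_pos.2 hx), Complex.I_mul_re, nome_div_one_sub_im hD, perA, cosh_abs]
  ring

theorem perB_eq_powerSeries {x : ℝ} (hx : x ≠ 0) (y t : ℝ) : perB x (t - y) =
    (powerSeries (fun n : ℕ => (|x| * Complex.I) *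
      (((n : ℂ) + 1) ^ 1 * nome |x| (-y) ^ (n + 1))) t).re := by
  have hD := cosh_sub_cos_pos (abs_ne_zero.2 hx) (t - y)
  rw [powerSeries_two (abs_pos.2 hx), mul_assoc, Complex.re_ofReal_mul, Complex.I_mul_re,
    nome_div_one_sub_sq hD, perB, cosh_abs]
  have : |x| * sinh |x| = x * sinh x := by rcases abs_cases x with ⟨h, _⟩ | ⟨h, _⟩ <;> simp [h]
  rw [← this]
  ring

theorem perD_eq_powerSeries {x : ℝ} (hx : x ≠ 0) (y t : ℝ) : perD x (t - y) =
    (powerSeries (fun n : ℕ => x * (((n : ℂ) + 1) ^ 1 * nome |x| (-y) ^ (n + 1))) t).re := by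
  have hD := cosh_sub_cos_pos (abs_ne_zero.2 hx) (t - y)
  rw [powerSeries_two (abs_pos.2 hx), Complex.re_ofReal_mul, nome_div_one_sub_sq hD, perD, cosh_abs]
  ring

/-- By Parseval the product of the `A` fields contributes the series with coefficients `1`. The `B`
and `D` fields have coefficients proportional to `n`, so their products give `n²`, with weights `|x|
|x'|` and `x x'`. -/
theorem integral_density_unit {ν x x' : ℝ} (hx : x ≠ 0) (hx' : x' ≠ 0) (y y' : ℝ) :
    ∫ t in (-π)..π, density ν x (t - y) x' (t - y') =
      π * ((1 - 2 * ν) * kernelG (|x| + |x'|) (y' - y) +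
        (|x| * |x'| + x * x') * kernelGtwo (|x| + |x'|) (y' - y)) := by
  have px := abs_pos.2 hx
  have px' := abs_pos.2 hx'
  have hs := add_pos px px'
  have hn := norm_nome_lt_one hs (y' - y)
  have s0 := fun κ k => summable_norm_pow_mul_nome px y κ k
  have s0' := fun κ k => summable_norm_pow_mul_nome px' y' κ k
  have c0 := fun κ k => Complex.continuous_re.comp (continuous_powerSeries (s0 κ k))
  have c0' := fun κ k => Complex.continuous_re.comp (continuous_powerSeries (s0' κ k))
  have hconj : ∀ (k n : ℕ), (((n : ℂ) + 1) ^ k * nome |x| (-y) ^ (n + 1)) *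
      (starRingEnd ℂ) (((n : ℂ) + 1) ^ k * nome |x'| (-y') ^ (n + 1)) =
      ((n : ℂ) + 1) ^ (2 * k) * nome (|x| + |x'|) (y' - y) ^ (n + 1) := fun k n => by
    have h := nome_mul_conj |x| |x'| (-y) (-y')
    rw [neg_sub_neg] at h
    rw [← h]
    simp
    ring
  have hmul : ∀ (κ κ' : ℂ) (k n : ℕ), (κ * (((n : ℂ) + 1) ^ k * nome |x| (-y) ^ (n + 1))) *
      (starRingEnd ℂ) (κ' * (((n : ℂ) + 1) ^ k * nome |x'| (-y') ^ (n + 1))) =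
      κ * (starRingEnd ℂ) κ' *
        (((n : ℂ) + 1) ^ (2 * k) * nome (|x| + |x'|) (y' - y) ^ (n + 1)) := fun κ κ' k n => by
    rw [← hconj, map_mul]; ring
  simp only [density, perA_eq_powerSeries hx, perA_eq_powerSeries hx', perB_eq_powerSeries hx,
    perB_eq_powerSeries hx', perD_eq_powerSeries hx, perD_eq_powerSeries hx']
  rw [intervalIntegral.integral_add, intervalIntegral.integral_add,
    intervalIntegral.integral_const_mul, integral_re_mul_re_powerSeries (s0 _ _) (s0' _ _),
    integral_re_mul_re_powerSeries (s0 _ _) (s0' _ _),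
    integral_re_mul_re_powerSeries (s0 _ _) (s0' _ _)]
  · simp only [hmul, tsum_mul_left]
    simp only [mul_zero, pow_zero, one_mul, mul_one]
    rw [(hasSum_geom_one hn).tsum_eq, (hasSum_geom_three hn).tsum_eq]
    have e1 : Complex.I * (starRingEnd ℂ) Complex.I = ((1 : ℝ) : ℂ) := by simp
    have e2 : |x| * Complex.I * (starRingEnd ℂ) (|x'| * Complex.I) = ((|x| * |x'| : ℝ) : ℂ) := by
      rw [map_mul, Complex.conj_ofReal, mul_mul_mul_comm, e1]; push_cast; ring
    have e3 : (x : ℂ) * (starRingEnd ℂ) (x' : ℂ) = ((x * x' : ℝ) : ℂ) := by simp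
    rw [e1, e2, e3, Complex.re_ofReal_mul, Complex.re_ofReal_mul, Complex.re_ofReal_mul,
      kernelG, kernelGtwo]
    ring
  · exact Continuous.intervalIntegrable (((c0 _ _).mul (c0' _ _)).const_mul _) _ _
  · exact Continuous.intervalIntegrable ((c0 _ _).mul (c0' _ _)) _ _
  · exact Continuous.intervalIntegrable ((((c0 _ _).mul (c0' _ _)).const_mul _).add
      ((c0 _ _).mul (c0' _ _))) _ _
  · exact Continuous.intervalIntegrable ((c0 _ _).mul (c0' _ _)) _ _

/-- The integral of the energy density over a vertical line. -/
def slice (ν x x' Y : ℝ) : ℝ :=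
  (1 - 2 * ν) * kernelG (|x| + |x'|) Y + (|x| * |x'| + x * x') * kernelGtwo (|x| + |x'|) Y

theorem integral_density_line {ν x x' h : ℝ} (hh : 0 < h) (hx : x ≠ 0) (hx' : x' ≠ 0) (y y' : ℝ) :
    ∫ t in Ico (-(π * h)) (π * h), density ν x ((t - y) / h) x' ((t - y') / h) =
      h * (π * slice ν x x' ((y' - y) / h)) := by
  rw [integral_Ico_eq_integral_Ioc, ← intervalIntegral.integral_of_le (by nlinarith [pi_pos])]
  have := intervalIntegral.integral_comp_div (a := -(π * h)) (b := π * h)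
    (fun t => density ν x (t - y / h) x' (t - y' / h)) hh.ne'
  simp only [← sub_div] at this
  rw [this, neg_div, mul_div_cancel_right₀ _ hh.ne', integral_density_unit hx hx', smul_eq_mul,
    slice, sub_div]

theorem integral_slice_Ioi {α a Y t₀ : ℝ} (ht : 0 ≤ a + 2 * t₀)
    (hD : 0 < cosh (a + 2 * t₀) - cos Y)
    (hint : IntegrableOn (fun t => α * kernelG (a + 2 * t) Y +
      2 * (t * (t + a)) * kernelGtwo (a + 2 * t) Y) (Ioi t₀)) :
    ∫ t in Ioi t₀, (α * kernelG (a + 2 * t) Y + 2 * (t * (t + a)) * kernelGtwo (a + 2 * t) Y) =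
      -sliceAntideriv α a Y t₀ := by
  rw [integral_Ioi_of_hasDerivAt_of_tendsto' (fun t ht' => ?_) hint (tendsto_sliceAntideriv α a Y),
    zero_sub]
  have ht' : t₀ ≤ t := ht'
  refine hasDerivAt_sliceAntideriv α (by linarith) ?_
  have : cosh (a + 2 * t₀) ≤ cosh (a + 2 * t) := by
    rw [cosh_le_cosh, abs_of_nonneg ht, abs_of_nonneg (by linarith)]; linarith
  linarith

/-- The normalized interaction potential of two dislocations. -/
def pot (X Y : ℝ) : ℝ := kernelF |X| Y + |X| * kernelG |X| Y

/-- Between the two dislocations `|x| + |x - X| = X` and `|x| |x - X| + x (x - X) = 0`, so the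
integrand is constant. The two outer half-lines are mirror images, and each is evaluated by the
antiderivative. The terms in `kernelG` then combine so that `1 - ν` factors out and the potential no
longer depends on `ν`. -/
theorem integral_slice_of_nonneg {ν X Y : ℝ} (hX : 0 ≤ X) (hD : 0 < cosh X - cos Y)
    (hint : Integrable (fun x => slice ν x (x - X) Y)) :
    ∫ x, slice ν x (x - X) Y = 2 * (1 - ν) * pot X Y := by
  set f : ℝ → ℝ := fun t => (1 - 2 * ν) * kernelG (X + 2 * t) Y +
    2 * (t * (t + X)) * kernelGtwo (X + 2 * t) Y with hf
  have e1 : ∀ t, 0 ≤ t → slice ν (t + X) (t + X - X) Y = f t := fun t ht => by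
    simp only [slice, hf, add_sub_cancel_right, abs_of_nonneg ht, abs_of_nonneg (add_nonneg ht hX)]
    rw [show t + X + t = X + 2 * t by ring]; ring
  have e2 : ∀ t, 0 ≤ t → slice ν (-t) (-t - X) Y = f t := fun t ht => by
    have : |-t - X| = t + X := by
      rw [abs_of_nonpos (by linarith)]; ring
    simp only [slice, hf, this, abs_neg, abs_of_nonneg ht]
    rw [show t + (t + X) = X + 2 * t by ring]; ring
  have e3 : ∀ x ∈ Ioc 0 X, slice ν x (x - X) Y = (1 - 2 * ν) * kernelG X Y := fun x hx => by
    have : |x - X| = X - x := by rw [abs_of_nonpos (by linarith [hx.2])]; ring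
    simp only [slice, this, abs_of_pos hx.1]
    rw [show x + (X - x) = X by ring]; ring
  have i1 : ∫ x in Ioi X, slice ν x (x - X) Y = ∫ t in Ioi 0, f t := by
    have := (measurePreserving_add_right volume X).setIntegral_preimage_emb
      (measurableEmbedding_addRight X) (fun x => slice ν x (x - X) Y) (Ioi X)
    rw [preimage_add_const_Ioi, sub_self] at this
    rw [← this]
    exact setIntegral_congr_fun measurableSet_Ioi fun t ht => e1 t (le_of_lt ht)
  have i2 : ∫ x in Iic 0, slice ν x (x - X) Y = ∫ t in Ioi 0, f t := by
    have := integral_comp_neg_Ioi 0 (fun x => slice ν x (x - X) Y)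
    rw [neg_zero] at this
    rw [← this]
    exact setIntegral_congr_fun measurableSet_Ioi fun t ht => e2 t (le_of_lt ht)
  have i3 : ∫ x in Ioc 0 X, slice ν x (x - X) Y = X * ((1 - 2 * ν) * kernelG X Y) := by
    rw [setIntegral_congr_fun measurableSet_Ioc e3]
    simp [hX]
  have hint' : IntegrableOn f (Ioi 0) := by
    have := (hint.comp_add_right X).integrableOn (s := Ioi 0)
    exact this.congr_fun (fun t ht => e1 t (le_of_lt ht)) measurableSet_Ioi
  have hval : ∫ t in Ioi 0, f t = -sliceAntideriv (1 - 2 * ν) X Y 0 :=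
    integral_slice_Ioi (by linarith) (by simpa using hD) hint'
  have hsplit : ∫ x, slice ν x (x - X) Y = (∫ x in Iic 0, slice ν x (x - X) Y) +
      ((∫ x in Ioc 0 X, slice ν x (x - X) Y) + ∫ x in Ioi X, slice ν x (x - X) Y) := by
    rw [← setIntegral_union Ioc_disjoint_Ioi_same measurableSet_Ioi hint.integrableOn
      hint.integrableOn, Ioc_union_Ioi_eq_Ioi hX, ← setIntegral_union (Iic_disjoint_Ioi le_rfl)
      measurableSet_Ioi hint.integrableOn hint.integrableOn, Iic_union_Ioi, setIntegral_univ]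
  rw [hsplit, i1, i2, i3, hval, sliceAntideriv, pot, abs_of_nonneg hX]
  simp only [mul_zero, add_zero]
  ring

theorem integral_slice {ν X Y : ℝ} (hD : 0 < cosh X - cos Y)
    (hint : Integrable (fun x => slice ν x (x - X) Y)) :
    ∫ x, slice ν x (x - X) Y = 2 * (1 - ν) * pot X Y := by
  rcases le_total 0 X with hX | hX
  · exact integral_slice_of_nonneg hX hD hint
  · have e : ∀ x, slice ν (-x) (-x - X) Y = slice ν x (x - -X) Y := fun x => by
      have : |-x - X| = |x - -X| := by rw [← abs_neg]; congr 1; ring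
      simp only [slice, this, abs_neg]
      ring
    rw [← integral_neg_eq_self]
    simp only [e]
    have hi := hint.comp_neg
    simp only [e] at hi
    rw [integral_slice_of_nonneg (by linarith) (by rwa [cosh_neg]) hi, pot, pot, abs_neg]

theorem integral_strip_density {ν h : ℝ} (hν₀ : 0 ≤ ν) (hν₁ : ν < 1) (hh : 0 < h)
    {z z' : ℝ × ℝ} (hz : z ∈ strip h) (hz' : z' ∈ strip h) (hne : z ≠ z') :
    ∫ ζ in strip h, density ν ((ζ.1 - z.1) / h) ((ζ.2 - z.2) / h)
      ((ζ.1 - z'.1) / h) ((ζ.2 - z'.2) / h) =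
    h ^ 2 * (2 * π * (1 - ν) * pot ((z'.1 - z.1) / h) ((z'.2 - z.2) / h)) := by
  have hint := integrableOn_density hν₀ hν₁ hh hz hz' hne
  have hD := cosh_sub_cos_pos_of_mem_strip hh hz hz' hne
  set X := (z'.1 - z.1) / h with hX
  set Y := (z'.2 - z.2) / h with hY
  rw [IntegrableOn, volume_restrict_strip] at hint
  rw [volume_restrict_strip, integral_prod _ hint]
  have hae : (fun x => ∫ y in Ico (-(π * h)) (π * h), density ν ((x - z.1) / h) ((y - z.2) / h)
      ((x - z'.1) / h) ((y - z'.2) / h)) =ᵐ[volume]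
      fun x => h * (π * slice ν ((x - z.1) / h) ((x - z.1) / h - X) Y) := by
    filter_upwards [compl_mem_ae_iff.2 (measure_singleton z.1),
      compl_mem_ae_iff.2 (measure_singleton z'.1)] with x h1 h2
    have h1 : x ≠ z.1 := h1
    have h2 : x ≠ z'.1 := h2
    rw [integral_density_line hh (div_ne_zero (sub_ne_zero.2 h1) hh.ne')
      (div_ne_zero (sub_ne_zero.2 h2) hh.ne'), hX, ← sub_div]
    congr 4; ring
  have hi := (hint.integral_prod_left.congr hae)
  have hg : Integrable (fun x => slice ν x (x - X) Y) := by
    have h1 := (((hi.comp_add_right z.1).comp_mul_left' hh.ne').const_mul (h⁻¹ * π⁻¹))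
    refine h1.congr (Filter.Eventually.of_forall fun x => ?_)
    have e : (h * x + z.1 - z.1) / h = x := by field_simp; ring
    simp only [e]
    have := pi_pos
    field_simp
  rw [integral_congr_ae hae, integral_const_mul, integral_const_mul,
    integral_sub_right_eq_self (fun x => slice ν (x / h) (x / h - X) Y) z.1,
    Measure.integral_comp_div (fun x => slice ν x (x - X) Y) h, integral_slice hD hg,
    abs_of_pos hh, smul_eq_mul]
  ring

/-- The energy scale: `U_int = scale * pot`. -/
def scale (μ ν b h : ℝ) : ℝ := gammaZero μ ν b * b / (2 * π * h)

/-- The factor `1 - ν` from the integral combines with the prefactor through `γ₀ (1 - ν) / μ = b /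
(4π)`. -/
theorem uInt_eq {μ ν b h : ℝ} (hμ : 0 < μ) (hν₀ : 0 ≤ ν) (hν₁ : ν < 1) (hh : 0 < h)
    {z z' : ℝ × ℝ} (hz : z ∈ strip h) (hz' : z' ∈ strip h) (hne : z ≠ z') :
    uInt μ ν b h z z' = scale μ ν b h * pot ((z'.1 - z.1) / h) ((z'.2 - z.2) / h) := by
  have hae : qPer μ ν b h z z' =ᵐ[volume.restrict (strip h)]
      fun ζ => 2 * gammaZero μ ν b ^ 2 / μ / h ^ 2 * density ν ((ζ.1 - z.1) / h) ((ζ.2 - z.2) / h)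
        ((ζ.1 - z'.1) / h) ((ζ.2 - z'.2) / h) := by
    filter_upwards [ae_restrict_of_ae (ae_fst_ne z.1), ae_restrict_of_ae (ae_fst_ne z'.1)]
      with ζ h1 h2
    exact (qPer_eq hμ.ne' hν₁ hh h1 h2).2
  have h1 : 1 - ν ≠ 0 := by linarith
  rw [uInt, integral_congr_ae hae, integral_const_mul,
    integral_strip_density hν₀ hν₁ hh hz hz' hne, scale, gammaZero]
  field_simp
  ring

/-! ### The self energy: translation invariance and logarithmic asymptotics. -/

theorem mem_periodicBall_iff_sub {h ρ : ℝ} {z ζ : ℝ × ℝ} :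
    ζ ∈ periodicBall h ρ z ↔ ζ - z ∈ periodicBall h ρ 0 := by
  simp [periodicBall]

theorem mem_periodicBall_add_period {h ρ x y : ℝ} :
    (x, y + 2 * π * h) ∈ periodicBall h ρ 0 ↔ (x, y) ∈ periodicBall h ρ 0 := by
  constructor
  · rintro ⟨n, hn⟩
    refine ⟨n - 1, ?_⟩
    simp only [shift, Prod.mk_sub_mk, sub_zero] at hn ⊢
    push_cast
    convert hn using 3
    ring
  · rintro ⟨n, hn⟩
    refine ⟨n + 1, ?_⟩
    simp only [shift, Prod.mk_sub_mk, sub_zero] at hn ⊢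
    push_cast
    convert hn using 3
    ring

/-- The self energy density outside the core, extended by zero. -/
def selfDensity (ν h ρ : ℝ) : ℝ × ℝ → ℝ :=
  (periodicBall h ρ 0)ᶜ.indicator fun ζ => density ν (ζ.1 / h) (ζ.2 / h) (ζ.1 / h) (ζ.2 / h)

theorem selfDensity_periodic (ν ρ : ℝ) {h : ℝ} (hh : 0 < h) (x : ℝ) :
    Function.Periodic (fun y => selfDensity ν h ρ (x, y)) (2 * π * h) := fun y => by
  have e : (y + 2 * π * h) / h = y / h + 2 * π := by field_simp
  simp only [selfDensity]
  by_cases hm : (x, y) ∈ periodicBall h ρ 0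
  · rw [indicator_of_notMem (not_not.2 (mem_periodicBall_add_period.2 hm)),
      indicator_of_notMem (not_not.2 hm)]
  · rw [indicator_of_mem (mem_compl fun h => hm (mem_periodicBall_add_period.1 h)), indicator_of_mem (mem_compl hm)]
    simp only [e, density, perA, perB, perD, cos_add_two_pi, sin_add_two_pi]

theorem selfDensity_sub (ν h ρ : ℝ) (z : ℝ × ℝ) : (fun ζ => selfDensity ν h ρ (ζ - z)) =
    (periodicBall h ρ z)ᶜ.indicator fun ζ => density ν ((ζ.1 - z.1) / h) ((ζ.2 - z.2) / h)
      ((ζ.1 - z.1) / h) ((ζ.2 - z.2) / h) := by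
  ext ζ
  simp only [selfDensity]
  by_cases hm : ζ ∈ periodicBall h ρ z
  · rw [indicator_of_notMem (not_not.2 (mem_periodicBall_iff_sub.1 hm)),
      indicator_of_notMem (not_not.2 hm)]
  · rw [indicator_of_mem (mem_compl fun h => hm (mem_periodicBall_iff_sub.2 h)), indicator_of_mem (mem_compl hm)]
    rfl

theorem setIntegral_selfDensity (ν h ρ : ℝ) (z : ℝ × ℝ) :
    ∫ ζ in strip h \ periodicBall h ρ z, density ν ((ζ.1 - z.1) / h) ((ζ.2 - z.2) / h)
      ((ζ.1 - z.1) / h) ((ζ.2 - z.2) / h) = ∫ ζ in strip h, selfDensity ν h ρ (ζ - z) := by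
  rw [selfDensity_sub, setIntegral_indicator (measurableSet_periodicBall h ρ z).compl, sdiff_eq]

theorem integrableOn_selfDensity {ν h ρ : ℝ} (hν₀ : 0 ≤ ν) (hν₁ : ν < 1) (hh : 0 < h)
    (hρ : 0 < ρ) (z : ℝ × ℝ) : IntegrableOn (fun ζ => selfDensity ν h ρ (ζ - z)) (strip h) := by
  rw [selfDensity_sub, IntegrableOn,
    integrable_indicator_iff (measurableSet_periodicBall h ρ z).compl, IntegrableOn,
    Measure.restrict_restrict (measurableSet_periodicBall h ρ z).compl, inter_comm, ← sdiff_eq]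
  exact integrableOn_density_self hν₀ hν₁ hh hρ z

theorem setIntegral_selfDensity_sub {ν h ρ : ℝ} (hν₀ : 0 ≤ ν) (hν₁ : ν < 1) (hh : 0 < h)
    (hρ : 0 < ρ) (z : ℝ × ℝ) :
    ∫ ζ in strip h, selfDensity ν h ρ (ζ - z) = ∫ ζ in strip h, selfDensity ν h ρ ζ := by
  have hi := integrableOn_selfDensity hν₀ hν₁ hh hρ z
  have hi0 := integrableOn_selfDensity hν₀ hν₁ hh hρ 0
  simp only [sub_zero] at hi0
  rw [IntegrableOn, volume_restrict_strip] at hi hi0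
  rw [volume_restrict_strip, integral_prod _ hi, integral_prod _ hi0]
  rw [← integral_sub_right_eq_self
    (fun x => ∫ y in Ico (-(π * h)) (π * h), selfDensity ν h ρ (x, y)) z.1]
  congr 1; ext x
  have hle : -(π * h) ≤ π * h := by nlinarith [pi_pos]
  rw [integral_Ico_eq_integral_Ioc, integral_Ico_eq_integral_Ioc,
    ← intervalIntegral.integral_of_le hle, ← intervalIntegral.integral_of_le hle]
  have h1 := intervalIntegral.integral_comp_sub_right (a := -(π * h)) (b := π * h)
    (fun y => selfDensity ν h ρ (x - z.1, y)) z.2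
  have h2 := (selfDensity_periodic ν ρ hh (x - z.1)).intervalIntegral_add_eq (-(π * h) - z.2)
    (-(π * h))
  rw [show -(π * h) - z.2 + 2 * π * h = π * h - z.2 by ring,
    show -(π * h) + 2 * π * h = π * h by ring] at h2
  exact h1.trans h2

theorem nome_zero (s : ℝ) : nome s 0 = ((exp (-s) : ℝ) : ℂ) := by
  rw [nome, Complex.ofReal_exp]; congr 1

theorem kernelG_zero (s : ℝ) : kernelG s 0 = exp (-s) / (1 - exp (-s)) := by
  rw [kernelG, nome_zero, ← Complex.ofReal_one, ← Complex.ofReal_sub, ← Complex.ofReal_div,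
    Complex.ofReal_re]

theorem kernelF_zero {s : ℝ} (hs : 0 ≤ s) : kernelF s 0 = -log (1 - exp (-s)) := by
  have : 0 ≤ 1 - exp (-s) := by simpa using hs
  rw [kernelF, nome_zero, ← Complex.ofReal_one, ← Complex.ofReal_sub, Complex.norm_real,
    norm_of_nonneg this]

theorem kernelG_zero_bounds {s : ℝ} (hs : 0 < s) : 0 ≤ kernelG s 0 ∧ s * kernelG s 0 ≤ 1 := by
  have h1 : exp (-s) < 1 := by simpa using hs
  have h2 : 0 < 1 - exp (-s) := by linarith
  rw [kernelG_zero]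
  refine ⟨by positivity, ?_⟩
  rw [← mul_div_assoc, div_le_one h2]
  have h3 := add_one_le_exp s
  have h4 : exp (-s) * exp s = 1 := by rw [← exp_add]; simp
  nlinarith [exp_pos (-s)]

theorem kernelGone_zero_bounds {s : ℝ} (hs : 0 < s) :
    0 ≤ kernelGone s 0 ∧ s ^ 2 * kernelGone s 0 ≤ 1 := by
  have hD := cosh_sub_cos_pos hs.ne' 0
  have h1 := sq_le_two_mul_cosh_sub_one s
  rw [kernelGone, nome_div_one_sub_sq hD]
  simp only [cos_zero, mul_one] at hD ⊢
  refine ⟨by positivity, ?_⟩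
  rw [← mul_div_assoc, div_le_one (by positivity)]
  nlinarith

theorem kernelF_zero_le {s : ℝ} (hs : 0 < s) : kernelF s 0 ≤ -log s + s := by
  rw [kernelF_zero hs.le]
  have h3 := add_one_le_exp s
  have h4 : exp (-s) * exp s = 1 := by rw [← exp_add]; simp
  have h5 : s * exp (-s) ≤ 1 - exp (-s) := by nlinarith [exp_pos (-s)]
  have h6 := log_le_log (by positivity) h5
  rw [log_mul hs.ne' (exp_pos _).ne', log_exp] at h6
  linarith

theorem le_kernelF_zero {s : ℝ} (hs : 0 < s) : -log s ≤ kernelF s 0 := by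
  rw [kernelF_zero hs.le]
  have h1 : exp (-s) < 1 := by simpa using hs
  have h5 : 1 - exp (-s) ≤ s := by linarith [add_one_le_exp (-s)]
  linarith [log_le_log (by linarith) h5]

/-- The region `|x| ≥ b` misses the core, so its vertical slices are full periods and the Parseval
formula applies, now with both dislocations at the origin. -/
theorem integrableOn_and_integral_outer {ν h b : ℝ} (hν₀ : 0 ≤ ν) (hν₁ : ν < 1) (hh : 0 < h)
    (hb : 0 < b) :
    ∫ ζ in {x | b ≤ |x|} ×ˢ Ico (-(π * h)) (π * h), density ν (ζ.1 / h) (ζ.2 / h)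
      (ζ.1 / h) (ζ.2 / h) = -(2 * π * h ^ 2 * sliceAntideriv (1 - 2 * ν) 0 0 (b / h)) := by
  have hS : MeasurableSet {x : ℝ | b ≤ |x|} := measurableSet_le measurable_const (by fun_prop)
  have hsub : {x | b ≤ |x|} ×ˢ Ico (-(π * h)) (π * h) ⊆ strip h \ periodicBall h b 0 := by
    rintro ⟨x, y⟩ ⟨hx, hy⟩
    refine ⟨⟨mem_univ _, hy⟩, ?_⟩
    rintro ⟨n, hn⟩
    have hx : b ≤ |x| := hx
    simp only [shift, sub_zero, Prod.mk_sub_mk] at hn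
    have : b ^ 2 ≤ x ^ 2 := by rw [← sq_abs x]; gcongr
    nlinarith [sq_nonneg (y - 2 * π * n * h)]
  have hint := (integrableOn_density_self hν₀ hν₁ hh hb 0).mono_set hsub
  simp only [Prod.fst_zero, Prod.snd_zero, sub_zero] at hint
  rw [Measure.volume_eq_prod, IntegrableOn, ← Measure.prod_restrict] at hint
  rw [Measure.volume_eq_prod, ← Measure.prod_restrict, integral_prod _ hint]
  set φ : ℝ → ℝ := fun t => (1 - 2 * ν) * kernelG (0 + 2 * t) 0 +
    2 * (t * (t + 0)) * kernelGtwo (0 + 2 * t) 0 with hφ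
  have hline : ∀ x, b ≤ |x| → ∫ y in Ico (-(π * h)) (π * h),
      density ν (x / h) (y / h) (x / h) (y / h) = h * (π * φ (h⁻¹ * |x|)) := by
    intro x hx
    have hx0 : x ≠ 0 := abs_pos.1 (by linarith)
    have h1 := integral_density_line (ν := ν) hh (div_ne_zero hx0 hh.ne')
      (div_ne_zero hx0 hh.ne') 0 0
    simp only [sub_zero, zero_div] at h1
    rw [h1, slice, hφ]
    simp only [zero_add, add_zero]
    rw [abs_div, abs_of_pos hh, ← two_mul, ← div_eq_inv_mul,
      show x / h * (x / h) = |x| / h * (|x| / h) by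
        rw [← abs_mul_abs_self (x / h), abs_div, abs_of_pos hh]]
    ring
  have hi := hint.integral_prod_left
  have hi' : IntegrableOn (fun x => h * (π * φ (h⁻¹ * x))) (Ioi b) := by
    have : IntegrableOn (fun x => ∫ y in Ico (-(π * h)) (π * h),
      density ν (x / h) (y / h) (x / h) (y / h)) {x | b ≤ |x|} := hi
    refine (this.mono_set (t := {x | b ≤ |x|}) (s := Ioi b) fun x hx => ?_).congr_fun
      (fun x hx => ?_) measurableSet_Ioi
    · exact (le_of_lt hx).trans (le_abs_self x)
    · have hx : b < x := hx
      simp only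
      rw [hline x (hx.le.trans (le_abs_self x)), abs_of_pos (hb.trans hx)]
  have hφi : IntegrableOn φ (Ioi (b / h)) := by
    have h2 : IntegrableOn (fun x => φ (h⁻¹ * x)) (Ioi b) := by
      have h3 : IntegrableOn (fun x => h⁻¹ * π⁻¹ * (h * (π * φ (h⁻¹ * x)))) (Ioi b) :=
        Integrable.const_mul hi' (h⁻¹ * π⁻¹)
      refine h3.congr_fun (fun x _ => ?_) measurableSet_Ioi
      have := pi_pos
      simp only
      field_simp
    have h3 := (integrableOn_Ioi_comp_mul_left_iff φ b (inv_pos.2 hh)).1 h2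
    rwa [← div_eq_inv_mul] at h3
  have hρ : 0 < b / h := by positivity
  have hval := integral_slice_Ioi (Y := 0) (by positivity : 0 ≤ 0 + 2 * (b / h))
    (cosh_sub_cos_pos (by positivity) 0) hφi
  rw [setIntegral_congr_fun hS fun x hx => hline x hx, ← integral_indicator hS]
  have hind : ({x : ℝ | b ≤ |x|}.indicator fun x => h * (π * φ (h⁻¹ * |x|))) =
      fun x => (Ici b).indicator (fun t => h * (π * φ (h⁻¹ * t))) |x| := by
    ext x; simp only [indicator, mem_Ici]; rfl
  rw [hind, integral_comp_abs, setIntegral_indicator measurableSet_Ici,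
    show Ioi 0 ∩ Ici b = Ici b from inter_eq_right.2 fun x hx => hb.trans_le hx,
    integral_Ici_eq_integral_Ioi, integral_const_mul, integral_const_mul,
    integral_comp_mul_left_Ioi φ b (inv_pos.2 hh), ← div_eq_inv_mul, hval, smul_eq_mul, inv_inv]
  ring

/-- In the strip `|x| < b` outside the core, the density is at most `π² h² / (b² + y²)`; integrating
over width `2b` gives a bound of order `h²`, without a logarithm. -/
theorem abs_integral_inner_le {ν h b : ℝ} (hν₀ : 0 ≤ ν) (hν₁ : ν < 1) (hh : 0 < h)
    (hb : 0 < b) :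
    |∫ ζ in (({x | |x| < b} ×ˢ Ico (-(π * h)) (π * h)) \ periodicBall h b 0),
      density ν (ζ.1 / h) (ζ.2 / h) (ζ.1 / h) (ζ.2 / h)| ≤ 2 * π ^ 3 * h ^ 2 := by
  have hS : {x : ℝ | |x| < b} = Ioo (-b) b := by ext x; simp [abs_lt]
  rw [hS]
  have hm : MeasurableSet (Ioo (-b) b ×ˢ Ico (-(π * h)) (π * h)) :=
    measurableSet_Ioo.prod measurableSet_Ico
  set g : ℝ → ℝ := fun y => π ^ 2 * (h / b) ^ 2 * (1 + (y / b) ^ 2)⁻¹ with hg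
  have hgi : Integrable g := (integrable_inv_one_add_sq.comp_div hb.ne').const_mul _
  have hgv : ∫ y, g y = π ^ 3 * h ^ 2 / b := by
    rw [hg, integral_const_mul, Measure.integral_comp_div (fun y => (1 + y ^ 2)⁻¹),
      integral_univ_inv_one_add_sq, abs_of_pos hb, smul_eq_mul]
    field_simp
  have hprod : Integrable (fun ζ : ℝ × ℝ => (1 : ℝ) * g ζ.2)
      ((volume.restrict (Ioo (-b) b)).prod (volume.restrict (Ico (-(π * h)) (π * h)))) :=
    Integrable.mul_prod (integrable_const 1) hgi.integrableOn
  have hprod' : IntegrableOn (fun ζ : ℝ × ℝ => (1 : ℝ) * g ζ.2)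
      (Ioo (-b) b ×ˢ Ico (-(π * h)) (π * h)) := by
    rw [IntegrableOn, Measure.volume_eq_prod, ← Measure.prod_restrict]; exact hprod
  have hbound : ∀ ζ ∈ (Ioo (-b) b ×ˢ Ico (-(π * h)) (π * h)) \ periodicBall h b 0,
      ‖density ν (ζ.1 / h) (ζ.2 / h) (ζ.1 / h) (ζ.2 / h)‖ ≤ 1 * g ζ.2 := by
    rintro ⟨x, y⟩ ⟨⟨-, hy⟩, hn⟩
    have h1 := le_cosh_sub_cos_of_notMem_periodicBall hh hn
    simp only [Prod.fst_zero, Prod.snd_zero, sub_zero] at h1 hy ⊢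
    have hy' : |y / h| ≤ π := by
      rw [abs_div, abs_of_pos hh, div_le_iff₀ hh]
      exact abs_le.2 ⟨hy.1, hy.2.le⟩
    have h2 := sq_le_cosh_sub_cos (x := x / h) hy'
    -- Average of the bound coming from the excluded core and the quadratic lower bound in `y`.
    have h3 : 1 / π ^ 2 * ((b / h) ^ 2 + (y / h) ^ 2) ≤ cosh (x / h) - cos (y / h) := by
      have e1 : 2 * (1 / π ^ 2 * ((b / h) ^ 2 + (y / h) ^ 2)) + 2 / π ^ 2 * (x / h) ^ 2 =
        2 / π ^ 2 * (b / h) ^ 2 + 1 / 2 * (4 / π ^ 2 * ((x / h) ^ 2 + (y / h) ^ 2)) := by ring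
      have : 0 ≤ 2 / π ^ 2 * (x / h) ^ 2 := by positivity
      linarith
    have := pi_pos
    calc _ ≤ 2 * (core (x / h) (y / h) * core (x / h) (y / h)) := abs_density_le hν₀ hν₁ _ _ _ _
      _ = 1 / (cosh (x / h) - cos (y / h)) := by
        rw [← sq, core_sq, mul_one_div, div_mul_cancel_left₀ two_ne_zero, one_div]
      _ ≤ 1 / (1 / π ^ 2 * ((b / h) ^ 2 + (y / h) ^ 2)) :=
        one_div_le_one_div_of_le (by positivity) h3
      _ = _ := by rw [hg]; field_simp
  have hnn : ∀ ζ : ℝ × ℝ, 0 ≤ 1 * g ζ.2 := fun ζ => by rw [hg]; positivity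
  calc _ ≤ ∫ ζ in (Ioo (-b) b ×ˢ Ico (-(π * h)) (π * h)) \ periodicBall h b 0, 1 * g ζ.2 :=
        norm_integral_le_of_norm_le (hprod'.mono_set sdiff_subset)
          ((ae_restrict_mem (hm.diff (measurableSet_periodicBall h b 0))).mono hbound)
    _ ≤ ∫ ζ in Ioo (-b) b ×ˢ Ico (-(π * h)) (π * h), 1 * g ζ.2 :=
        setIntegral_mono_set hprod' (Filter.Eventually.of_forall hnn)
          (Filter.Eventually.of_forall sdiff_subset)
    _ = 2 * b * ∫ y in Ico (-(π * h)) (π * h), g y := by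
        rw [Measure.volume_eq_prod, ← Measure.prod_restrict, integral_prod_mul (fun _ => (1 : ℝ)) g]
        congr 1
        rw [integral_const]
        simp [hb.le]; ring
    _ ≤ 2 * b * ∫ y, g y := by
        refine mul_le_mul_of_nonneg_left ?_ (by positivity)
        exact setIntegral_le_integral hgi (Filter.Eventually.of_forall fun y => by
          have := hnn (0, y); simpa using this)
    _ = _ := by rw [hgv]; field_simp

/-- The logarithm is `kernelF (2b/h) 0` from the outer region. The other boundary terms stay bounded
as `b/h → 0`, and the inner region is `O(h²)`. -/
theorem abs_setIntegral_selfDensity_add_log_le {ν h b : ℝ} (hν₀ : 0 ≤ ν) (hν₁ : ν < 1) (hb : 0 < b)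
    (hbh : b ≤ h) :
    |(∫ ζ in strip h, selfDensity ν h b ζ) / (2 * π * (1 - ν) * h ^ 2) + log (b / h)| ≤
      4 + 12 / (1 - ν) := by
  have hh : 0 < h := hb.trans_le hbh
  have h1ν : 0 < 1 - ν := by linarith
  have hpi := pi_pos
  have e0 := setIntegral_selfDensity ν h b 0
  simp only [sub_zero, Prod.fst_zero, Prod.snd_zero] at e0
  set I₁ := ({x | b ≤ |x|} ×ˢ Ico (-(π * h)) (π * h) : Set (ℝ × ℝ)) with hI₁
  set I₂ := ({x | |x| < b} ×ˢ Ico (-(π * h)) (π * h) : Set (ℝ × ℝ)) \ periodicBall h b 0 with hI₂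
  have hm₂ : MeasurableSet I₂ := by
    refine MeasurableSet.diff (MeasurableSet.prod ?_ measurableSet_Ico)
      (measurableSet_periodicBall h b 0)
    exact measurableSet_lt (by fun_prop) measurable_const
  have hunion : strip h \ periodicBall h b 0 = I₁ ∪ I₂ := by
    ext ⟨x, y⟩
    constructor
    · rintro ⟨⟨-, hy⟩, hn⟩
      rcases le_or_gt b |x| with hx | hx
      · exact Or.inl ⟨hx, hy⟩
      · exact Or.inr ⟨⟨hx, hy⟩, hn⟩
    · rintro (⟨hx, hy⟩ | ⟨⟨hx, hy⟩, hn⟩)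
      · refine ⟨⟨mem_univ _, hy⟩, ?_⟩
        rintro ⟨n, hn⟩
        have hx : b ≤ |x| := hx
        simp only [shift, sub_zero, Prod.mk_sub_mk] at hn
        have : b ^ 2 ≤ x ^ 2 := by rw [← sq_abs x]; gcongr
        nlinarith [sq_nonneg (y - 2 * π * n * h)]
      · exact ⟨⟨mem_univ _, hy⟩, hn⟩
  have hdisj : Disjoint I₁ I₂ := by
    rw [Set.disjoint_left]
    rintro ⟨x, y⟩ ⟨hx, -⟩ ⟨⟨hx', -⟩, -⟩
    exact absurd (show |x| < b from hx') (not_lt.2 hx)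
  have hint := integrableOn_density_self hν₀ hν₁ hh hb 0
  simp only [sub_zero, Prod.fst_zero, Prod.snd_zero] at hint
  rw [hunion] at e0 hint
  rw [setIntegral_union hdisj hm₂ (hint.mono_set subset_union_left)
    (hint.mono_set subset_union_right), integrableOn_and_integral_outer hν₀ hν₁ hh hb] at e0
  have hI2 := abs_integral_inner_le hν₀ hν₁ hh hb
  set R := ∫ ζ in I₂, density ν (ζ.1 / h) (ζ.2 / h) (ζ.1 / h) (ζ.2 / h) with hR
  rw [← e0, sliceAntideriv]
  simp only [zero_add, add_zero]
  set ρ := b / h with hρ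
  have hρ0 : 0 < ρ := by positivity
  have hρ1 : ρ ≤ 1 := by rw [hρ, div_le_one hh]; exact hbh
  have g := kernelG_zero_bounds (s := 2 * ρ) (by positivity)
  have g1 := kernelGone_zero_bounds (s := 2 * ρ) (by positivity)
  have f1 := kernelF_zero_le (s := 2 * ρ) (by positivity)
  have f2 := le_kernelF_zero (s := 2 * ρ) (by positivity)
  rw [log_mul two_ne_zero hρ0.ne'] at f1 f2
  have hl2 : 0 ≤ log 2 := log_nonneg one_le_two
  have hl2' : log 2 ≤ 1 := by linarith [log_le_sub_one_of_pos (two_pos : (0 : ℝ) < 2)]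
  set F := kernelF (2 * ρ) 0
  set G := kernelG (2 * ρ) 0
  set G1 := kernelGone (2 * ρ) 0
  have key : (-(2 * π * h ^ 2 * (-((1 + (1 - 2 * ν)) / 2) * F - ρ * ρ * G1 - 2 * ρ / 2 * G)) + R) /
      (2 * π * (1 - ν) * h ^ 2) + log ρ =
      (F + log ρ) + (ρ ^ 2 * G1 + ρ * G + R / (2 * π * h ^ 2)) / (1 - ν) := by
    field_simp
    ring
  rw [key]
  have hRb : |R / (2 * π * h ^ 2)| ≤ π ^ 2 := by
    rw [abs_div, abs_of_pos (by positivity : 0 < 2 * π * h ^ 2), div_le_iff₀ (by positivity)]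
    linarith
  have hpi2 : π ^ 2 ≤ 10 := by nlinarith [pi_lt_d2]
  have hb1 : |F + log ρ| ≤ 4 := abs_le.2 ⟨by linarith, by linarith⟩
  -- The three terms are at most `1/4`, `1/2` and `π² ≤ 10`.
  have hb2 : |ρ ^ 2 * G1 + ρ * G + R / (2 * π * h ^ 2)| ≤ 12 := by
    have := abs_le.1 hRb
    have p1 : 0 ≤ ρ ^ 2 * G1 := mul_nonneg (sq_nonneg _) g1.1
    have p2 : 0 ≤ ρ * G := mul_nonneg hρ0.le g.1
    exact abs_le.2 ⟨by linarith, by nlinarith [g.2, g1.2]⟩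
  refine (abs_add_le _ _).trans (add_le_add hb1 ?_)
  rw [abs_div, abs_of_pos h1ν]
  gcongr

/-- The self energy in units of `scale`. -/
def selfConst (ν b h : ℝ) : ℝ :=
  (∫ ζ in strip h, selfDensity ν h b ζ) / (2 * π * (1 - ν) * h ^ 2)

theorem uSelf_eq {μ ν b h : ℝ} (hμ : 0 < μ) (hν₀ : 0 ≤ ν) (hν₁ : ν < 1) (hb : 0 < b) (hh : 0 < h)
    (z : ℝ × ℝ) : uSelf μ ν b h b z = scale μ ν b h * selfConst ν b h := by
  have hae : qPer μ ν b h z z =ᵐ[volume.restrict (strip h \ periodicBall h b z)]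
      fun ζ => 2 * gammaZero μ ν b ^ 2 / μ / h ^ 2 * density ν ((ζ.1 - z.1) / h) ((ζ.2 - z.2) / h)
        ((ζ.1 - z.1) / h) ((ζ.2 - z.2) / h) := by
    filter_upwards [ae_restrict_of_ae (ae_fst_ne z.1)] with ζ h1
    exact (qPer_eq hμ.ne' hν₁ hh h1 h1).2
  have h1 : 1 - ν ≠ 0 := by linarith
  rw [uSelf, integral_congr_ae hae, integral_const_mul, setIntegral_selfDensity,
    setIntegral_selfDensity_sub hν₀ hν₁ hh hb, scale, selfConst, gammaZero]
  field_simp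
  ring

/-! ### Lower bound for the interaction by positive definiteness. -/

theorem integrable_exp_neg_abs_sub_mul (p q : ℝ) :
    Integrable (fun x => exp (-|x - p|) * exp (-|x - q|)) := by
  have h : Integrable (fun x : ℝ => exp (-|x|)) :=
    integrable_comp_abs (f := fun x => exp (-x)) (integrableOn_exp_neg_Ioi 0)
  refine (h.comp_sub_right p).mono' (Continuous.aestronglyMeasurable (by fun_prop))
    (Filter.Eventually.of_forall fun x => ?_)
  rw [norm_of_nonneg (by positivity)]
  have : exp (-|x - q|) ≤ 1 := by simp
  nlinarith [exp_pos (-|x - p|)]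

theorem integral_exp_neg_abs_of_nonneg {a : ℝ} (ha : 0 ≤ a) :
    ∫ x, exp (-|x|) * exp (-|x - a|) = (1 + a) * exp (-a) := by
  have hi := integrable_exp_neg_abs_sub_mul 0 a
  simp only [sub_zero] at hi
  set f : ℝ → ℝ := fun x => exp (-|x|) * exp (-|x - a|) with hf
  have e1 : ∫ x in Iic 0, f x = exp (-a) / 2 := by
    have : ∀ x ∈ Iic (0 : ℝ), f x = exp (-a) * exp (2 * x) := fun x hx => by
      have hx : x ≤ 0 := hx
      simp only [hf, ← exp_add]
      rw [abs_of_nonpos hx, abs_of_nonpos (by linarith)]; congr 1; ring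
    rw [setIntegral_congr_fun measurableSet_Iic this, integral_const_mul,
      integral_exp_mul_Iic two_pos]
    simp; ring
  have e2 : ∫ x in Ioc 0 a, f x = a * exp (-a) := by
    have : ∀ x ∈ Ioc 0 a, f x = exp (-a) := fun x hx => by
      simp only [hf, ← exp_add]
      rw [abs_of_pos hx.1, abs_of_nonpos (by linarith [hx.2])]; congr 1; ring
    rw [setIntegral_congr_fun measurableSet_Ioc this]
    simp [ha]
  have e3 : ∫ x in Ioi a, f x = exp (-a) / 2 := by
    have : ∀ x ∈ Ioi a, f x = exp a * exp (-2 * x) := fun x hx => by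
      have hx : a < x := hx
      simp only [hf, ← exp_add]
      rw [abs_of_pos (by linarith), abs_of_pos (by linarith)]; congr 1; ring
    rw [setIntegral_congr_fun measurableSet_Ioi this, integral_const_mul,
      integral_exp_mul_Ioi (by norm_num)]
    rw [show -2 * a = -a + -a by ring, exp_add]
    have : exp a * exp (-a) = 1 := by rw [← exp_add]; simp
    linear_combination (exp (-a) / 2) * this
  have hsplit : ∫ x, f x = (∫ x in Iic 0, f x) + ((∫ x in Ioc 0 a, f x) + ∫ x in Ioi a, f x) := by
    rw [← setIntegral_union Ioc_disjoint_Ioi_same measurableSet_Ioi hi.integrableOn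
      hi.integrableOn, Ioc_union_Ioi_eq_Ioi ha, ← setIntegral_union (Iic_disjoint_Ioi le_rfl)
      measurableSet_Ioi hi.integrableOn hi.integrableOn, Iic_union_Ioi, setIntegral_univ]
  rw [hsplit, e1, e2, e3]; ring

theorem integral_exp_neg_abs_sub_mul (p q : ℝ) :
    ∫ x, exp (-|x - p|) * exp (-|x - q|) = (1 + |p - q|) * exp (-|p - q|) := by
  wlog h : p ≤ q generalizing p q
  · rw [abs_sub_comm p q, ← this q p (by linarith)]
    simp only [mul_comm]
  have := integral_sub_right_eq_self (fun x => exp (-|x|) * exp (-|x - (q - p)|)) p (μ := volume)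
  rw [integral_exp_neg_abs_of_nonneg (by linarith)] at this
  rw [abs_of_nonpos (by linarith), neg_sub, ← this]
  simp only [sub_sub_sub_cancel_right]

/-- The kernel is the self-convolution of `exp (-|x|)`, so the quadratic form is the integral of a
square. -/
theorem sum_exp_kernel_nonneg {ι : Type*} (s : Finset ι) (c p : ι → ℝ) :
    0 ≤ ∑ i ∈ s, ∑ j ∈ s, c i * c j * ((1 + |p i - p j|) * exp (-|p i - p j|)) := by
  have h : ∑ i ∈ s, ∑ j ∈ s, c i * c j * ((1 + |p i - p j|) * exp (-|p i - p j|)) =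
      ∫ x, (∑ i ∈ s, c i * exp (-|x - p i|)) ^ 2 := by
    have e : ∀ x, (∑ i ∈ s, c i * exp (-|x - p i|)) ^ 2 =
        ∑ i ∈ s, ∑ j ∈ s, c i * c j * (exp (-|x - p i|) * exp (-|x - p j|)) := fun x => by
      rw [sq, Finset.sum_mul_sum]
      refine Finset.sum_congr rfl fun i _ => Finset.sum_congr rfl fun j _ => ?_
      ring
    simp only [e]
    rw [integral_finsetSum _ fun i _ => integrable_finsetSum _ fun j _ =>
      (integrable_exp_neg_abs_sub_mul _ _).const_mul _]
    refine Finset.sum_congr rfl fun i _ => ?_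
    rw [integral_finsetSum _ fun j _ => (integrable_exp_neg_abs_sub_mul _ _).const_mul _]
    refine Finset.sum_congr rfl fun j _ => ?_
    rw [integral_const_mul, integral_exp_neg_abs_sub_mul]
  rw [h]
  exact integral_nonneg fun x => sq_nonneg _

/-- A positive definite minorant (up to a small constant) of `pot`. -/
def potReg (ε X Y : ℝ) : ℝ := kernelF (|X| + ε) Y + |X| * kernelG (|X| + ε) Y

theorem hasSum_kernel {s : ℝ} (hs : 0 < s) (a Y : ℝ) :
    HasSum (fun n : ℕ => (((1 / ((n : ℝ) + 1) + a : ℝ) : ℂ) * nome s Y ^ (n + 1)).re)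
      (kernelF s Y + a * kernelG s Y) := by
  have hn := norm_nome_lt_one hs Y
  have h1 := (hasSum_nat_add_iff' (f := fun n : ℕ => nome s Y ^ n / n) 1).2
    (Complex.hasSum_taylorSeries_neg_log hn)
  have h2 := (hasSum_geom_one hn).mul_left (a : ℂ)
  have h3 := Complex.hasSum_re (h1.add h2)
  refine hasSum_of_eq h3 (funext fun n => ?_) ?_
  · congr 1; push_cast; ring
  · simp [kernelF, kernelG, Complex.log_re]

theorem hasSum_potReg {ε : ℝ} (hε : 0 < ε) (X Y : ℝ) :
    HasSum (fun n : ℕ => exp (-(((n : ℝ) + 1) * ε)) / ((n : ℝ) + 1) *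
      (((1 + ((n : ℝ) + 1) * |X|) * exp (-(((n : ℝ) + 1) * |X|))) * cos (((n : ℝ) + 1) * Y)))
      (potReg ε X Y) := by
  refine hasSum_of_eq (hasSum_kernel (by positivity : 0 < |X| + ε) |X| Y) (funext fun n => ?_) rfl
  have h : nome (|X| + ε) Y ^ (n + 1) = nome (((n : ℝ) + 1) * (|X| + ε)) (((n : ℝ) + 1) * Y) := by
    rw [nome, nome, ← Complex.exp_nat_mul]
    congr 1
    apply Complex.ext <;> simp
    · ring
  rw [h, Complex.re_ofReal_mul, nome_re, mul_add, neg_add, exp_add]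
  field_simp

/-- Every Fourier mode is nonnegative: `cos (k (Yⱼ - Yᵢ))` splits into a cosine and a sine product,
each giving a form of the preceding type with points `k Xᵢ`. -/
theorem sum_potReg_nonneg {ι : Type*} (s : Finset ι) {ε : ℝ} (hε : 0 < ε) (X Y : ι → ℝ) :
    0 ≤ ∑ i ∈ s, ∑ j ∈ s, potReg ε (X j - X i) (Y j - Y i) := by
  have h := hasSum_sum (s := s) fun i _ => hasSum_sum (s := s) fun j _ =>
    hasSum_potReg hε (X j - X i) (Y j - Y i)
  refine h.nonneg fun n => ?_
  set k : ℝ := (n : ℝ) + 1 with hk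
  have hk0 : 0 < k := by positivity
  have e : ∑ i ∈ s, ∑ j ∈ s, exp (-(k * ε)) / k * (((1 + k * |X j - X i|) *
      exp (-(k * |X j - X i|))) * cos (k * (Y j - Y i))) =
      exp (-(k * ε)) / k * (
        (∑ i ∈ s, ∑ j ∈ s, cos (k * Y i) * cos (k * Y j) * ((1 + |k * X i - k * X j|) *
          exp (-|k * X i - k * X j|))) +
        ∑ i ∈ s, ∑ j ∈ s, sin (k * Y i) * sin (k * Y j) * ((1 + |k * X i - k * X j|) *
          exp (-|k * X i - k * X j|))) := by
    rw [← Finset.sum_add_distrib, Finset.mul_sum]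
    refine Finset.sum_congr rfl fun i _ => ?_
    rw [← Finset.sum_add_distrib, Finset.mul_sum]
    refine Finset.sum_congr rfl fun j _ => ?_
    have h1 : |k * X i - k * X j| = k * |X j - X i| := by
      rw [← mul_sub, abs_mul, abs_of_pos hk0, abs_sub_comm]
    rw [h1, mul_sub, cos_sub]
    ring
  rw [e]
  have := sum_exp_kernel_nonneg s (fun i => cos (k * Y i)) (fun i => k * X i)
  have := sum_exp_kernel_nonneg s (fun i => sin (k * Y i)) (fun i => k * X i)
  positivity

/-- Bounds the growth in `s` of `kernelF + a kernelG` with `a` frozen, so that the regularization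
costs at most `ε/2`. -/
theorem neg_kernel_le {a s Y : ℝ} (ha : 0 ≤ a) (has : a ≤ s) (hD : 0 < cosh s - cos Y) :
    -kernelG s Y - a * kernelGone s Y ≤ 1 / 2 := by
  rw [kernelG_eq hD, kernelGone, nome_div_one_sub_sq hD]
  simp only
  have hs : 0 ≤ s := ha.trans has
  have h1 : 0 ≤ sinh s * (cosh s - cos Y) + a * (cosh s * cos Y - 1) := by
    have k1 : s ≤ sinh s := self_le_sinh_iff.2 hs
    have k2 := one_le_cosh s
    have k3 := cos_le_one Y
    have k4 := neg_one_le_cos Y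
    rcases le_total 0 (cosh s * cos Y - 1) with h | h
    · have : 0 ≤ sinh s := hs.trans k1
      positivity
    · have e1 : sinh s * (cosh s - cos Y) + s * (cosh s * cos Y - 1) =
        (1 + cos Y) / 2 * ((sinh s + s) * (cosh s - 1)) +
          (1 - cos Y) / 2 * ((sinh s - s) * (cosh s + 1)) := by ring
      have e2 : 0 ≤ (1 + cos Y) / 2 * ((sinh s + s) * (cosh s - 1)) :=
        mul_nonneg (by linarith) (mul_nonneg (by linarith) (by linarith))
      have e3 : 0 ≤ (1 - cos Y) / 2 * ((sinh s - s) * (cosh s + 1)) :=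
        mul_nonneg (by linarith) (mul_nonneg (by linarith) (by linarith))
      nlinarith
  have h2 : -((sinh s / (cosh s - cos Y) - 1) / 2) -
      a * ((cosh s * cos Y - 1) / (2 * (cosh s - cos Y) ^ 2)) = 1 / 2 -
      (sinh s * (cosh s - cos Y) + a * (cosh s * cos Y - 1)) / (2 * (cosh s - cos Y) ^ 2) := by
    field_simp
    ring
  rw [h2]
  have : 0 ≤ (sinh s * (cosh s - cos Y) + a * (cosh s * cos Y - 1)) /
    (2 * (cosh s - cos Y) ^ 2) := by positivity
  linarith

theorem potReg_le {ε X Y : ℝ} (hε : 0 ≤ ε) (hD : 0 < cosh X - cos Y) :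
    potReg ε X Y ≤ pot X Y + ε / 2 := by
  set a := |X| with ha
  have ha0 : 0 ≤ a := abs_nonneg _
  have hD' : ∀ s ∈ Ici a, 0 < cosh s - cos Y := fun s hs => by
    have : cosh X ≤ cosh s := by
      rw [← cosh_abs X, cosh_le_cosh, abs_abs, abs_of_nonneg (ha0.trans hs)]; exact hs
    linarith
  have hder : ∀ s ∈ Ici a, HasDerivAt (fun s => kernelF s Y + a * kernelG s Y)
      (-kernelG s Y + a * -kernelGone s Y) s := fun s hs =>
    (hasDerivAt_kernelF (ha0.trans hs) (hD' s hs)).add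
      ((hasDerivAt_kernelG (hD' s hs)).const_mul a)
  have := (convex_Ici a).image_sub_le_mul_sub_of_deriv_le (C := 1 / 2)
    (fun s hs => (hder s hs).continuousAt.continuousWithinAt)
    (fun s hs => (hder s (interior_subset hs)).differentiableAt.differentiableWithinAt)
    (fun s hs => by
      rw [(hder s (interior_subset hs)).deriv]
      have := neg_kernel_le ha0 (interior_subset hs) (hD' s (interior_subset hs))
      linarith) a (mem_Ici.2 le_rfl) (a + ε) (mem_Ici.2 (by linarith)) (by linarith)
  rw [potReg, pot]
  simp only [← ha]
  linarith

theorem potReg_zero_le {ε : ℝ} (hε : 0 < ε) : potReg ε 0 0 ≤ -log ε + ε := by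
  simpa [potReg] using kernelF_zero_le hε

/-- Lower bound for the interaction energy of `N` dislocations. -/
theorem le_sum_pot {ι : Type*} [DecidableEq ι] (s : Finset ι) (X Y : ι → ℝ)
    (hD : ∀ i ∈ s, ∀ j ∈ s, i ≠ j → 0 < cosh (X j - X i) - cos (Y j - Y i)) (hs : s.Nonempty) :
    -(s.card * log s.card) - 2 * s.card ≤
      ∑ p ∈ s.offDiag, pot (X p.2 - X p.1) (Y p.2 - Y p.1) := by
  have hN : (1 : ℝ) ≤ s.card := by exact_mod_cast hs.card_pos
  set N : ℝ := (s.card : ℝ)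
  have hN0 : 0 < N := by linarith
  -- This choice balances the diagonal cost `-N log ε` against the regularization error `N² ε / 2`.
  have hε : 0 < 1 / N := by positivity
  have h1 := sum_potReg_nonneg s hε X Y
  rw [← Finset.sum_product', ← Finset.diag_union_offDiag,
    Finset.sum_union (Finset.disjoint_diag_offDiag s), Finset.sum_diag] at h1
  simp only [sub_self, Finset.sum_const, nsmul_eq_mul] at h1
  have h2 : ∑ p ∈ s.offDiag, potReg (1 / N) (X p.2 - X p.1) (Y p.2 - Y p.1) ≤
      ∑ p ∈ s.offDiag, (pot (X p.2 - X p.1) (Y p.2 - Y p.1) + 1 / N / 2) :=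
    Finset.sum_le_sum fun p hp => by
      obtain ⟨ha, hb, hne⟩ := Finset.mem_offDiag.1 hp
      exact potReg_le hε.le (hD _ ha _ hb hne)
  rw [Finset.sum_add_distrib, Finset.sum_const, nsmul_eq_mul] at h2
  have h3 : (s.offDiag.card : ℝ) ≤ N * N := by
    rw [Finset.offDiag_card]
    exact (Nat.cast_le.2 (Nat.sub_le _ _)).trans_eq (Nat.cast_mul _ _)
  have h4 : (s.offDiag.card : ℝ) * (1 / N / 2) ≤ N / 2 := by
    calc _ ≤ N * N * (1 / N / 2) := by gcongr
      _ = _ := by field_simp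
  have h5 := mul_le_mul_of_nonneg_left (potReg_zero_le hε) hN0.le
  have h6 : N * (-log (1 / N) + 1 / N) = N * log N + 1 := by
    rw [one_div, log_inv]; field_simp
  change 0 ≤ N * potReg (1 / N) 0 0 + _ at h1
  linarith

/-! ### Upper bound: the equispaced wall. -/

theorem nome_zero_left_pow (Y : ℝ) (n : ℕ) : nome 0 Y ^ n = nome 0 (n * Y) := by
  rw [nome, nome, ← Complex.exp_nat_mul]
  congr 1
  apply Complex.ext <;> simp

/-- The interaction energy of an equispaced wall. -/
theorem sum_pot_equispaced {N : ℕ} (hN : 1 ≤ N) :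
    ∑ p ∈ (Finset.range N).offDiag, pot 0 (2 * π * (p.2 : ℝ) / N - 2 * π * (p.1 : ℝ) / N) =
      -(N * log N) := by
  have hN0 : (N : ℝ) ≠ 0 := by positivity
  have hNc : (N : ℂ) ≠ 0 := by exact_mod_cast hN0
  set ζ : ℂ := nome 0 (2 * π / N) with hζ
  have hζp : IsPrimitiveRoot ζ N := by
    convert Complex.isPrimitiveRoot_exp N (by omega) using 1
    rw [hζ, nome]; congr 1
    apply Complex.ext
    · simp
    · simp
  have hnorm : ∀ j : ℕ, ‖ζ ^ j‖ = 1 := fun j => by rw [norm_pow, hζ, norm_nome]; simp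
  have hpot : ∀ i j : ℕ, pot 0 (2 * π * (j : ℝ) / N - 2 * π * (i : ℝ) / N) =
      -log ‖ζ ^ i - ζ ^ j‖ := fun i j => by
    have h1 : ζ ^ i ≠ 0 := fun h => by have := hnorm i; rw [h] at this; simp at this
    have h2 : ζ ^ i * nome 0 (2 * π * (j : ℝ) / N - 2 * π * (i : ℝ) / N) = ζ ^ j := by
      rw [hζ, nome_zero_left_pow, nome_zero_left_pow, nome, nome, nome, ← Complex.exp_add]
      congr 1
      apply Complex.ext
      · simp
      · simp; ring
    rw [pot, abs_zero, zero_mul, add_zero, kernelF, ← h2, ← mul_one_sub, norm_mul, hnorm, one_mul]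
  -- The product is the modulus of the derivative of `X ^ N - 1` at a root.
  have hprod : ∀ i ∈ Finset.range N, ∏ j ∈ (Finset.range N).erase i, ‖ζ ^ i - ζ ^ j‖ = N := by
    intro i hi
    have h1 := X_pow_sub_C_eq_prod hζp (by omega) (one_pow N)
    have h2 := Lagrange.eval_nodal_derivative_eval_node_eq (v := fun j : ℕ => ζ ^ j) hi
    have h3 : Lagrange.nodal (Finset.range N) (fun j : ℕ => ζ ^ j) =
        Polynomial.X ^ N - Polynomial.C 1 := by
      rw [h1, Lagrange.nodal]; simp only [mul_one]
    rw [h3, Lagrange.eval_nodal] at h2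
    have h4 := congrArg norm h2
    rw [norm_prod] at h4
    rw [← h4]
    have h5 : ‖ζ‖ = 1 := by simpa using hnorm 1
    simp [Polynomial.derivative_X_pow, h5]
  have hsplit : ∑ p ∈ (Finset.range N).offDiag,
      pot 0 (2 * π * (p.2 : ℝ) / N - 2 * π * (p.1 : ℝ) / N) =
      ∑ i ∈ Finset.range N, ∑ j ∈ (Finset.range N).erase i, -log ‖ζ ^ i - ζ ^ j‖ := by
    simp only [hpot]
    rw [Finset.sum_sigma']
    refine Finset.sum_bij' (fun p _ => ⟨p.1, p.2⟩) (fun p _ => (p.1, p.2)) ?_ ?_ ?_ ?_ ?_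
    · intro p hp; simp at hp ⊢; tauto
    · intro p hp; simp at hp ⊢; tauto
    · intro p _; rfl
    · intro p _; rfl
    · intro p _; rfl
  rw [hsplit]
  have hin : ∀ i ∈ Finset.range N, ∑ j ∈ (Finset.range N).erase i, -log ‖ζ ^ i - ζ ^ j‖ =
      -log N := fun i hi => by
    rw [Finset.sum_neg_distrib, ← log_prod, hprod i hi]
    intro j hj
    rw [norm_ne_zero_iff, sub_ne_zero]
    intro h
    obtain ⟨hji, hj'⟩ := Finset.mem_erase.1 hj
    exact hji (hζp.pow_inj (Finset.mem_range.1 hj') (Finset.mem_range.1 hi) h.symm)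
  rw [Finset.sum_congr rfl hin, Finset.sum_const, Finset.card_range, nsmul_eq_mul]
  ring

/-! ### Existence of minimizers on the cylinder. -/

/-- The properties of a pair interaction on the cylinder that ensure that the interaction energy of
`N` particles has a minimizer. -/
structure IsPairInteraction (W : ℝ × Real.Angle → ℝ) : Prop where
  zero : W 0 = 0
  even : ∀ s, W (-s) = W s
  cont : ContinuousOn W {0}ᶜ
  bddBelow : ∃ B, ∀ s, -B ≤ W s
  singular : ∀ M, ∃ U, IsOpen U ∧ 0 ∈ U ∧ ∀ s ∈ U, s ≠ 0 → M ≤ W s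
  decay : ∀ ε, 0 < ε → ∃ L, ∀ s : ℝ × Real.Angle, L ≤ s.1 → |W s| ≤ ε
  mean : ∀ (X : ℝ) (θ : Real.Angle), X ≠ 0 → ∫ φ in (-π)..π, W (X, θ + (φ : Real.Angle)) = 0

/-- The diagonal is included; it is harmless because interactions are normalized by `W 0 = 0`. -/
def pairEnergy (W : ℝ × Real.Angle → ℝ) (ω : Finset (ℝ × Real.Angle)) : ℝ :=
  ∑ a ∈ ω, ∑ b ∈ ω, W (b - a)

variable {W : ℝ × Real.Angle → ℝ}

theorem pairEnergy_map {ι : Type*} (s : Finset ι) (f : ι ↪ ℝ × Real.Angle) :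
    pairEnergy W (s.map f) = ∑ i ∈ s, ∑ j ∈ s, W (f j - f i) := by
  simp [pairEnergy]

theorem pairEnergy_map_add (ω : Finset (ℝ × Real.Angle)) (v : ℝ × Real.Angle) :
    pairEnergy W (ω.map (addRightEmbedding v)) = pairEnergy W ω := by
  simp [pairEnergy]

theorem pairEnergy_union (hW : IsPairInteraction W) {A B : Finset (ℝ × Real.Angle)}
    [DecidableEq (ℝ × Real.Angle)] (h : Disjoint A B) :
    pairEnergy W (A ∪ B) =
      pairEnergy W A + pairEnergy W B + 2 * ∑ a ∈ A, ∑ b ∈ B, W (b - a) := by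
  have e : ∑ b ∈ B, ∑ a ∈ A, W (a - b) = ∑ a ∈ A, ∑ b ∈ B, W (b - a) := by
    rw [Finset.sum_comm]
    refine Finset.sum_congr rfl fun a _ => Finset.sum_congr rfl fun b _ => ?_
    rw [← hW.even, neg_sub]
  simp only [pairEnergy, Finset.sum_union h, Finset.sum_add_distrib, e]
  ring

/-- Once `B` lies strictly to the right of `A`, the interaction is continuous in the rotation angle
and averages to zero, so some rotation makes it nonpositive. -/
theorem exists_sum_nonpos (hW : IsPairInteraction W) {A B : Finset (ℝ × Real.Angle)} {T : ℝ}
    (h : ∀ a ∈ A, ∀ b ∈ B, a.1 < b.1 + T) :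
    ∃ φ : ℝ, ∑ a ∈ A, ∑ b ∈ B, W (b + (T, (φ : Real.Angle)) - a) ≤ 0 := by
  by_contra! hcon
  have e : ∀ (a b : ℝ × Real.Angle) (φ : ℝ), b + (T, (φ : Real.Angle)) - a =
      (b.1 + T - a.1, (b.2 - a.2) + (φ : Real.Angle)) := fun a b φ => by
    ext
    · rfl
    · simp only [Prod.snd_sub, Prod.snd_add]; abel
  have hc : ∀ a ∈ A, ∀ b ∈ B, Continuous (fun φ : ℝ => W (b + (T, (φ : Real.Angle)) - a)) := by
    intro a ha b hb
    refine hW.cont.comp_continuous (by fun_prop) fun φ => ?_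
    rw [e]
    intro h0
    have h1 := congrArg Prod.fst (mem_singleton_iff.1 h0)
    simp only [Prod.fst_zero] at h1
    linarith [h a ha b hb]
  have hint : ∫ φ in (-π)..π, ∑ a ∈ A, ∑ b ∈ B, W (b + (T, (φ : Real.Angle)) - a) = 0 := by
    rw [intervalIntegral.integral_finsetSum fun a ha => (continuous_finsetSum _ fun b hb =>
      hc a ha b hb).intervalIntegrable _ _]
    refine Finset.sum_eq_zero fun a ha => ?_
    rw [intervalIntegral.integral_finsetSum fun b hb => (hc a ha b hb).intervalIntegrable _ _]
    refine Finset.sum_eq_zero fun b hb => ?_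
    simp only [e]
    exact hW.mean _ _ (by linarith [h a ha b hb])
  have hpos := intervalIntegral.intervalIntegral_pos_of_pos (a := -π) (b := π)
    ((continuous_finsetSum _ fun a ha => continuous_finsetSum _ fun b hb =>
      hc a ha b hb).intervalIntegrable _ _) hcon (by linarith [pi_pos])
  rw [hint] at hpos
  exact lt_irrefl _ hpos

/-- Two configurations can be placed side by side with nonpositive interaction. -/
theorem exists_pairEnergy_le_add (hW : IsPairInteraction W) (A B : Finset (ℝ × Real.Angle)) :
    ∃ ω : Finset (ℝ × Real.Angle), ω.card = A.card + B.card ∧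
      pairEnergy W ω ≤ pairEnergy W A + pairEnergy W B := by
  classical
  obtain ⟨MA, hMA⟩ := (A.finite_toSet.image Prod.fst).bddAbove
  obtain ⟨MB, hMB⟩ := (B.finite_toSet.image Prod.fst).bddBelow
  have hT : ∀ a ∈ A, ∀ b ∈ B, a.1 < b.1 + (MA - MB + 1) := fun a ha b hb => by
    have h1 := hMA (mem_image_of_mem Prod.fst (Finset.mem_coe.2 ha))
    have h2 := hMB (mem_image_of_mem Prod.fst (Finset.mem_coe.2 hb))
    linarith
  obtain ⟨φ, hφ⟩ := exists_sum_nonpos hW hT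
  set v : ℝ × Real.Angle := (MA - MB + 1, (φ : Real.Angle)) with hv
  have hdisj : Disjoint A (B.map (addRightEmbedding v)) := by
    rw [Finset.disjoint_left]
    intro a ha hb
    obtain ⟨b, hbB, rfl⟩ := Finset.mem_map.1 hb
    have := hT _ ha b hbB
    simp [hv] at this
  refine ⟨A ∪ B.map (addRightEmbedding v), ?_, ?_⟩
  · rw [Finset.card_union_of_disjoint hdisj, Finset.card_map]
  · rw [pairEnergy_union hW hdisj, pairEnergy_map_add]
    simp only [Finset.sum_map, addRightEmbedding_apply]
    linarith

theorem isCompact_univ_angle : IsCompact (univ : Set Real.Angle) := by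
  have h := (isCompact_Icc (a := -π) (b := π)).image Real.Angle.continuous_coe
  convert h
  symm
  rw [eq_univ_iff_forall]
  exact fun θ => ⟨θ.toReal, ⟨(Real.Angle.neg_pi_lt_toReal θ).le, Real.Angle.toReal_le_pi θ⟩,
    Real.Angle.coe_toReal θ⟩

/-- A configuration of `N` particles without gaps longer than `L` fits into a cylinder of length
`N L`. -/
theorem exists_spread_le {ω : Finset (ℝ × Real.Angle)} {L : ℝ} (hL : 0 < L) (hne : ω.Nonempty)
    (hgap : ∀ t : ℝ, (∃ a ∈ ω, a.1 ≤ t) → (∃ b ∈ ω, t < b.1) →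
      ∃ a ∈ ω, ∃ b ∈ ω, a.1 ≤ t ∧ t < b.1 ∧ b.1 - a.1 < L) :
    ∃ c, ∀ a ∈ ω, c ≤ a.1 ∧ a.1 ≤ c + ω.card * L := by
  classical
  obtain ⟨m, hm, hmin⟩ := ω.exists_min_image Prod.fst hne
  -- Moving right by `L` captures at least one new point as long as any is left, since there is no
  -- gap of length `L`.
  have claim : ∀ k : ℕ, min (k + 1) ω.card ≤ (ω.filter fun s => s.1 ≤ m.1 + k * L).card := by
    intro k
    induction k with
    | zero =>
      refine (min_le_left _ _).trans ?_
      rw [zero_add, Nat.one_le_iff_ne_zero, ← Nat.pos_iff_ne_zero, Finset.card_pos]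
      exact ⟨m, by simp [hm]⟩
    | succ k ih =>
      have hle : m.1 + (k : ℝ) * L ≤ m.1 + ((k + 1 : ℕ) : ℝ) * L := by push_cast; linarith
      by_cases hall : ∀ s ∈ ω, s.1 ≤ m.1 + k * L
      · rw [Finset.filter_true_of_mem fun s hs => (hall s hs).trans hle]
        exact min_le_right _ _
      · push Not at hall
        have hk : 0 ≤ (k : ℝ) * L := by positivity
        obtain ⟨a, ha, b, hb, hat, htb, hab⟩ := hgap _ ⟨m, hm, by linarith⟩ hall
        have hlt : (ω.filter fun s => s.1 ≤ m.1 + k * L).card <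
            (ω.filter fun s => s.1 ≤ m.1 + ((k + 1 : ℕ) : ℝ) * L).card := by
          refine Finset.card_lt_card ⟨fun s hs => ?_, fun hsub => ?_⟩
          · rw [Finset.mem_filter] at hs ⊢
            exact ⟨hs.1, hs.2.trans hle⟩
          · have h1 := hsub (Finset.mem_filter.2 ⟨hb, by push_cast; linarith⟩)
            exact absurd (Finset.mem_filter.1 h1).2 (not_le.2 htb)
        omega
  refine ⟨m.1, fun a ha => ⟨hmin a ha, ?_⟩⟩
  have h1 := claim ω.card
  rw [min_eq_right (Nat.le_succ _)] at h1
  have h2 := Finset.eq_of_subset_of_card_le (Finset.filter_subset _ ω) h1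
  rw [← h2] at ha
  exact (Finset.mem_filter.1 ha).2

theorem neg_le_sum_sum {A B : Finset (ℝ × Real.Angle)} {N : ℕ} {ε : ℝ} (hε : 0 ≤ ε)
    (hA : A.card ≤ N) (hB : B.card ≤ N) (h : ∀ a ∈ A, ∀ b ∈ B, -ε ≤ W (b - a)) :
    -(N * N * ε) ≤ ∑ a ∈ A, ∑ b ∈ B, W (b - a) := by
  have h1 : (A.card : ℝ) * (B.card * -ε) ≤ ∑ a ∈ A, ∑ b ∈ B, W (b - a) := by
    rw [← nsmul_eq_mul, ← nsmul_eq_mul]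
    exact Finset.card_nsmul_le_sum _ _ _ fun a ha => Finset.card_nsmul_le_sum _ _ _ (h a ha)
  have h2 : (A.card : ℝ) * B.card ≤ N * N := by
    have hA' : (A.card : ℝ) ≤ N := by exact_mod_cast hA
    have hB' : (B.card : ℝ) ≤ N := by exact_mod_cast hB
    gcongr
  nlinarith

/-- One large pair forces a large total, since all other terms are at least `-B`. This keeps the
points of low-energy configurations apart. -/
theorem le_pairEnergy_of_mem (hW : IsPairInteraction W) {B M : ℝ} (hB : ∀ s, -B ≤ W s)
    {ω : Finset (ℝ × Real.Angle)} {a b : ℝ × Real.Angle} (ha : a ∈ ω) (hb : b ∈ ω)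
    (hM : M ≤ W (b - a)) : M - ω.card * ω.card * B ≤ pairEnergy W ω := by
  have hB0 : 0 ≤ B := by have := hB 0; rw [hW.zero] at this; linarith
  have e : pairEnergy W ω + ω.card * ω.card * B = ∑ a ∈ ω, ∑ b ∈ ω, (W (b - a) + B) := by
    simp only [pairEnergy, Finset.sum_add_distrib, Finset.sum_const, nsmul_eq_mul]
    ring
  have h0 : ∀ a b, 0 ≤ W (b - a) + B := fun a b => by linarith [hB (b - a)]
  have h1 : W (b - a) + B ≤ ∑ a ∈ ω, ∑ b ∈ ω, (W (b - a) + B) :=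
    (Finset.single_le_sum (f := fun b => W (b - a) + B) (fun b _ => h0 a b) hb).trans
      (Finset.single_le_sum (f := fun a => ∑ b ∈ ω, (W (b - a) + B))
        (fun a _ => Finset.sum_nonneg fun b _ => h0 a b) ha)
  linarith

/-- The configurations of `N` particles in a cylinder of length `R` whose mutual differences avoid
a neighbourhood of the origin form a compact set, on which the energy is minimized. -/
theorem exists_minimal_of_separated (hW : IsPairInteraction W) {N : ℕ} {R : ℝ}
    {U : Set (ℝ × Real.Angle)} (hU : IsOpen U) (hU0 : 0 ∈ U)
    (hne : ∃ ω : Finset (ℝ × Real.Angle), ω.card = N ∧ (∀ a ∈ ω, a.1 ∈ Icc 0 R) ∧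
      ∀ a ∈ ω, ∀ b ∈ ω, a ≠ b → b - a ∉ U) :
    ∃ ω : Finset (ℝ × Real.Angle), ω.card = N ∧ ∀ ω' : Finset (ℝ × Real.Angle), ω'.card = N →
      (∀ a ∈ ω', a.1 ∈ Icc 0 R) → (∀ a ∈ ω', ∀ b ∈ ω', a ≠ b → b - a ∉ U) →
      pairEnergy W ω ≤ pairEnergy W ω' := by
  classical
  set K : Set (Fin N → ℝ × Real.Angle) :=
    (Set.univ.pi fun _ => Icc (0 : ℝ) R ×ˢ (univ : Set Real.Angle)) ∩
      ⋂ (i) (j) (_ : i ≠ j), (fun f : Fin N → ℝ × Real.Angle => f j - f i) ⁻¹' Uᶜ with hK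
  have hKc : IsCompact K := by
    refine (isCompact_univ_pi fun _ => isCompact_Icc.prod isCompact_univ_angle).inter_right ?_
    exact isClosed_iInter fun i => isClosed_iInter fun j => isClosed_iInter fun _ =>
      hU.isClosed_compl.preimage (by fun_prop)
  have hsep : ∀ f ∈ K, ∀ i j, i ≠ j → f j - f i ∉ U := fun f hf i j hij =>
    mem_iInter.1 (mem_iInter.1 (mem_iInter.1 hf.2 i) j) hij
  have hinj : ∀ f ∈ K, Function.Injective f := fun f hf i j hij => by
    by_contra hne
    exact hsep f hf i j hne (by rw [hij, sub_self]; exact hU0)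
  have hof : ∀ ω : Finset (ℝ × Real.Angle), ω.card = N → (∀ a ∈ ω, a.1 ∈ Icc 0 R) →
      (∀ a ∈ ω, ∀ b ∈ ω, a ≠ b → b - a ∉ U) →
      ∃ f ∈ K, ∑ i, ∑ j, W (f j - f i) = pairEnergy W ω := by
    intro ω hω hR hs
    let e := ω.equivFinOfCardEq hω
    let f : Fin N ↪ ℝ × Real.Angle := e.symm.toEmbedding.trans (Function.Embedding.subtype _)
    have hfm : ∀ i, f i ∈ ω := fun i => (e.symm i).2
    refine ⟨f, ⟨fun i _ => ⟨hR _ (hfm i), mem_univ _⟩, ?_⟩, ?_⟩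
    · refine mem_iInter.2 fun i => mem_iInter.2 fun j => mem_iInter.2 fun hij => ?_
      exact hs _ (hfm i) _ (hfm j) (f.injective.ne hij)
    · rw [← pairEnergy_map]
      congr 1
      refine Finset.eq_of_subset_of_card_le (fun a ha => ?_) (by simp [hω])
      obtain ⟨i, -, rfl⟩ := Finset.mem_map.1 ha
      exact hfm i
  have hcont : ContinuousOn (fun f : Fin N → ℝ × Real.Angle => ∑ i, ∑ j, W (f j - f i)) K := by
    refine continuousOn_finsetSum _ fun i _ => continuousOn_finsetSum _ fun j _ => ?_
    rcases eq_or_ne i j with rfl | hij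
    · simp only [sub_self]
      exact continuousOn_const
    · refine hW.cont.comp (by fun_prop) fun f hf h0 => ?_
      exact hsep f hf i j hij (by rw [mem_singleton_iff.1 h0]; exact hU0)
  obtain ⟨ω₀, hω₀, hR₀, hs₀⟩ := hne
  obtain ⟨f₀, hf₀, -⟩ := hof ω₀ hω₀ hR₀ hs₀
  obtain ⟨f, hf, hmin⟩ := hKc.exists_isMinOn ⟨f₀, hf₀⟩ hcont
  refine ⟨Finset.univ.map ⟨f, hinj f hf⟩, by simp, fun ω' hω' hR' hs' => ?_⟩
  obtain ⟨g, hg, hgE⟩ := hof ω' hω' hR' hs'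
  rw [pairEnergy_map, ← hgE]
  exact hmin hg

/-- The interaction energy of `N` particles on the cylinder has a minimizer. -/
theorem exists_minimal_pairEnergy (hW : IsPairInteraction W) (N : ℕ) :
    ∃ ω : Finset (ℝ × Real.Angle), ω.card = N ∧
      ∀ ω' : Finset (ℝ × Real.Angle), ω'.card = N → pairEnergy W ω ≤ pairEnergy W ω' := by
  classical
  induction N using Nat.strong_induction_on with
  | _ N ih =>
  rcases Nat.eq_zero_or_pos N with rfl | hN
  · refine ⟨∅, rfl, fun ω' h => ?_⟩
    rw [Finset.card_eq_zero.1 h]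
  choose! g hg hgmin using ih
  -- If some split into smaller minimizers is already optimal, placing them side by side attains the
  -- minimum.
  by_cases hA : ∃ k, 0 < k ∧ k < N ∧ ∀ ω' : Finset (ℝ × Real.Angle), ω'.card = N →
      pairEnergy W (g k) + pairEnergy W (g (N - k)) ≤ pairEnergy W ω'
  · obtain ⟨k, hk0, hkN, hk⟩ := hA
    obtain ⟨ω, hω, hωE⟩ := exists_pairEnergy_le_add hW (g k) (g (N - k))
    refine ⟨ω, ?_, fun ω' h => hωE.trans (hk ω' h)⟩
    rw [hω, hg k hkN, hg (N - k) (by omega)]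
    omega
  push Not at hA
  -- Otherwise one configuration beats every split by a uniform margin; for `N = 1` there are no
  -- splits and any configuration will do.
  obtain ⟨ω₀, hω₀, δ, hδ, hsplit⟩ : ∃ ω₀ : Finset (ℝ × Real.Angle), ω₀.card = N ∧ ∃ δ > 0,
      ∀ k, 0 < k → k < N →
        pairEnergy W ω₀ + δ ≤ pairEnergy W (g k) + pairEnergy W (g (N - k)) := by
    rcases (Finset.Ioo 0 N).eq_empty_or_nonempty with h | h
    · obtain ⟨ω, hω⟩ := Infinite.exists_subset_card_eq (ℝ × Real.Angle) N
      refine ⟨ω, hω, 1, one_pos, fun k hk0 hkN => ?_⟩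
      exact absurd (Finset.mem_Ioo.2 ⟨hk0, hkN⟩) (by simp [h])
    · obtain ⟨k, hk, hkmin⟩ := (Finset.Ioo 0 N).exists_min_image
        (fun k => pairEnergy W (g k) + pairEnergy W (g (N - k))) h
      rw [Finset.mem_Ioo] at hk
      obtain ⟨ω, hω, hωE⟩ := hA k hk.1 hk.2
      refine ⟨ω, hω, _, sub_pos.2 hωE, fun j hj0 hjN => ?_⟩
      have := hkmin j (Finset.mem_Ioo.2 ⟨hj0, hjN⟩)
      linarith
  obtain ⟨B, hB⟩ := hW.bddBelow
  -- Chosen so that the interaction across a long gap, at least `-2N²ε`, cannot make up the margin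
  -- `δ`.
  set ε : ℝ := δ / (2 * N * N + 1) with hε
  have hε0 : 0 < ε := by positivity
  have hεδ : 2 * (N * N * ε) < δ := by
    have h1 : (2 * (N : ℝ) * N + 1) * ε = δ := by rw [hε]; field_simp
    linarith
  obtain ⟨L₀, hL₀⟩ := hW.decay ε hε0
  -- A pair with difference in `U` would push the energy to at least `pairEnergy W ω₀ + 1`.
  obtain ⟨U, hU, hU0, hUM⟩ := hW.singular (pairEnergy W ω₀ + N * N * B + 1)
  have hL : 0 < max L₀ 1 := lt_max_of_lt_right one_pos
  have hgood : ∀ ω : Finset (ℝ × Real.Angle), ω.card = N → pairEnergy W ω ≤ pairEnergy W ω₀ →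
      ∃ ω' : Finset (ℝ × Real.Angle), ω'.card = N ∧
        (∀ a ∈ ω', a.1 ∈ Icc 0 (N * max L₀ 1)) ∧ (∀ a ∈ ω', ∀ b ∈ ω', a ≠ b → b - a ∉ U) ∧
        pairEnergy W ω' = pairEnergy W ω := by
    intro ω hω hωE
    have hsep : ∀ a ∈ ω, ∀ b ∈ ω, a ≠ b → b - a ∉ U := fun a ha b hb hab hmem => by
      have h1 := le_pairEnergy_of_mem hW hB ha hb (hUM _ hmem (sub_ne_zero.2 hab.symm))
      rw [hω] at h1
      linarith
    obtain ⟨c, hc⟩ := exists_spread_le hL (Finset.card_pos.1 (hω ▸ hN)) (ω := ω) (by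
      rintro t ⟨a, ha, hat⟩ ⟨b, hb, htb⟩
      by_contra! hcon
      have hunion := Finset.filter_union_filter_not_eq (fun s : ℝ × Real.Angle => s.1 ≤ t) ω
      have hdisj := Finset.disjoint_filter_filter_not ω ω (fun s : ℝ × Real.Angle => s.1 ≤ t)
      set P := ω.filter fun s => s.1 ≤ t with hP
      set Q := ω.filter fun s => ¬ s.1 ≤ t with hQ
      have hcard : P.card + Q.card = N := by
        rw [← Finset.card_union_of_disjoint hdisj, hunion, hω]
      have hP0 : 0 < P.card := Finset.card_pos.2 ⟨a, Finset.mem_filter.2 ⟨ha, hat⟩⟩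
      have hQ0 : 0 < Q.card := Finset.card_pos.2 ⟨b, Finset.mem_filter.2 ⟨hb, not_le.2 htb⟩⟩
      have hE := pairEnergy_union hW hdisj
      rw [hunion] at hE
      have h1 := hgmin P.card (by omega) P rfl
      have h2 := hgmin (N - P.card) (by omega) Q (by omega)
      have h3 := hsplit P.card hP0 (by omega)
      have h4 : -(N * N * ε) ≤ ∑ a ∈ P, ∑ b ∈ Q, W (b - a) := by
        refine neg_le_sum_sum hε0.le (by omega) (by omega) fun x hx y hy => ?_
        have hx := Finset.mem_filter.1 hx
        have hy := Finset.mem_filter.1 hy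
        have h5 := hcon x hx.1 y hy.1 hx.2 (not_le.1 hy.2)
        exact (abs_le.1 (hL₀ (y - x) ((le_max_left _ _).trans h5))).1
      linarith)
    refine ⟨ω.map (addRightEmbedding (-c, 0)), by rw [Finset.card_map, hω], ?_, ?_,
      pairEnergy_map_add _ _⟩
    · intro a ha
      obtain ⟨a, haω, rfl⟩ := Finset.mem_map.1 ha
      have h1 := hc a haω
      rw [hω] at h1
      simp only [addRightEmbedding_apply, Prod.fst_add, mem_Icc]
      constructor <;> linarith
    · intro a ha b hb hab
      obtain ⟨a, haω, rfl⟩ := Finset.mem_map.1 ha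
      obtain ⟨b, hbω, rfl⟩ := Finset.mem_map.1 hb
      simp only [addRightEmbedding_apply, add_sub_add_right_eq_sub]
      exact hsep a haω b hbω fun h => hab (by rw [h])
  obtain ⟨ω₁, hω₁, hR₁, hs₁, -⟩ := hgood ω₀ hω₀ le_rfl
  obtain ⟨ω, hω, hmin⟩ := exists_minimal_of_separated hW hU hU0 ⟨ω₁, hω₁, hR₁, hs₁⟩
  have hle : ∀ ω' : Finset (ℝ × Real.Angle), ω'.card = N → pairEnergy W ω' ≤ pairEnergy W ω₀ →
      pairEnergy W ω ≤ pairEnergy W ω' := fun ω' hω' hE => by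
    obtain ⟨ω₂, hω₂, hR₂, hs₂, hE₂⟩ := hgood ω' hω' hE
    exact hE₂ ▸ hmin ω₂ hω₂ hR₂ hs₂
  refine ⟨ω, hω, fun ω' hω' => ?_⟩
  rcases le_total (pairEnergy W ω') (pairEnergy W ω₀) with h | h
  · exact hle ω' hω' h
  · exact (hle ω₀ hω₀ le_rfl).trans h

/-! ### The dislocation potential as a pair interaction on the cylinder. -/

theorem cosh_sub_cos_pos_of_ne_zero {s : ℝ × Real.Angle} (hs : s ≠ 0) :
    0 < cosh s.1 - s.2.cos := by
  rcases eq_or_ne s.1 0 with h | h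
  · have h2 : s.2 ≠ 0 := fun h2 => hs (Prod.ext h h2)
    have h3 : s.2.cos ≠ 1 := fun h3 => h2 (by
      rw [← Real.Angle.cos_zero, Real.Angle.cos_eq_iff_eq_or_eq_neg] at h3
      simpa using h3)
    have h4 : s.2.cos ≤ 1 := by rw [← Real.Angle.cos_toReal]; exact cos_le_one _
    have := lt_of_le_of_ne h4 h3
    rw [h, cosh_zero]; linarith
  · rw [← Real.Angle.cos_toReal]
    exact cosh_sub_cos_pos h _

theorem pot_eq {X Y : ℝ} (hD : 0 < cosh X - cos Y) :
    pot X Y = -(log (2 * exp (-|X|) * (cosh X - cos Y)) / 2) +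
      |X| * ((sinh |X| / (cosh X - cos Y) - 1) / 2) := by
  have hD' : 0 < cosh |X| - cos Y := by rwa [cosh_abs]
  have h := norm_one_sub_nome_sq |X| Y
  rw [cosh_abs] at h
  rw [pot, kernelF, kernelG_eq hD', ← h, log_pow, cosh_abs]
  push_cast; ring

/-- The pair potential as a function on the cylinder. -/
def potCyl (s : ℝ × Real.Angle) : ℝ := pot s.1 s.2.toReal

theorem potCyl_mk (X Y : ℝ) : potCyl (X, (Y : Real.Angle)) = pot X Y := by
  have h : ∀ t, nome t ((Y : Real.Angle).toReal) = nome t Y := fun t => by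
    apply Complex.ext
    · rw [nome_re, nome_re, Real.Angle.cos_toReal, Real.Angle.cos_coe]
    · rw [nome_im, nome_im, Real.Angle.sin_toReal, Real.Angle.sin_coe]
  simp only [potCyl, pot, kernelF, kernelG, h]

theorem potCyl_eq {s : ℝ × Real.Angle} (hs : s ≠ 0) :
    potCyl s = -(log (2 * exp (-|s.1|) * (cosh s.1 - s.2.cos)) / 2) +
      |s.1| * ((sinh |s.1| / (cosh s.1 - s.2.cos) - 1) / 2) := by
  have h := cosh_sub_cos_pos_of_ne_zero hs
  rw [← Real.Angle.cos_toReal] at h ⊢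
  exact pot_eq h

/-- This is the convention `log 0 = 0`; the true potential is `+∞` there. -/
theorem potCyl_zero : potCyl 0 = 0 := by
  have h : (⟨0, 0⟩ : ℂ) = 0 := rfl
  simp [potCyl, pot, kernelF, nome, h]

/-- Compare with the regularized potential at `ε = 1`, which is at least `-2` because its kernels
are evaluated at `|X| + 1 ≥ 1`; the comparison costs `1/2`. -/
theorem neg_three_le_potCyl (s : ℝ × Real.Angle) : -3 ≤ potCyl s := by
  rcases eq_or_ne s 0 with rfl | hs
  · rw [potCyl_zero]; norm_num
  have hD := cosh_sub_cos_pos_of_ne_zero hs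
  rw [← Real.Angle.cos_toReal] at hD
  have h := potReg_le zero_le_one hD
  have ha : 0 ≤ |s.1| := abs_nonneg _
  have hF := (abs_le.1 (abs_kernelF_le (by linarith : 1 ≤ |s.1| + 1) s.2.toReal)).1
  have hG := (abs_le.1 (abs_kernelG_le (by linarith : 1 ≤ |s.1| + 1) s.2.toReal)).1
  have hG' := mul_le_mul_of_nonneg_left hG ha
  have he : (|s.1| + 1) * exp (-(|s.1| + 1)) ≤ 1 := by
    rw [exp_neg, ← div_eq_mul_inv, div_le_one (exp_pos _)]
    linarith [add_one_le_exp (|s.1| + 1)]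
  rw [potReg] at h
  rw [potCyl]
  nlinarith

theorem le_potCyl_of_small {M : ℝ} {s : ℝ × Real.Angle} (hs : s ≠ 0) (h1 : |s.1| < 1)
    (h2 : 2 * exp (-|s.1|) * (cosh s.1 - s.2.cos) < exp (-(2 * M) - 1)) : M ≤ potCyl s := by
  have hD := cosh_sub_cos_pos_of_ne_zero hs
  have hlog := log_lt_log (by positivity) h2
  rw [log_exp] at hlog
  have hq : 0 ≤ |s.1| * (sinh |s.1| / (cosh s.1 - s.2.cos)) :=
    mul_nonneg (abs_nonneg _) (div_nonneg (sinh_nonneg_iff.2 (abs_nonneg _)) hD.le)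
  rw [potCyl_eq hs]
  nlinarith

theorem abs_pot_le {X Y : ℝ} (hX : 1 ≤ X) : |pot X Y| ≤ 4 * exp (-(X / 2)) := by
  have hX0 : 0 ≤ X := by linarith
  rw [pot, abs_of_nonneg hX0]
  have hF := abs_kernelF_le hX Y
  have hG := mul_le_mul_of_nonneg_left (abs_kernelG_le hX Y) hX0
  have h1 : |kernelF X Y + X * kernelG X Y| ≤ 2 * ((1 + X) * exp (-X)) := by
    refine (abs_add_le _ _).trans ?_
    rw [abs_mul, abs_of_nonneg hX0]
    linarith
  have h2 : exp (-X) = exp (-(X / 2)) * exp (-(X / 2)) := by rw [← exp_add]; ring_nf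
  have h3 : (X / 2 + 1) * exp (-(X / 2)) ≤ 1 := by
    rw [exp_neg, ← div_eq_mul_inv, div_le_one (exp_pos _)]
    exact add_one_le_exp _
  have h4 : 0 < exp (-(X / 2)) := exp_pos _
  rw [h2] at h1
  nlinarith

/-- The Fourier series has no constant mode, and its coefficients are absolutely summable because `X
≠ 0`. -/
theorem integral_pot {X : ℝ} (hX : X ≠ 0) (y : ℝ) : ∫ φ in (-π)..π, pot X (y + φ) = 0 := by
  have ha : 0 < |X| := abs_pos.2 hX
  set c : ℕ → ℂ := fun n => ((1 / ((n : ℝ) + 1) + |X| : ℝ) : ℂ) * nome |X| (- -y) ^ (n + 1) with hc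
  have hsum : Summable fun n => ‖c n‖ := by
    refine (summable_norm_pow_mul_nome ha (-y) ((1 + |X| : ℝ) : ℂ) 0).of_nonneg_of_le
      (fun n => norm_nonneg _) fun n => ?_
    rw [hc, pow_zero, one_mul, norm_mul, norm_mul, Complex.norm_real, Complex.norm_real]
    gcongr
    rw [norm_of_nonneg (by positivity), norm_of_nonneg (by positivity)]
    gcongr
    rw [div_le_one (by positivity)]
    linarith [(Nat.cast_nonneg n : (0 : ℝ) ≤ n)]
  have e : ∀ φ, pot X (y + φ) = (powerSeries c φ).re := fun φ => by
    have h1 := Complex.hasSum_re (summable_powerSeries hsum φ).hasSum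
    refine (hasSum_kernel ha |X| (y + φ)).unique (hasSum_of_eq h1 (funext fun n => ?_) rfl)
    rw [hc, mul_assoc, nome_pow_mul_exp, sub_neg_eq_add, add_comm φ]
  simp only [e]
  have h2 := integral_exp_mul_powerSeries hsum 0
  simp only [CharP.cast_eq_zero, zero_mul, Complex.exp_zero, one_mul] at h2
  have h3 := Complex.reCLM.intervalIntegral_comp_comm (μ := volume)
    ((continuous_powerSeries hsum).intervalIntegrable (-π) π)
  rw [h2] at h3
  simpa using h3

theorem isPairInteraction_potCyl : IsPairInteraction potCyl where
  zero := potCyl_zero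
  even s := by
    rcases eq_or_ne s 0 with rfl | hs
    · simp
    · rw [potCyl_eq hs, potCyl_eq (neg_ne_zero.2 hs)]
      simp
  cont := by
    have h : ContinuousOn (fun s : ℝ × Real.Angle =>
        -(log (2 * exp (-|s.1|) * (cosh s.1 - s.2.cos)) / 2) +
          |s.1| * ((sinh |s.1| / (cosh s.1 - s.2.cos) - 1) / 2)) {0}ᶜ := by
      have hcos : Continuous fun s : ℝ × Real.Angle => s.2.cos :=
        Real.Angle.continuous_cos.comp continuous_snd
      have hD : ∀ s ∈ ({0}ᶜ : Set (ℝ × Real.Angle)), cosh s.1 - s.2.cos ≠ 0 :=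
        fun s hs => (cosh_sub_cos_pos_of_ne_zero hs).ne'
      have hlog : ContinuousOn (fun s : ℝ × Real.Angle =>
          log (2 * exp (-|s.1|) * (cosh s.1 - s.2.cos))) {0}ᶜ := by
        refine ContinuousOn.log (Continuous.continuousOn (by fun_prop)) fun s hs => ?_
        exact mul_ne_zero (by positivity) (hD s hs)
      have hdiv : ContinuousOn (fun s : ℝ × Real.Angle =>
          sinh |s.1| / (cosh s.1 - s.2.cos)) {0}ᶜ :=
        ContinuousOn.div (Continuous.continuousOn (by fun_prop))
          (Continuous.continuousOn (by fun_prop)) hD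
      fun_prop
    exact h.congr fun s hs => potCyl_eq hs
  bddBelow := ⟨3, neg_three_le_potCyl⟩
  singular M := by
    have hcos : Continuous fun s : ℝ × Real.Angle => s.2.cos :=
      Real.Angle.continuous_cos.comp continuous_snd
    refine ⟨{s | |s.1| < 1} ∩
      {s | 2 * exp (-|s.1|) * (cosh s.1 - s.2.cos) < exp (-(2 * M) - 1)},
      (isOpen_lt (by fun_prop) (by fun_prop)).inter (isOpen_lt (by fun_prop) (by fun_prop)),
      ⟨?_, ?_⟩, fun s hs hs0 => le_potCyl_of_small hs0 hs.1 hs.2⟩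
    · change |(0 : ℝ)| < 1
      simp
    · change 2 * exp (-|(0 : ℝ)|) * (cosh 0 - (0 : Real.Angle).cos) < _
      simp [exp_pos]
  decay ε hε := by
    refine ⟨max 1 (2 * log (4 / ε)), fun s hs => ?_⟩
    have h1 : 1 ≤ s.1 := (le_max_left _ _).trans hs
    have h2 : 2 * log (4 / ε) ≤ s.1 := (le_max_right _ _).trans hs
    refine (abs_pot_le h1).trans ?_
    have h3 : exp (-(s.1 / 2)) ≤ exp (-log (4 / ε)) := exp_le_exp.2 (by linarith)
    rw [exp_neg (log _), exp_log (by positivity)] at h3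
    calc 4 * exp (-(s.1 / 2)) ≤ 4 * (4 / ε)⁻¹ := by gcongr
      _ = ε := by field_simp
  mean X θ hX := by
    induction θ using Real.Angle.induction_on with
    | _ y =>
    simp only [← Real.Angle.coe_add, potCyl_mk]
    exact integral_pot hX y

/-! ### Passage between strip and cylinder, and the bounds for the minimum. -/

/-- The point of the cylinder of circumference `2π` represented by a point of the strip. -/
def toCyl (h : ℝ) (z : ℝ × ℝ) : ℝ × Real.Angle := (z.1 / h, ((z.2 / h : ℝ) : Real.Angle))

theorem injOn_toCyl {h : ℝ} (hh : 0 < h) : InjOn (toCyl h) (strip h) := by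
  rintro z ⟨-, hz⟩ z' ⟨-, hz'⟩ e
  have e1 := congrArg Prod.fst e
  have e2 := congrArg Prod.snd e
  simp only [toCyl] at e1 e2
  refine Prod.ext ((div_left_inj' hh.ne').1 e1) ?_
  obtain ⟨k, hk⟩ := Real.Angle.angle_eq_iff_two_pi_dvd_sub.1 e2
  have h1 : z.2 - z'.2 = 2 * π * h * k := by field_simp at hk; linarith
  have hp : 0 < π * h := by positivity
  have h2 : (k : ℝ) < 1 := by nlinarith [hz.1, hz.2, hz'.1, hz'.2]
  have h3 : (-1 : ℝ) < k := by nlinarith [hz.1, hz.2, hz'.1, hz'.2]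
  have h4 : k < 1 := by exact_mod_cast h2
  have h5 : -1 < k := by exact_mod_cast h3
  have h6 : k = 0 := by omega
  rw [h6] at h1
  simp at h1
  linarith

theorem exists_mem_strip_toCyl_eq {h : ℝ} (hh : 0 < h) (s : ℝ × Real.Angle) :
    ∃ z ∈ strip h, toCyl h z = s := by
  obtain ⟨X, θ⟩ := s
  -- Representatives of angles lie in `(-π, π]`, while the strip is closed below and open above, so
  -- `π` must be replaced by `-π`.
  by_cases hπ : θ = (π : Real.Angle)
  · refine ⟨(X * h, -π * h), ⟨mem_univ _, by simp, by have := pi_pos; simp only; nlinarith⟩, ?_⟩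
    rw [toCyl, hπ, mul_div_cancel_right₀ _ hh.ne', mul_div_cancel_right₀ _ hh.ne',
      Real.Angle.coe_neg, Real.Angle.neg_coe_pi]
  · refine ⟨(X * h, θ.toReal * h), ⟨mem_univ _, ?_, ?_⟩, ?_⟩
    · have := (Real.Angle.neg_pi_lt_toReal θ).le
      simp only; nlinarith
    · have h1 : θ.toReal ≠ π := fun h => hπ (Real.Angle.toReal_eq_pi_iff.1 h)
      have := lt_of_le_of_ne (Real.Angle.toReal_le_pi θ) h1
      simp only; nlinarith
    · simp [toCyl, hh.ne']

theorem sum_sum_eq_sum_offDiag {ι : Type*} [DecidableEq ι] (s : Finset ι) (f : ι → ι → ℝ)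
    (hf : ∀ i, f i i = 0) : ∑ i ∈ s, ∑ j ∈ s, f i j = ∑ p ∈ s.offDiag, f p.1 p.2 := by
  rw [← Finset.sum_product', ← Finset.diag_union_offDiag, Finset.sum_union
    (Finset.disjoint_diag_offDiag s), Finset.sum_diag]
  simp [hf]

theorem pairEnergy_eq_sum_offDiag {ι : Type*} [DecidableEq ι] [DecidableEq (ℝ × Real.Angle)]
    (s : Finset ι) (X Y : ι → ℝ)
    (hinj : InjOn (fun i => (X i, (Y i : Real.Angle))) s) :
    pairEnergy potCyl (s.image fun i => (X i, (Y i : Real.Angle))) =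
      ∑ p ∈ s.offDiag, pot (X p.2 - X p.1) (Y p.2 - Y p.1) := by
  rw [pairEnergy, Finset.sum_image hinj]
  simp only [Finset.sum_image hinj, Prod.mk_sub_mk, ← Real.Angle.coe_sub, potCyl_mk]
  refine sum_sum_eq_sum_offDiag s (fun i j => pot (X j - X i) (Y j - Y i)) fun i => ?_
  rw [sub_self, sub_self, ← potCyl_mk]
  exact potCyl_zero

/-- The self energy is the same for all points, so minimizing the energy amounts to minimizing the
pair energy on the cylinder. -/
theorem energy_eq [DecidableEq (ℝ × Real.Angle)] {μ ν b h : ℝ} (hμ : 0 < μ) (hν₀ : 0 ≤ ν) (hν₁ : ν < 1) (hb : 0 < b) (hh : 0 < h)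
    {ω : Finset (ℝ × ℝ)} (hω : (ω : Set (ℝ × ℝ)) ⊆ strip h) :
    energy μ ν b h ω =
      scale μ ν b h * (ω.card * selfConst ν b h + pairEnergy potCyl (ω.image (toCyl h))) := by
  have hinj := (injOn_toCyl hh).mono hω
  have e := pairEnergy_eq_sum_offDiag ω (fun z => z.1 / h) (fun z => z.2 / h) hinj
  rw [energy, mul_add, show toCyl h = fun z => (z.1 / h, ((z.2 / h : ℝ) : Real.Angle)) from rfl, e,
    Finset.mul_sum]
  congr 1
  · simp only [uSelf_eq hμ hν₀ hν₁ hb hh, Finset.sum_const, nsmul_eq_mul]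
    ring
  · refine Finset.sum_congr rfl fun p hp => ?_
    obtain ⟨h1, h2, h3⟩ := Finset.mem_offDiag.1 hp
    rw [uInt_eq hμ hν₀ hν₁ hh (hω h1) (hω h2) h3, sub_div, sub_div]

theorem le_pairEnergy {ω : Finset (ℝ × Real.Angle)} (hω : ω.Nonempty) :
    -(ω.card * log ω.card) - 2 * ω.card ≤ pairEnergy potCyl ω := by
  classical
  have e : ∀ s : ℝ × Real.Angle, (s.1, (s.2.toReal : Real.Angle)) = s := fun s => by simp
  have h1 := pairEnergy_eq_sum_offDiag ω (fun s => s.1) (fun s => s.2.toReal)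
    (fun i _ j _ hij => by simpa only [e] using hij)
  simp only [e, Finset.image_id'] at h1
  rw [h1]
  refine le_sum_pot ω (fun s => s.1) (fun s => s.2.toReal) (fun i _ j _ hij => ?_) hω
  have h2 := cosh_sub_cos_pos_of_ne_zero (sub_ne_zero.2 hij.symm)
  rw [← e i, ← e j, Prod.mk_sub_mk, ← Real.Angle.coe_sub, Real.Angle.cos_coe] at h2
  exact h2

theorem exists_pairEnergy_eq {N : ℕ} (hN : 1 ≤ N) : ∃ ω : Finset (ℝ × Real.Angle),
    ω.card = N ∧ pairEnergy potCyl ω = -(N * log N) := by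
  classical
  have hN0 : (0 : ℝ) < N := by exact_mod_cast hN
  have hinj : InjOn (fun i : ℕ => ((0 : ℝ), ((2 * π * i / N : ℝ) : Real.Angle)))
      (Finset.range N : Finset ℕ) := by
    intro i hi j hj e
    have hi : i < N := by simpa using hi
    have hj : j < N := by simpa using hj
    obtain ⟨k, hk⟩ := Real.Angle.angle_eq_iff_two_pi_dvd_sub.1 (congrArg Prod.snd e)
    have hpi := pi_pos
    have h1 : (i : ℝ) - j = N * k := by
      field_simp at hk
      linarith
    have h2 : (i : ℤ) - j = N * k := by exact_mod_cast h1
    have h3 : k = 0 := by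
      by_contra hk0
      rcases lt_or_gt_of_ne hk0 with h | h <;> nlinarith
    rw [h3] at h2
    omega
  refine ⟨(Finset.range N).image fun i : ℕ => ((0 : ℝ), ((2 * π * i / N : ℝ) : Real.Angle)), ?_, ?_⟩
  · rw [Finset.card_image_of_injOn hinj, Finset.card_range]
  · rw [pairEnergy_eq_sum_offDiag _ (fun _ => 0) (fun i : ℕ => 2 * π * i / N) hinj, sub_self]
    exact sum_pot_equispaced hN

/-- The minimum of the energy exists and corresponds to a minimal configuration on the cylinder. -/
theorem exists_isLeast_energy {μ ν b h : ℝ} (hμ : 0 < μ) (hν₀ : 0 ≤ ν) (hν₁ : ν < 1) (hb : 0 < b)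
    (hh : 0 < h) {N : ℕ} (hN : 1 ≤ N) :
    ∃ e, IsLeast {E : ℝ | ∃ ω : Finset (ℝ × ℝ), (ω : Set (ℝ × ℝ)) ⊆ strip h ∧ ω.card = N ∧
        E = energy μ ν b h ω} (scale μ ν b h * (N * selfConst ν b h + e)) ∧
      -(N * log N) - 2 * N ≤ e ∧ e ≤ -(N * log N) := by
  classical
  have hscale : 0 ≤ scale μ ν b h := by
    have : 0 < 1 - ν := by linarith
    rw [scale, gammaZero]; positivity
  obtain ⟨ω, hω, hmin⟩ := exists_minimal_pairEnergy isPairInteraction_potCyl N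
  obtain ⟨ω₁, hω₁, hE₁⟩ := exists_pairEnergy_eq hN
  choose g hg hgeq using exists_mem_strip_toCyl_eq hh
  have hginj : Function.Injective g := fun s t hst => by rw [← hgeq s, hst, hgeq]
  have hgω : ((ω.image g : Finset (ℝ × ℝ)) : Set (ℝ × ℝ)) ⊆ strip h := by
    intro z hz
    obtain ⟨s, -, rfl⟩ := Finset.mem_image.1 (Finset.mem_coe.1 hz)
    exact hg s
  have hcard : (ω.image g).card = N := by rw [Finset.card_image_of_injective _ hginj, hω]
  refine ⟨pairEnergy potCyl ω, ⟨⟨ω.image g, hgω, hcard, ?_⟩, ?_⟩, ?_, hE₁ ▸ hmin ω₁ hω₁⟩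
  · rw [energy_eq hμ hν₀ hν₁ hb hh hgω, hcard, Finset.image_image]
    have : toCyl h ∘ g = id := funext hgeq
    rw [this, Finset.image_id]
  · rintro E ⟨ω', hω', hcard', rfl⟩
    rw [energy_eq hμ hν₀ hν₁ hb hh hω', hcard']
    have h1 := hmin (ω'.image (toCyl h))
      (by rw [Finset.card_image_of_injOn ((injOn_toCyl hh).mono hω'), hcard'])
    gcongr
  · have h1 := le_pairEnergy (Finset.card_pos.1 (hω ▸ hN))
    rwa [hω] at h1

end ReadShockley

end

/-! ### Assembly of the formula. -/

open ReadShockley in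
theorem theorem1 (μ ν b : ℝ) (hμ : 0 < μ) (hν₀ : 0 ≤ ν) (hν₁ : ν < 1) (hb : 0 < b) :
    ∃ C θ₀ : ℝ, 0 < θ₀ ∧
      ∀ (N : ℕ) (h : ℝ), 1 ≤ N → 0 < h → ReadShockley.tilt b h N < θ₀ →
        ReadShockley.EnergyWellDefined μ ν b h ∧
        ∃ m : ℝ,
          IsLeast {E : ℝ | ∃ ω : Finset (ℝ × ℝ), (ω : Set (ℝ × ℝ)) ⊆ ReadShockley.strip h ∧
            ω.card = N ∧ E = ReadShockley.energy μ ν b h ω} m ∧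
          |m - (-(ReadShockley.gammaZero μ ν b) * ReadShockley.tilt b h N *
              Real.log (ReadShockley.tilt b h N))| ≤ C * ReadShockley.tilt b h N := by
  have hν : 0 < 1 - ν := by linarith
  have hγ : 0 < gammaZero μ ν b := by have := Real.pi_pos; rw [gammaZero]; positivity
  have hpi := Real.pi_pos
  -- The constant adds the self energy error, the error `2N` in the pair energy, and the `log 2π`
  -- hidden in `θ`. The threshold `1/(2π)` says `N b < h`, whence `b ≤ h`.
  refine ⟨gammaZero μ ν b * (4 + 12 / (1 - ν) + 2 + |Real.log (2 * Real.pi)|), 1 / (2 * Real.pi),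
    by positivity, fun N h hN hh hθ => ⟨energyWellDefined hμ hν₀ hν₁ hb hh, ?_⟩⟩
  obtain ⟨e, hleast, he1, he2⟩ := exists_isLeast_energy hμ hν₀ hν₁ hb hh hN
  refine ⟨_, hleast, ?_⟩
  have hN1 : (1 : ℝ) ≤ N := by exact_mod_cast hN
  have hN0 : (0 : ℝ) < N := by linarith
  have hbh : b ≤ h := by
    rw [tilt, div_lt_div_iff₀ (by positivity) (by positivity)] at hθ
    have h1 : N * b < h := by nlinarith
    nlinarith
  have hS := abs_setIntegral_selfDensity_add_log_le hν₀ hν₁ hb hbh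
  change |selfConst ν b h + Real.log (b / h)| ≤ _ at hS
  have hθ0 : 0 < tilt b h N := by rw [tilt]; positivity
  have hlog : Real.log (tilt b h N) = Real.log N + Real.log (b / h) - Real.log (2 * Real.pi) := by
    rw [← Real.log_mul (by positivity) (by positivity), ← Real.log_div (by positivity)
      (by positivity), tilt]
    congr 1; field_simp
  have hsc : scale μ ν b h * N = gammaZero μ ν b * tilt b h N := by
    rw [scale, tilt]; ring
  have hfac : scale μ ν b h * (N * selfConst ν b h + e) -
      -(gammaZero μ ν b) * tilt b h N * Real.log (tilt b h N) =
      gammaZero μ ν b * tilt b h N * (selfConst ν b h + Real.log (b / h) +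
        (e / N + Real.log N) - Real.log (2 * Real.pi)) := by
    have : scale μ ν b h * (N * selfConst ν b h + e) =
        scale μ ν b h * N * (selfConst ν b h + e / N) := by field_simp
    rw [this, hsc, hlog]; ring
  have he : |e / N + Real.log N| ≤ 2 := by
    have h1 : e / N + Real.log N = (e + N * Real.log N) / N := by field_simp
    rw [h1, abs_div, abs_of_pos hN0, div_le_iff₀ hN0, abs_le]
    constructor <;> linarith
  rw [hfac, abs_mul, abs_of_pos (mul_pos hγ hθ0)]
  have hb1 : |selfConst ν b h + Real.log (b / h) + (e / N + Real.log N) - Real.log (2 * Real.pi)| ≤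
      4 + 12 / (1 - ν) + 2 + |Real.log (2 * Real.pi)| :=
    (abs_sub _ _).trans (by gcongr; exact (abs_add_le _ _).trans (by gcongr))
  calc _ ≤ gammaZero μ ν b * tilt b h N * (4 + 12 / (1 - ν) + 2 + |Real.log (2 * Real.pi)|) := by
        gcongr
    _ = _ := by ring
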